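/- Let $m\ge 0$ and consider the exterior Schwarzschild spacetime (Minkowski spacetime if $m=0$) $$g_{\mathrm{Sch}}=-h\,dt^2+h^{-1}dr^2+r^2\sigma,\qquad h=1-\tfrac{2m}{r},\quad r=|\mathbf x|>2m,$$ where $\sigma$ is the standard metric of the unit sphere $\mathbb S^2\subset\mathbb R^3$. Let $r_*=r+2m\log\left|\frac r{2m}-1\right|$ (with $r_*=r$ if $m=0$), and let $s_0>0$ with $2ms_0\le 1$. Let $\Sigma$ be a spacelike surface which is the graph $t=u(\mathbf x)$ of a function $u$ over $\{|\mathbf x|>1/s_0\}$. Write $s=1/r$ and $P(\mathbf y,s)=r_*-u$ at $\mathbf x=\mathbf y/s$, for $\mathbf y\in\mathbb S^2$ and $0<s<s_0$. Let $G$ be the induced metric of $\Sigma$, $\mathcal S$ the scalar curvature of $G$, $A$ the second fundamental form with respect to the future directed unit normal $\mathbf n$ (with $A(X,Y)=g_{\mathrm{Sch}}(\nabla_X\mathbf n,Y)$), $H=\frac13\operatorname{tr}_GA$ the mean curvature, and $\mathring A=A-HG$ the traceless part of $A$. Below, $f=O(s^k)$ means that $|f|\le Cs^k$ for all sufficiently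 small $s>0$, with a constant $C$ uniform in $\mathbf y\in\mathbb S^2$. Assume that $P$ extends to a smooth function on $\mathbb S^2\times[0,s_0)$, again denoted by $P$, and that $H=1+s^3\varphi$ on $\mathbb S^2\times(0,s_0)$ for some smooth function $\varphi$ on $\mathbb S^2\times[0,s_0)$. Then $|\mathring A|_G=O(s)$. Moreover: (a) The following are equivalent: (i) $|\mathring A|_G=O(s^2)$; (ii) $P(\cdot,0)$ is a linear combination of the first four eigenfunctions of the Laplacian of $(\mathbb S^2,\sigma)$, that is, a sum of elements of the eigenspaces of $-\Delta_\sigma$ for its two lowest eigenvalues $0$ and $2$ (of multiplicities $1$ and $3$); (iii) $|\mathring A|_G=O(s^3)$. If $H\equiv 1$ on $\Sigma$, they are also equivalent to $|\mathcal S+6|=O(s^6)$. (b) If $m>0$, the following are equivalent: (i) $|\mathring A|_G=O(s^4)$; (ii) $P(\cdot,0)$ is constant on $\mathbb S^2$ and $\partial_s^4P(\mathbf y,0)=-\frac{9m}{2}$ for all $\mathbf y\in\mathbb S^2$. -/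

import Mathlib

open Filter Set Metric Asymptotics Bornology
open scoped Manifold ContDiff

namespace SchwarzschildCMC

noncomputable section

/-! ### Pseudo-Riemannian geometry in one global coordinate system -/

/-- The coordinate space `ℝⁿ`, with the Euclidean norm. -/
abbrev E (n : ℕ) : Type := EuclideanSpace ℝ (Fin n)

/-- The partial derivative of `f` in the `i`-th coordinate direction. -/
def pderiv {n : ℕ} (i : Fin n) (f : E n → ℝ) (x : E n) : ℝ :=
  fderiv ℝ f x (EuclideanSpace.single i 1)

/-- The Christoffel symbol `Γ^k_{ij}` of the metric with coefficients `g x i j`. -/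
def christoffel {n : ℕ} (g : E n → Matrix (Fin n) (Fin n) ℝ) (k i j : Fin n) (x : E n) : ℝ :=
  (1 / 2) * ∑ l, (g x)⁻¹ k l *
    (pderiv i (fun z => g z j l) x + pderiv j (fun z => g z i l) x
      - pderiv l (fun z => g z i j) x)

/-- The Ricci curvature
`R_{ij} = ∂_k Γ^k_{ij} - ∂_j Γ^k_{ik} + Γ^k_{kl} Γ^l_{ij} - Γ^k_{jl} Γ^l_{ik}`. -/
def ricci {n : ℕ} (g : E n → Matrix (Fin n) (Fin n) ℝ) (i j : Fin n) (x : E n) : ℝ :=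
  ∑ k, (pderiv k (christoffel g k i j) x - pderiv j (christoffel g k i k) x
    + ∑ l, (christoffel g k k l x * christoffel g l i j x
      - christoffel g k j l x * christoffel g l i k x))

/-- The scalar curvature `g^{ij} R_{ij}`. -/
def scalarCurvature {n : ℕ} (g : E n → Matrix (Fin n) (Fin n) ℝ) (x : E n) : ℝ :=
  ∑ i, ∑ j, (g x)⁻¹ i j * ricci g i j x

/-! ### The exterior Schwarzschild spacetime

The coordinates of the spacetime are `(x⁰, x¹, x², x³) = (t, 𝐱)`, with `r = |𝐱| > 2m`. -/

/-- The spatial part `𝐱` of `(t, 𝐱)`. -/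
def spatial (X : E 4) : E 3 := WithLp.toLp 2 (fun i : Fin 3 => X i.succ)

/-- `h(r) = 1 - 2m/r`. -/
def lapse (m r : ℝ) : ℝ := 1 - 2 * m / r

/-- The function `r_* = r + 2m log |r/(2m) - 1|`; for `m = 0` it is `r`. -/
def tortoise (m r : ℝ) : ℝ := r + 2 * m * Real.log |r / (2 * m) - 1|

/-- The Schwarzschild metric `- h dt² + h⁻¹ dr² + r² σ` in the coordinates `(t, 𝐱)`.
Here `dr = 𝐱 · d𝐱 / r` and `r² σ = d𝐱 · d𝐱 - dr²`, so that the spatial part is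
`d𝐱 · d𝐱 + (h⁻¹ - 1) dr²`. -/
def schwarzschild (m : ℝ) (X : E 4) : Matrix (Fin 4) (Fin 4) ℝ :=
  let r := ‖spatial X‖
  Matrix.of fun a b =>
    Fin.cases
      (Fin.cases (-lapse m r) (fun _ => 0) b)
      (fun i => Fin.cases 0
        (fun j => (if i = j then 1 else 0)
          + ((lapse m r)⁻¹ - 1) * (spatial X i / r) * (spatial X j / r)) b) a

/-! ### Graphs `t = u(𝐱)`

The graph `Σ` of `u` is parametrized by `𝐱`, and tensors on `Σ` are given by their components
in the coordinates `𝐱 = (x¹, x², x³)`. -/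

/-- The parametrization `𝐱 ↦ (u(𝐱), 𝐱)` of the graph of `u`. -/
def graphMap (u : E 3 → ℝ) (x : E 3) : E 4 := WithLp.toLp 2 (Fin.cons (u x) (fun i => x i))

/-- The coordinate tangent vectors `e_i` of the graph: `frame u i x a` is the `a`-th component
of the derivative of the parametrization along `x^i`. -/
def frame (u : E 3 → ℝ) (i : Fin 3) (x : E 3) (a : Fin 4) : ℝ :=
  pderiv i (fun z => graphMap u z a) x

/-- The induced metric `G_{ij} = g(e_i, e_j)`. -/
def inducedMetric (m : ℝ) (u : E 3 → ℝ) (x : E 3) : Matrix (Fin 3) (Fin 3) ℝ :=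
  Matrix.of fun i j =>
    ∑ a, ∑ b, schwarzschild m (graphMap u x) a b * frame u i x a * frame u j x b

/-- The differential of `F = -t + u(𝐱)`, whose zero set is the graph. -/
def dF (u : E 3 → ℝ) (x : E 3) (a : Fin 4) : ℝ :=
  Fin.cases (-1) (fun i => pderiv i u x) a

/-- `- ⟨∇F, ∇F⟩`, which is positive where the graph is spacelike. -/
def normalFactor (m : ℝ) (u : E 3 → ℝ) (x : E 3) : ℝ :=
  -∑ a, ∑ b, (schwarzschild m (graphMap u x))⁻¹ a b * dF u x a * dF u x b

/-- The future directed unit normal `𝐧 = ∇F / (-⟨∇F, ∇F⟩)^{1/2}` of a spacelike graph; its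
`t`-component is positive, because the `t`-component of `∇F` is `h⁻¹`. -/
def unitNormal (m : ℝ) (u : E 3 → ℝ) (x : E 3) (a : Fin 4) : ℝ :=
  (Real.sqrt (normalFactor m u x))⁻¹ *
    ∑ b, (schwarzschild m (graphMap u x))⁻¹ a b * dF u x b

/-- The vector `∇_{e_i} e_j`, with `∇` the Levi-Civita connection of the Schwarzschild metric. -/
def frameCovDeriv (m : ℝ) (u : E 3 → ℝ) (i j : Fin 3) (x : E 3) (a : Fin 4) : ℝ :=
  pderiv i (fun z => frame u j z a) x
    + ∑ b, ∑ c, christoffel (schwarzschild m) a b c (graphMap u x) * frame u i x b * frame u j x c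

/-- The second fundamental form with respect to the future directed unit normal,
`A_{ij} = g(∇_{e_i} 𝐧, e_j) = - g(∇_{e_i} e_j, 𝐧)`. -/
def secondFF (m : ℝ) (u : E 3 → ℝ) (x : E 3) : Matrix (Fin 3) (Fin 3) ℝ :=
  Matrix.of fun i j =>
    -∑ a, ∑ b, schwarzschild m (graphMap u x) a b * frameCovDeriv m u i j x a * unitNormal m u x b

/-- The mean curvature `H`, one third of the trace of the second fundamental form. -/
def meanCurvature (m : ℝ) (u : E 3 → ℝ) (x : E 3) : ℝ :=
  (1 / 3) * ∑ i, ∑ j, (inducedMetric m u x)⁻¹ i j * secondFF m u x i j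

/-- The traceless part `Å = A - H G` of the second fundamental form. -/
def tracelessFF (m : ℝ) (u : E 3 → ℝ) (x : E 3) : Matrix (Fin 3) (Fin 3) ℝ :=
  secondFF m u x - meanCurvature m u x • inducedMetric m u x

/-- The norm `|Å|_G = (G^{ik} G^{jl} Å_{ij} Å_{kl})^{1/2}`. -/
def tracelessNorm (m : ℝ) (u : E 3 → ℝ) (x : E 3) : ℝ :=
  Real.sqrt (∑ i, ∑ j, ∑ k, ∑ l, (inducedMetric m u x)⁻¹ i k * (inducedMetric m u x)⁻¹ j l
    * tracelessFF m u x i j * tracelessFF m u x k l)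

/-! ### Functions on the unit sphere and near future null infinity -/

/-- The unit sphere of `ℝ³`. -/
abbrev S2 : Type := sphere (0 : E 3) 1

/-- `Q` is smooth on `𝕊² × [0, s₀)`, up to the boundary `s = 0`. -/
def SmoothUpToScri (s₀ : ℝ) (Q : S2 × ℝ → ℝ) : Prop :=
  ContMDiffOn ((𝓡 2).prod 𝓘(ℝ, ℝ)) 𝓘(ℝ, ℝ) ∞ Q (univ ×ˢ Ico 0 s₀)

/-- `f = O(s^k)` as `s = 1/r → 0`, uniformly on `𝕊²`, for a function `f` on the graph. -/
def IsBigOScri (f : E 3 → ℝ) (k : ℕ) : Prop :=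
  f =O[cobounded (E 3)] fun x => (‖x‖⁻¹) ^ k

/-- The extension of `f` to `ℝ³ ∖ {0}` that is constant along rays. -/
def radialExtension (f : S2 → ℝ) (x : E 3) : ℝ :=
  if hx : x = 0 then 0
  else f ⟨‖x‖⁻¹ • x, by
    rw [mem_sphere_zero_iff_norm, norm_smul, norm_inv, norm_norm,
      inv_mul_cancel₀ (norm_ne_zero_iff.2 hx)]⟩

/-- The Laplacian of the standard metric of `𝕊²`: on the unit sphere it is the Euclidean Laplacian
of the extension that is constant along rays. -/
def sphereLaplacian (f : S2 → ℝ) (y : S2) : ℝ :=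
  Laplacian.laplacian (radialExtension f) (y : E 3)

/-- `φ` is a smooth solution of `-Δφ = lam φ` on `𝕊²`. -/
def IsSphereEigenfunction (lam : ℝ) (φ : S2 → ℝ) : Prop :=
  ContMDiff (𝓡 2) 𝓘(ℝ, ℝ) ∞ φ ∧ ∀ y, -sphereLaplacian φ y = lam * φ y

/-- `f` is a linear combination of the first four eigenfunctions of the Laplacian of `𝕊²`. The
eigenvalues of `-Δ` in increasing order, with multiplicity, are `0, 2, 2, 2, 6, …`, so that the
span of the first four eigenfunctions is the span of the eigenspaces for `0` and `2`. -/
def IsFirstFourCombination (f : S2 → ℝ) : Prop :=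
  f ∈ Submodule.span ℝ {φ : S2 → ℝ | IsSphereEigenfunction 0 φ ∨ IsSphereEigenfunction 2 φ}

end

end SchwarzschildCMC

open SchwarzschildCMC

/-!
With `v = t - r_*`, the metric `s² g` is `-s² h dv² + 2 dv ds + σ`. It is smooth up to `s = 0`, which
is future null infinity, and the graph of `u` is the level set `v + P = 0`. For the metric `s² g` let
`-Q` be the square of the gradient of `v + P`, and let `K` be the Hessian of `v + P`, restricted to
the surface. The traceless part of the second fundamental form is conformally invariant up to a
factor, so that `|Å| = s Q^{-1/2} |K°|`, where `K°` is the traceless part of `K` and its norm is that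
of the metric `s² G`. The mean curvature satisfies `3 √Q H = 3 ω - s tr K`, where `ω` is the component
in the direction of `∂ₛ` of the gradient of `v + P`. All these quantities are polynomials in the two
jet of `P` and `1 / Q`; `ScriJet` collects them, and `ScriJet.Matches.hess_eq` is the comparison with
the geometry of the graph in Cartesian coordinates.

*The surface is spacelike up to null infinity.* Multiplied by `Q`, the equation for `H` has a limit as
`s → 0`, which gives `Q ∈ {0, 1}` at `s = 0`, and by connectedness `Q` is constant there. If it were
zero, then `Q` would have its maximum over `𝕊² × [0, s₁]` at a point with `s > 0`; there the equation
gives `√Q ≥ 1 - O(s₁)`, although the maximum is small with `s₁`. Hence `Q = 1` at `s = 0`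
(`ScriCMC.gradSq_zero_eq_one`), and `|Å| = O(s^{k+1})` if and only if the components of `K°` are
`O(s^k)` (`ScriCMC.isBigOScri_tracelessNorm_iff`). In particular `|Å| = O(s)`.

*First order.* At `s = 0` the tangential part of `K°` contains the traceless Hessian of `P(·, 0)` on
the sphere. If this vanishes, then `P(·, 0) = a + b · y` (`eq_add_of_traceless_hessian`), and these
functions are the combinations of the first four eigenfunctions (`isFirstFourCombination_iff`): for an
eigenfunction `ψ` for `2` the extension `|x| ψ` is harmonic, its partial derivatives are harmonic and
constant along rays, and such functions are constant.

*Second order.* Conversely let `P(·, 0) = a + b · y`. Then `Q = 1` determines `∂ₛP(·, 0)`, and the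
coefficients of `s` and `s²` in the equation for `H` determine `∂ₛ²P(·, 0)` and `∂ₛ³P(·, 0)`. With
these values `K` agrees up to `O(s²)` with `κ` times the metric, where `κ = -b · y - s (b · y)²`
(`AffineCMC.scriO_traceless_two`). So `|Å|` is `O(s³)` as soon as it is `O(s²)`.

*Third order.* The traceless tangential part of `K` at order `s²` is `3 m (B ⊗ B - |B|² / 2)`, where
`B` is the gradient of `b · y` on the sphere. If `m > 0`, it vanishes only for `b = 0`
(`AffineCMC.eq_zero_of_scriO`). For `b = 0` the only remaining coefficient of order `s²` is
`∂ₛ⁴P(·, 0) / 2 + 9 m / 4`, in the direction of `∂ₛ` (`AffineCMC.scriExp_devS_const`).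

*Scalar curvature.* The Gauss equation in the Ricci flat spacetime is `S = |Å|² - 6 H²`
(`SpacelikeOver.scalarCurvature_eq_traceless`), so that `|S + 6| = |Å|²` for `H = 1`.
-/

namespace SchwarzschildCMC

/-! ### Partial derivatives -/

/-- `f` is differentiable at `x`, with partial derivatives `f'`. -/
structure HasPD {n : ℕ} (f : E n → ℝ) (f' : Fin n → ℝ) (x : E n) : Prop where
  diff : DifferentiableAt ℝ f x
  eq : ∀ i, pderiv i f x = f' i

section HasPD

variable {n : ℕ} {f g : E n → ℝ} {f' g' : Fin n → ℝ} {x : E n}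

theorem DifferentiableAt.hasPD (h : DifferentiableAt ℝ f x) :
    HasPD f (fun i => pderiv i f x) x := ⟨h, fun _ => rfl⟩

theorem HasPD.congr_deriv (h : HasPD f f' x) (e : ∀ i, f' i = g' i) : HasPD f g' x :=
  ⟨h.diff, fun i => (h.eq i).trans (e i)⟩

theorem HasPD.congr_of_eventuallyEq (h : HasPD f f' x) (e : g =ᶠ[nhds x] f) : HasPD g f' x :=
  ⟨h.diff.congr_of_eventuallyEq e, fun i => by
    rw [← h.eq i, pderiv, pderiv, e.fderiv_eq]⟩

theorem pderiv_congr (e : g =ᶠ[nhds x] f) (i : Fin n) : pderiv i g x = pderiv i f x := by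
  rw [pderiv, pderiv, e.fderiv_eq]

theorem HasPD.const (c : ℝ) : HasPD (fun _ : E n => c) (fun _ => 0) x :=
  ⟨differentiableAt_const c, fun i => by simp [pderiv]⟩

theorem HasPD.add (hf : HasPD f f' x) (hg : HasPD g g' x) :
    HasPD (fun z => f z + g z) (fun i => f' i + g' i) x :=
  ⟨hf.diff.add hg.diff, fun i => by
    rw [← hf.eq i, ← hg.eq i, pderiv, fderiv_fun_add hf.diff hg.diff]; rfl⟩

theorem HasPD.sub (hf : HasPD f f' x) (hg : HasPD g g' x) :
    HasPD (fun z => f z - g z) (fun i => f' i - g' i) x :=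
  ⟨hf.diff.sub hg.diff, fun i => by
    rw [← hf.eq i, ← hg.eq i, pderiv, fderiv_fun_sub hf.diff hg.diff]; rfl⟩

theorem HasPD.neg (hf : HasPD f f' x) : HasPD (fun z => -f z) (fun i => -f' i) x :=
  ⟨hf.diff.neg, fun i => by rw [← hf.eq i, pderiv, fderiv_fun_neg]; rfl⟩

theorem HasPD.mul (hf : HasPD f f' x) (hg : HasPD g g' x) :
    HasPD (fun z => f z * g z) (fun i => f' i * g x + f x * g' i) x :=
  ⟨hf.diff.mul hg.diff, fun i => by
    rw [← hf.eq i, ← hg.eq i, pderiv, fderiv_fun_mul hf.diff hg.diff]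
    simp [pderiv]; ring⟩

theorem HasPD.const_mul (c : ℝ) (hf : HasPD f f' x) :
    HasPD (fun z => c * f z) (fun i => c * f' i) x :=
  ((HasPD.const c).mul hf).congr_deriv fun i => by ring

theorem HasPD.comp {φ : ℝ → ℝ} {φ' : ℝ} (hφ : HasDerivAt φ φ' (f x)) (hf : HasPD f f' x) :
    HasPD (fun z => φ (f z)) (fun i => φ' * f' i) x :=
  ⟨hφ.differentiableAt.comp x hf.diff, fun i => by
    have := (hφ.comp_hasFDerivAt x hf.diff.hasFDerivAt).fderiv
    rw [← hf.eq i, pderiv]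
    simp only [Function.comp_def] at this
    rw [this]; simp [pderiv]⟩

theorem HasPD.sum {ι : Type*} (s : Finset ι) {F : ι → E n → ℝ} {F' : ι → Fin n → ℝ}
    (h : ∀ a ∈ s, HasPD (F a) (F' a) x) :
    HasPD (fun z => ∑ a ∈ s, F a z) (fun i => ∑ a ∈ s, F' a i) x :=
  ⟨DifferentiableAt.fun_sum fun a ha => (h a ha).diff, fun i => by
    rw [pderiv, fderiv_fun_sum fun a ha => (h a ha).diff, sum_apply]
    exact Finset.sum_congr rfl fun a ha => (h a ha).eq i⟩

theorem HasPD.coord (j : Fin n) : HasPD (fun z : E n => z j) (fun i => if i = j then 1 else 0) x := by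
  have h : HasFDerivAt (fun z : E n => z j) (EuclideanSpace.proj j : E n →L[ℝ] ℝ) x :=
    (EuclideanSpace.proj j : E n →L[ℝ] ℝ).hasFDerivAt
  refine ⟨h.differentiableAt, fun i => ?_⟩
  rw [pderiv, h.fderiv]
  simp [eq_comm]

theorem HasPD.norm (hx : x ≠ 0) : HasPD (fun z : E n => ‖z‖) (fun i => x i / ‖x‖) x := by
  have hd : DifferentiableAt ℝ (fun z : E n => ‖z‖) x := differentiableAt_id.norm ℝ hx
  have h2 : HasPD (fun z : E n => ‖z‖ ^ 2) (fun i => 2 * x i) x := by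
    have : (fun z : E n => ‖z‖ ^ 2) = fun z => ∑ j, z j * z j := by
      funext z; rw [EuclideanSpace.norm_sq_eq]; simp [sq]
    rw [this]
    refine (HasPD.sum Finset.univ fun j _ => (HasPD.coord j).mul (HasPD.coord j)).congr_deriv ?_
    intro i; simp [Finset.sum_add_distrib]; ring
  refine ⟨hd, fun i => ?_⟩
  have h3 := (hd.hasPD.comp (hasDerivAt_pow 2 ‖x‖)).eq i
  rw [h2.eq i] at h3
  have : ‖x‖ ≠ 0 := norm_ne_zero_iff.2 hx
  field_simp
  simp at h3; linarith

end HasPD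

theorem sum_sq_eq_norm_sq {n : ℕ} (x : E n) : ∑ i, x i * x i = ‖x‖ ^ 2 := by
  rw [EuclideanSpace.norm_sq_eq]; simp [sq]

theorem fderiv_eq_sum_pderiv {n : ℕ} (f : E n → ℝ) (x v : E n) :
    fderiv ℝ f x v = ∑ i, v i * pderiv i f x := by
  conv_lhs => rw [← (EuclideanSpace.basisFun (Fin n) ℝ).sum_repr v]
  simp [map_sum, pderiv]

section Smooth

variable {n : ℕ} {f : E n → ℝ} {U : Set (E n)} {x : E n}

theorem contDiffOn_pderiv (hU : IsOpen U) (hf : ContDiffOn ℝ ∞ f U) (i : Fin n) :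
    ContDiffOn ℝ ∞ (pderiv i f) U :=
  (hf.fderiv_of_isOpen hU (m := ∞) le_rfl).clm_apply contDiffOn_const

theorem ContDiffOn.hasPD (hU : IsOpen U) (hf : ContDiffOn ℝ ∞ f U) (hx : x ∈ U) :
    HasPD f (fun i => pderiv i f x) x :=
  DifferentiableAt.hasPD ((hf.contDiffAt (hU.mem_nhds hx)).differentiableAt (by simp))

theorem pderiv_comm (hU : IsOpen U) (hf : ContDiffOn ℝ ∞ f U) (hx : x ∈ U) (i j : Fin n) :
    pderiv i (pderiv j f) x = pderiv j (pderiv i f) x := by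
  have hc : ContDiffAt ℝ ∞ f x := hf.contDiffAt (hU.mem_nhds hx)
  have hs : IsSymmSndFDerivAt ℝ f x := hc.isSymmSndFDerivAt (by simp; exact WithTop.coe_le_coe.2 le_top)
  have hd : DifferentiableAt ℝ (fderiv ℝ f) x :=
    (hc.fderiv_right (m := 1) (by exact WithTop.coe_le_coe.2 le_top)).differentiableAt (by simp)
  have key : ∀ a b : Fin n, pderiv a (pderiv b f) x
      = fderiv ℝ (fderiv ℝ f) x (EuclideanSpace.single a 1) (EuclideanSpace.single b 1) := by
    intro a b
    have := (hd.hasFDerivAt.clm_apply (hasFDerivAt_const (EuclideanSpace.single b (1 : ℝ)) x)).fderiv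
    rw [pderiv]
    change fderiv ℝ (fun z => fderiv ℝ f z (EuclideanSpace.single b 1)) x _ = _
    rw [this]; simp
  rw [key, key, hs.eq]

end Smooth

/-! ### The Schwarzschild metric in Cartesian coordinates -/

/-- The components `y = 𝐱 / r` of the unit radial vector. -/
noncomputable def unitDir (x : E 3) (i : Fin 3) : ℝ := x i / ‖x‖

/-- The radial derivative `y · ∇u`. -/
noncomputable def radialDeriv (u : E 3 → ℝ) (x : E 3) : ℝ := ∑ k, pderiv k u x * unitDir x k

theorem sum_unitDir_sq {x : E 3} (hx : x ≠ 0) : ∑ i, unitDir x i * unitDir x i = 1 := by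
  have h := sum_sq_eq_norm_sq x
  have : ‖x‖ ≠ 0 := norm_ne_zero_iff.2 hx
  simp only [unitDir, Fin.sum_univ_three] at *
  field_simp
  linarith

theorem hasPD_unitDir {x : E 3} (hx : x ≠ 0) (i : Fin 3) :
    HasPD (fun z => unitDir z i)
      (fun k => ((if k = i then 1 else 0) - unitDir x k * unitDir x i) / ‖x‖) x := by
  have h0 : ‖x‖ ≠ 0 := norm_ne_zero_iff.2 hx
  refine ((HasPD.coord i).mul ((HasPD.norm hx).comp (hasDerivAt_inv h0))).congr_deriv ?_
  intro k
  simp only [unitDir]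
  field_simp
  ring

theorem hasDerivAt_lapse (m : ℝ) {r : ℝ} (hr : r ≠ 0) :
    HasDerivAt (lapse m) (2 * m / r ^ 2) r := by
  have h := ((hasDerivAt_inv hr).const_mul (2 * m)).const_sub 1
  refine (h.congr_deriv (by field_simp; try ring)).congr_of_eventuallyEq ?_
  filter_upwards with z
  simp [lapse, div_eq_mul_inv]

theorem hasPD_lapse (m : ℝ) {x : E 3} (hx : x ≠ 0) :
    HasPD (fun z => lapse m ‖z‖) (fun k => 2 * m / ‖x‖ ^ 2 * unitDir x k) x :=
  (HasPD.norm hx).comp (hasDerivAt_lapse m (norm_ne_zero_iff.2 hx))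

theorem hasPD_lapse_inv (m : ℝ) {x : E 3} (hx : x ≠ 0) (hh : lapse m ‖x‖ ≠ 0) :
    HasPD (fun z => (lapse m ‖z‖)⁻¹)
      (fun k => -(2 * m / ‖x‖ ^ 2) / lapse m ‖x‖ ^ 2 * unitDir x k) x :=
  (HasPD.comp (hasDerivAt_inv hh) (hasPD_lapse m hx)).congr_deriv fun k => by ring

/-- The spatial part of the Schwarzschild metric. -/
noncomputable def spatialMetric (m : ℝ) (x : E 3) (i j : Fin 3) : ℝ :=
  (if i = j then 1 else 0) + ((lapse m ‖x‖)⁻¹ - 1) * unitDir x i * unitDir x j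

theorem hasPD_spatialMetric (m : ℝ) {x : E 3} (hx : x ≠ 0) (hh : lapse m ‖x‖ ≠ 0) (i j : Fin 3) :
    HasPD (fun z => spatialMetric m z i j) (fun k =>
      -(2 * m / ‖x‖ ^ 2) / lapse m ‖x‖ ^ 2 * unitDir x k * unitDir x i * unitDir x j
      + ((lapse m ‖x‖)⁻¹ - 1) *
        (((if k = i then 1 else 0) - unitDir x k * unitDir x i) / ‖x‖ * unitDir x j
        + unitDir x i * (((if k = j then 1 else 0) - unitDir x k * unitDir x j) / ‖x‖))) x :=
  ((HasPD.const _).add ((((hasPD_lapse_inv m hx hh).sub (HasPD.const 1)).mul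
    (hasPD_unitDir hx i)).mul (hasPD_unitDir hx j))).congr_deriv fun k => by ring

theorem sum_fin_four (f : Fin 4 → ℝ) : ∑ a, f a = f 0 + ∑ i : Fin 3, f i.succ :=
  Fin.sum_univ_succ f

@[simp] theorem spatial_graphMap (u : E 3 → ℝ) (x : E 3) : spatial (graphMap u x) = x := by
  ext i; simp [spatial, graphMap]

theorem frame_zero (u : E 3 → ℝ) (i : Fin 3) (x : E 3) : frame u i x 0 = pderiv i u x := rfl

theorem frame_succ (u : E 3 → ℝ) (i k : Fin 3) (x : E 3) :
    frame u i x k.succ = if i = k then 1 else 0 :=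
  (HasPD.coord k).eq i

theorem schwarzschild_zero_zero (m : ℝ) (X : E 4) :
    schwarzschild m X 0 0 = -lapse m ‖spatial X‖ := rfl

theorem schwarzschild_zero_succ (m : ℝ) (X : E 4) (i : Fin 3) :
    schwarzschild m X 0 i.succ = 0 := rfl

theorem schwarzschild_succ_zero (m : ℝ) (X : E 4) (i : Fin 3) :
    schwarzschild m X i.succ 0 = 0 := rfl

theorem schwarzschild_succ_succ (m : ℝ) (X : E 4) (i j : Fin 3) :
    schwarzschild m X i.succ j.succ = spatialMetric m (spatial X) i j := rfl

theorem HasPD.comp_spatial {f : E 3 → ℝ} {f' : Fin 3 → ℝ} {X : E 4} (h : HasPD f f' (spatial X)) :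
    HasPD (fun Z => f (spatial Z)) (fun a => Fin.cases 0 f' a) X := by
  let L : E 4 →ₗ[ℝ] E 3 :=
    { toFun := spatial
      map_add' := fun a b => by ext i; simp [spatial]
      map_smul' := fun c a => by ext i; simp [spatial] }
  have hL : HasFDerivAt spatial (LinearMap.toContinuousLinearMap L) X :=
    (LinearMap.toContinuousLinearMap L).hasFDerivAt
  have hc := h.diff.hasFDerivAt.comp X hL
  refine ⟨hc.differentiableAt, fun a => ?_⟩
  have := hc.fderiv
  simp only [Function.comp_def] at this
  rw [pderiv, this]
  have hs : ∀ a : Fin 4, L (EuclideanSpace.single a 1)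
      = Fin.cases 0 (fun i => EuclideanSpace.single i 1) a := by
    intro a
    refine Fin.cases ?_ (fun i => ?_) a <;> ext j <;> simp [L, spatial, Fin.succ_ne_zero]
  simp only [ContinuousLinearMap.comp_apply, LinearMap.coe_toContinuousLinearMap', hs]
  refine Fin.cases ?_ (fun i => ?_) a
  · simp
  · exact h.eq i

/-- The inverse of the Schwarzschild metric. -/
noncomputable def schwarzschildInv (m : ℝ) (x : E 3) : Matrix (Fin 4) (Fin 4) ℝ :=
  Matrix.of fun a b =>
    Fin.cases
      (Fin.cases (-(lapse m ‖x‖)⁻¹) (fun _ => 0) b)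
      (fun i => Fin.cases 0
        (fun j => (if i = j then 1 else 0)
          + (lapse m ‖x‖ - 1) * unitDir x i * unitDir x j) b) a

theorem schwarzschild_mul_inv (m : ℝ) (X : E 4) (hx : spatial X ≠ 0)
    (hh : lapse m ‖spatial X‖ ≠ 0) :
    schwarzschild m X * schwarzschildInv m (spatial X) = 1 := by
  have hy := sum_unitDir_sq hx
  ext a b
  rw [Matrix.mul_apply, sum_fin_four]
  refine Fin.cases ?_ (fun i => ?_) a <;> refine Fin.cases ?_ (fun j => ?_) b
  · simp [schwarzschild_zero_zero, schwarzschild_zero_succ, schwarzschildInv, hh]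
  · simp [schwarzschild_zero_zero, schwarzschild_zero_succ, schwarzschildInv,
      (Fin.succ_ne_zero j).symm]
  · simp [schwarzschild_succ_zero, schwarzschild_succ_succ, schwarzschildInv, Fin.succ_ne_zero]
  · simp only [schwarzschild_succ_zero, schwarzschild_succ_succ, schwarzschildInv, spatialMetric,
      Matrix.of_apply, Fin.cases_succ, Fin.cases_zero, zero_mul, zero_add, Matrix.one_apply,
      Fin.succ_inj]
    have : ∀ k : Fin 3, ((if i = k then (1 : ℝ) else 0)
        + ((lapse m ‖spatial X‖)⁻¹ - 1) * unitDir (spatial X) i * unitDir (spatial X) k) *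
        ((if k = j then 1 else 0)
        + (lapse m ‖spatial X‖ - 1) * unitDir (spatial X) k * unitDir (spatial X) j)
        = (if i = k then (if k = j then 1 else 0) else 0)
        + (if i = k then (lapse m ‖spatial X‖ - 1) * unitDir (spatial X) k * unitDir (spatial X) j
            else 0)
        + (if k = j then ((lapse m ‖spatial X‖)⁻¹ - 1) * unitDir (spatial X) i
            * unitDir (spatial X) k else 0)
        + ((lapse m ‖spatial X‖)⁻¹ - 1) * (lapse m ‖spatial X‖ - 1) * unitDir (spatial X) i
          * unitDir (spatial X) j * (unitDir (spatial X) k * unitDir (spatial X) k) := by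
      intro k; split_ifs <;> ring
    simp only [this, Finset.sum_add_distrib, ← Finset.mul_sum, hy, Finset.sum_ite_eq,
      Finset.sum_ite_eq', Finset.mem_univ, if_true]
    field_simp
    ring

theorem schwarzschild_inv (m : ℝ) (X : E 4) (hx : spatial X ≠ 0)
    (hh : lapse m ‖spatial X‖ ≠ 0) :
    (schwarzschild m X)⁻¹ = schwarzschildInv m (spatial X) :=
  Matrix.inv_eq_right_inv (schwarzschild_mul_inv m X hx hh)

/-! ### Geometry of a graph in terms of the derivatives of `u` -/

theorem inducedMetric_apply (m : ℝ) (u : E 3 → ℝ) (x : E 3) (i j : Fin 3) :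
    inducedMetric m u x i j
      = spatialMetric m x i j - lapse m ‖x‖ * pderiv i u x * pderiv j u x := by
  simp only [inducedMetric, Matrix.of_apply, sum_fin_four, frame_zero, frame_succ,
    schwarzschild_zero_zero, schwarzschild_zero_succ, schwarzschild_succ_zero,
    schwarzschild_succ_succ, spatial_graphMap]
  simp
  ring

theorem inv_mul_dF (m : ℝ) (u : E 3 → ℝ) (x : E 3) (a : Fin 4) :
    ∑ b, schwarzschildInv m x a b * dF u x b
      = Fin.cases (lapse m ‖x‖)⁻¹
        (fun i => pderiv i u x + (lapse m ‖x‖ - 1) * radialDeriv u x * unitDir x i) a := by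
  rw [sum_fin_four]
  refine Fin.cases ?_ (fun i => ?_) a
  · simp [schwarzschildInv, dF]
  · simp only [schwarzschildInv, dF, Matrix.of_apply, Fin.cases_succ, Fin.cases_zero, zero_mul,
      zero_add, add_mul, Finset.sum_add_distrib, ite_mul, one_mul, Finset.sum_ite_eq,
      Finset.mem_univ, if_true, radialDeriv, Finset.mul_sum, Finset.sum_mul]
    congr 1
    exact Finset.sum_congr rfl fun k _ => by ring

theorem normalFactor_eq (m : ℝ) (u : E 3 → ℝ) {x : E 3} (hx : x ≠ 0) (hh : lapse m ‖x‖ ≠ 0) :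
    normalFactor m u x = (lapse m ‖x‖)⁻¹ - (∑ i, pderiv i u x * pderiv i u x
      + (lapse m ‖x‖ - 1) * radialDeriv u x ^ 2) := by
  have h1 : ∀ a, ∑ b, (schwarzschild m (graphMap u x))⁻¹ a b * dF u x a * dF u x b
      = dF u x a * ∑ b, schwarzschildInv m x a b * dF u x b := by
    intro a
    rw [schwarzschild_inv m _ (by simpa using hx) (by simpa using hh), spatial_graphMap,
      Finset.mul_sum]
    exact Finset.sum_congr rfl fun b _ => by ring
  have h2 : ∑ i, pderiv i u x * ((lapse m ‖x‖ - 1) * radialDeriv u x * unitDir x i)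
      = (lapse m ‖x‖ - 1) * radialDeriv u x ^ 2 := by
    rw [sq, ← mul_assoc]
    conv_rhs => rw [radialDeriv, Finset.mul_sum]
    exact Finset.sum_congr rfl fun k _ => by simp only [radialDeriv]; ring
  simp only [normalFactor, h1, inv_mul_dF]
  simp only [sum_fin_four, dF, Fin.cases_succ, Fin.cases_zero, mul_add, Finset.sum_add_distrib, h2]
  ring

/-- The time component of the covariant derivative `∇_{e_i} e_j`. -/
noncomputable def timeHess (m : ℝ) (u : E 3 → ℝ) (x : E 3) (i j : Fin 3) : ℝ :=
  pderiv i (pderiv j u) x + m / ‖x‖ ^ 2 / lapse m ‖x‖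
    * (unitDir x i * pderiv j u x + pderiv i u x * unitDir x j)

/-- The spatial components of the covariant derivative `∇_{e_i} e_j` are `y` times this form. -/
noncomputable def radialHess (m : ℝ) (u : E 3 → ℝ) (x : E 3) (i j : Fin 3) : ℝ :=
  -(m / ‖x‖ ^ 2 / lapse m ‖x‖) * unitDir x i * unitDir x j
    + (1 - lapse m ‖x‖) / ‖x‖ * ((if i = j then 1 else 0) - unitDir x i * unitDir x j)
    + m / ‖x‖ ^ 2 * lapse m ‖x‖ * pderiv i u x * pderiv j u x

theorem pderiv_schwarzschild_zero_zero (m : ℝ) (u : E 3 → ℝ) {x : E 3} (hx : x ≠ 0) (a : Fin 4) :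
    pderiv a (fun z => schwarzschild m z 0 0) (graphMap u x)
      = Fin.cases 0 (fun k => -(2 * m / ‖x‖ ^ 2 * unitDir x k)) a := by
  have := (HasPD.comp_spatial (X := graphMap u x)
    (by simpa using (hasPD_lapse m hx).neg)).eq a
  exact this

theorem pderiv_schwarzschild_succ_succ (m : ℝ) (u : E 3 → ℝ) {x : E 3} (hx : x ≠ 0)
    (hh : lapse m ‖x‖ ≠ 0) (a : Fin 4) (i j : Fin 3) :
    pderiv a (fun z => schwarzschild m z i.succ j.succ) (graphMap u x)
      = Fin.cases 0 (fun k =>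
      -(2 * m / ‖x‖ ^ 2) / lapse m ‖x‖ ^ 2 * unitDir x k * unitDir x i * unitDir x j
      + ((lapse m ‖x‖)⁻¹ - 1) *
        (((if k = i then 1 else 0) - unitDir x k * unitDir x i) / ‖x‖ * unitDir x j
        + unitDir x i * (((if k = j then 1 else 0) - unitDir x k * unitDir x j) / ‖x‖))) a := by
  have := (HasPD.comp_spatial (X := graphMap u x)
    (by simpa using hasPD_spatialMetric m hx hh i j)).eq a
  exact this

theorem pderiv_schwarzschild_mixed (m : ℝ) (X : E 4) (a : Fin 4) (i : Fin 3) :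
    pderiv a (fun z => schwarzschild m z i.succ 0) X = 0 ∧
    pderiv a (fun z => schwarzschild m z 0 i.succ) X = 0 :=
  ⟨(HasPD.const 0).eq a, (HasPD.const 0).eq a⟩

/-- The components of `∇_{e_i} e_j`. -/
theorem frameCovDeriv_eq (m : ℝ) (u : E 3 → ℝ) {x : E 3} (hx : x ≠ 0)
    (hh : lapse m ‖x‖ ≠ 0) (i j : Fin 3) (a : Fin 4) :
    frameCovDeriv m u i j x a
      = Fin.cases (timeHess m u x i j) (fun k => unitDir x k * radialHess m u x i j) a := by
  have hy := sum_unitDir_sq hx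
  have hG : ∀ a b c, christoffel (schwarzschild m) a b c (graphMap u x)
      = (1 / 2) * ∑ l, schwarzschildInv m x a l *
    (pderiv b (fun z => schwarzschild m z c l) (graphMap u x)
      + pderiv c (fun z => schwarzschild m z b l) (graphMap u x)
      - pderiv l (fun z => schwarzschild m z b c) (graphMap u x)) := by
    intro a b c
    rw [christoffel, schwarzschild_inv m _ (by simpa using hx) (by simpa using hh),
      spatial_graphMap]
  have hr : ‖x‖ ≠ 0 := norm_ne_zero_iff.2 hx
  set C : Fin 4 → Fin 4 → Fin 4 → ℝ := fun l b c =>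
    pderiv b (fun z => schwarzschild m z c l) (graphMap u x)
      + pderiv c (fun z => schwarzschild m z b l) (graphMap u x)
      - pderiv l (fun z => schwarzschild m z b c) (graphMap u x) with hC
  have hsum : ∀ l, ∑ b, ∑ c, C l b c * frame u i x b * frame u j x c
      = C l 0 0 * pderiv i u x * pderiv j u x + C l 0 j.succ * pderiv i u x
        + C l i.succ 0 * pderiv j u x + C l i.succ j.succ := by
    intro l
    simp only [sum_fin_four, frame_zero, frame_succ]
    simp [Finset.sum_add_distrib]
    ring
  -- the covariant derivative with its index lowered
  have hL : ∀ l, ∑ b, ∑ c, C l b c * frame u i x b * frame u j x c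
      = Fin.cases (-(2 * (m / ‖x‖ ^ 2) * (unitDir x i * pderiv j u x + pderiv i u x * unitDir x j)))
        (fun k => unitDir x k * (2 / lapse m ‖x‖ * radialHess m u x i j)) l := by
    intro l
    rw [hsum]
    refine Fin.cases ?_ (fun k => ?_) l
    · simp only [hC, pderiv_schwarzschild_zero_zero m u hx, pderiv_schwarzschild_succ_succ m u hx hh,
        pderiv_schwarzschild_mixed, Fin.cases_zero, Fin.cases_succ]
      ring
    · simp only [hC, pderiv_schwarzschild_zero_zero m u hx, pderiv_schwarzschild_succ_succ m u hx hh,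
        pderiv_schwarzschild_mixed, Fin.cases_zero, Fin.cases_succ, radialHess, eq_comm (a := k),
        eq_comm (a := j) (b := i)]
      field_simp
      ring
  have hD : frameCovDeriv m u i j x a = pderiv i (fun z => frame u j z a) x
      + (1 / 2) * ∑ l, schwarzschildInv m x a l *
        ∑ b, ∑ c, C l b c * frame u i x b * frame u j x c := by
    simp only [frameCovDeriv, hG, Finset.mul_sum, Finset.sum_mul]
    congr 1
    rw [Finset.sum_comm' (t' := Finset.univ) (s' := fun _ => Finset.univ) (by simp)]
    conv_rhs => rw [Finset.sum_comm]
    rw [Finset.sum_comm]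
    refine Finset.sum_congr rfl fun b _ => ?_
    rw [Finset.sum_comm]
    refine Finset.sum_congr rfl fun l _ => ?_
    refine Finset.sum_congr rfl fun c _ => ?_
    simp only [hC]
    ring
  rw [hD]
  simp only [hL]
  rw [sum_fin_four]
  refine Fin.cases ?_ (fun k => ?_) a
  · have : pderiv i (fun z => frame u j z 0) x = pderiv i (pderiv j u) x := rfl
    simp only [this, schwarzschildInv, Matrix.of_apply, Fin.cases_zero, Fin.cases_succ, zero_mul,
      Finset.sum_const_zero, add_zero, timeHess]
    field_simp
  · have : pderiv i (fun z => frame u j z k.succ) x = 0 := by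
      simp only [frame_succ]
      exact (HasPD.const _).eq i
    have h3 : ∑ l, ((if k = l then 1 else 0) + (lapse m ‖x‖ - 1) * unitDir x k * unitDir x l)
        * (unitDir x l * (2 / lapse m ‖x‖ * radialHess m u x i j))
        = unitDir x k * (2 * radialHess m u x i j) := by
      have : ∀ l, ((if k = l then 1 else 0) + (lapse m ‖x‖ - 1) * unitDir x k * unitDir x l)
        * (unitDir x l * (2 / lapse m ‖x‖ * radialHess m u x i j))
        = (if k = l then unitDir x l * (2 / lapse m ‖x‖ * radialHess m u x i j) else 0)
          + (lapse m ‖x‖ - 1) * unitDir x k * (2 / lapse m ‖x‖ * radialHess m u x i j)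
            * (unitDir x l * unitDir x l) := by
        intro l; split_ifs <;> ring
      simp only [this, Finset.sum_add_distrib, ← Finset.mul_sum, hy, Finset.sum_ite_eq,
        Finset.mem_univ, if_true]
      field_simp
      ring
    simp only [this, schwarzschildInv, Matrix.of_apply, Fin.cases_zero, Fin.cases_succ, zero_mul,
      zero_add, h3]
    ring

/-- The second fundamental form is `-dF(∇_{e_i} e_j)`, up to normalization. -/
theorem secondFF_eq (m : ℝ) (u : E 3 → ℝ) {x : E 3} (hx : x ≠ 0)
    (hh : lapse m ‖x‖ ≠ 0) (i j : Fin 3) :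
    secondFF m u x i j = (Real.sqrt (normalFactor m u x))⁻¹
      * (timeHess m u x i j - radialDeriv u x * radialHess m u x i j) := by
  -- the unit normal is the normalized gradient of `F`
  have hn : ∀ a, ∑ b, schwarzschild m (graphMap u x) a b * unitNormal m u x b
      = (Real.sqrt (normalFactor m u x))⁻¹ * dF u x a := by
    intro a
    have h1 := schwarzschild_mul_inv m (graphMap u x) (by simpa using hx) (by simpa using hh)
    have h2 : (schwarzschild m (graphMap u x)).mulVec
        ((schwarzschild m (graphMap u x))⁻¹.mulVec (dF u x)) a = dF u x a := by
      rw [schwarzschild_inv m _ (by simpa using hx) (by simpa using hh), Matrix.mulVec_mulVec, h1,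
        Matrix.one_mulVec]
    simp only [unitNormal]
    rw [← h2]
    simp only [Matrix.mulVec, dotProduct, Finset.mul_sum]
    refine Finset.sum_congr rfl fun b _ => ?_
    refine Finset.sum_congr rfl fun c _ => ?_
    ring
  have h3 : ∀ a, ∑ b, schwarzschild m (graphMap u x) a b * frameCovDeriv m u i j x a
      * unitNormal m u x b
      = frameCovDeriv m u i j x a * ((Real.sqrt (normalFactor m u x))⁻¹ * dF u x a) := by
    intro a
    rw [← hn a, Finset.mul_sum]
    exact Finset.sum_congr rfl fun b _ => by ring
  simp only [secondFF, Matrix.of_apply, h3]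
  simp only [frameCovDeriv_eq m u hx hh, sum_fin_four, Fin.cases_zero, Fin.cases_succ, dF,
    radialDeriv, Finset.sum_mul]
  rw [mul_sub, Finset.mul_sum, neg_add, sub_eq_add_neg, ← Finset.sum_neg_distrib,
    ← Finset.sum_neg_distrib]
  congr 1
  · ring
  · exact Finset.sum_congr rfl fun b _ => by ring

/-- The spatial components of `∇F`, that is, the spatial gradient of `u`. -/
noncomputable def graphGrad (m : ℝ) (u : E 3 → ℝ) (x : E 3) (i : Fin 3) : ℝ :=
  pderiv i u x + (lapse m ‖x‖ - 1) * radialDeriv u x * unitDir x i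

theorem sum_spatialMetric_mul {m : ℝ} {x : E 3} (v : Fin 3 → ℝ) (i : Fin 3) :
    ∑ k, spatialMetric m x i k * v k
      = v i + ((lapse m ‖x‖)⁻¹ - 1) * unitDir x i * ∑ k, unitDir x k * v k := by
  simp only [spatialMetric, add_mul, Finset.sum_add_distrib, ite_mul, one_mul, zero_mul,
    Finset.sum_ite_eq, Finset.mem_univ, if_true, Finset.mul_sum]
  congr 1
  exact Finset.sum_congr rfl fun k _ => by ring

theorem sum_unitDir_mul_graphGrad {m : ℝ} {u : E 3 → ℝ} {x : E 3} (hx : x ≠ 0) :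
    ∑ k, unitDir x k * graphGrad m u x k = lapse m ‖x‖ * radialDeriv u x := by
  have h1 : ∀ k, unitDir x k * graphGrad m u x k = pderiv k u x * unitDir x k
      + (lapse m ‖x‖ - 1) * radialDeriv u x * (unitDir x k * unitDir x k) := by
    intro k; simp only [graphGrad]; ring
  simp only [h1, Finset.sum_add_distrib, ← Finset.mul_sum, sum_unitDir_sq hx]
  rw [← radialDeriv]; ring

theorem sum_pderiv_mul_graphGrad {m : ℝ} {u : E 3 → ℝ} {x : E 3} :
    ∑ k, pderiv k u x * graphGrad m u x k
      = ∑ i, pderiv i u x * pderiv i u x + (lapse m ‖x‖ - 1) * radialDeriv u x ^ 2 := by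
  have h1 : ∀ k, pderiv k u x * graphGrad m u x k = pderiv k u x * pderiv k u x
      + (lapse m ‖x‖ - 1) * radialDeriv u x * (pderiv k u x * unitDir x k) := by
    intro k; simp only [graphGrad]; ring
  simp only [h1, Finset.sum_add_distrib, ← Finset.mul_sum]
  rw [← radialDeriv]; ring

theorem sum_spatialMetric_mul_graphGrad {m : ℝ} {u : E 3 → ℝ} {x : E 3} (hx : x ≠ 0)
    (hh : lapse m ‖x‖ ≠ 0) (i : Fin 3) :
    ∑ k, spatialMetric m x i k * graphGrad m u x k = pderiv i u x := by
  rw [sum_spatialMetric_mul, sum_unitDir_mul_graphGrad hx, graphGrad]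
  field_simp
  ring

theorem lapse_mul_normalFactor {m : ℝ} {u : E 3 → ℝ} {x : E 3} (hx : x ≠ 0)
    (hh : lapse m ‖x‖ ≠ 0) :
    lapse m ‖x‖ * normalFactor m u x
      = 1 - lapse m ‖x‖ * ∑ k, pderiv k u x * graphGrad m u x k := by
  rw [normalFactor_eq m u hx hh, sum_pderiv_mul_graphGrad]
  field_simp

/-- The inverse of the induced metric, by the formula for a rank one perturbation. -/
noncomputable def inducedInv (m : ℝ) (u : E 3 → ℝ) (x : E 3) : Matrix (Fin 3) (Fin 3) ℝ :=
  Matrix.of fun i j => (if i = j then 1 else 0) + (lapse m ‖x‖ - 1) * unitDir x i * unitDir x j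
    + graphGrad m u x i * graphGrad m u x j / normalFactor m u x

theorem inducedMetric_mul_inducedInv {m : ℝ} {u : E 3 → ℝ} {x : E 3} (hx : x ≠ 0)
    (hh : lapse m ‖x‖ ≠ 0) (hn : normalFactor m u x ≠ 0) :
    inducedMetric m u x * inducedInv m u x = 1 := by
  have hy := sum_unitDir_sq hx
  ext i j
  have h1 : ∀ v : Fin 3 → ℝ, ∑ k, inducedMetric m u x i k * v k
      = v i + ((lapse m ‖x‖)⁻¹ - 1) * unitDir x i * (∑ k, unitDir x k * v k)
        - lapse m ‖x‖ * pderiv i u x * ∑ k, pderiv k u x * v k := by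
    intro v
    rw [← sum_spatialMetric_mul, Finset.mul_sum, ← Finset.sum_sub_distrib]
    exact Finset.sum_congr rfl fun k _ => by rw [inducedMetric_apply]; ring
  have h2 : ∀ v : Fin 3 → ℝ, ∑ k, v k * inducedInv m u x k j
      = v j + (lapse m ‖x‖ - 1) * unitDir x j * (∑ k, v k * unitDir x k)
        + graphGrad m u x j / normalFactor m u x * ∑ k, v k * graphGrad m u x k := by
    intro v
    simp only [inducedInv, Matrix.of_apply, mul_add, Finset.sum_add_distrib, mul_ite, mul_one,
      mul_zero, Finset.sum_ite_eq', Finset.mem_univ, if_true, Finset.mul_sum]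
    congr 1
    · congr 1
      exact Finset.sum_congr rfl fun k _ => by ring
    · exact Finset.sum_congr rfl fun k _ => by ring
  rw [Matrix.mul_apply, h1, h2, h2, hy, sum_unitDir_mul_graphGrad hx]
  have h3 := lapse_mul_normalFactor (m := m) (u := u) hx hh
  rw [← radialDeriv]
  set S := ∑ k, pderiv k u x * graphGrad m u x k
  have h4 : S = (1 - lapse m ‖x‖ * normalFactor m u x) / lapse m ‖x‖ := by
    field_simp; linarith
  rw [h4]
  simp only [inducedInv, Matrix.of_apply, Matrix.one_apply, graphGrad]
  field_simp
  ring

theorem inducedMetric_inv {m : ℝ} {u : E 3 → ℝ} {x : E 3} (hx : x ≠ 0)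
    (hh : lapse m ‖x‖ ≠ 0) (hn : normalFactor m u x ≠ 0) :
    (inducedMetric m u x)⁻¹ = inducedInv m u x :=
  Matrix.inv_eq_right_inv (inducedMetric_mul_inducedInv hx hh hn)

/-- The conormal of a spacelike graph is timelike. -/
theorem normalFactor_pos {m : ℝ} {u : E 3 → ℝ} {x : E 3} (hx : x ≠ 0)
    (hh : 0 < lapse m ‖x‖) (hG : (inducedMetric m u x).PosDef) : 0 < normalFactor m u x := by
  -- Test the metric on the gradient of `u`, where it is `|∇u|² (1 - h |∇u|²)`.
  set S := ∑ k, pderiv k u x * graphGrad m u x k with hS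
  have h3 := lapse_mul_normalFactor (m := m) (u := u) hx hh.ne'
  have hq : ∑ i, graphGrad m u x i * ∑ j, inducedMetric m u x i j * graphGrad m u x j
      = S * (1 - lapse m ‖x‖ * S) := by
    have h1 : ∀ i, ∑ j, inducedMetric m u x i j * graphGrad m u x j
        = pderiv i u x * (1 - lapse m ‖x‖ * S) := by
      intro i
      have : ∀ j, inducedMetric m u x i j * graphGrad m u x j
          = spatialMetric m x i j * graphGrad m u x j
            - lapse m ‖x‖ * pderiv i u x * (pderiv j u x * graphGrad m u x j) := by
        intro j; rw [inducedMetric_apply]; ring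
      simp only [this, Finset.sum_sub_distrib, ← Finset.mul_sum,
        sum_spatialMetric_mul_graphGrad hx hh.ne']
      ring
    simp only [h1]
    rw [hS, Finset.sum_mul]
    exact Finset.sum_congr rfl fun i _ => by ring
  have hpos : 0 < lapse m ‖x‖ * normalFactor m u x := by
    rw [h3, ← hS]
    by_cases h0 : graphGrad m u x = 0
    · have : S = 0 := by simp [hS, h0]
      rw [this]; simp
    · have h4 := hG.dotProduct_mulVec_pos h0
      have h5 : 0 < S * (1 - lapse m ‖x‖ * S) := by
        rw [← hq]; simpa [dotProduct, Matrix.mulVec] using h4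
      by_contra hneg
      have h6 : 1 ≤ lapse m ‖x‖ * S := by linarith
      have h7 : 0 < S := by
        by_contra h8
        nlinarith
      nlinarith
  exact (mul_pos_iff_of_pos_left hh).1 hpos

/-! ### Curvature from the lowered Christoffel symbols -/

/-- The lowered Christoffel symbol `Γ_{l,ij}`. -/
noncomputable def lowerChristoffel {n : ℕ} (g : E n → Matrix (Fin n) (Fin n) ℝ) (l i j : Fin n)
    (x : E n) : ℝ :=
  (1 / 2) * (pderiv i (fun z => g z j l) x + pderiv j (fun z => g z i l) x
      - pderiv l (fun z => g z i j) x)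

theorem christoffel_eq_sum_lower {n : ℕ} (g : E n → Matrix (Fin n) (Fin n) ℝ) (k i j : Fin n)
    (x : E n) : christoffel g k i j x = ∑ l, (g x)⁻¹ k l * lowerChristoffel g l i j x := by
  simp only [christoffel, lowerChristoffel, Finset.mul_sum]
  exact Finset.sum_congr rfl fun l _ => by ring

theorem pderiv_metric_eq {n : ℕ} {g : E n → Matrix (Fin n) (Fin n) ℝ}
    (hs : ∀ z i j, g z i j = g z j i) (k q l : Fin n) (x : E n) :
    pderiv k (fun z => g z q l) x = lowerChristoffel g q k l x + lowerChristoffel g l k q x := by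
  have h1 : (fun z => g z l q) = fun z => g z q l := funext fun z => hs z l q
  simp only [lowerChristoffel, h1]
  ring

/-- Partial derivatives of the inverse of the metric. -/
theorem pderiv_inv_metric {n : ℕ} {g gi : E n → Matrix (Fin n) (Fin n) ℝ} {x : E n}
    (hg : ∀ i j, DifferentiableAt ℝ (fun z => g z i j) x)
    (hgi : ∀ i j, DifferentiableAt ℝ (fun z => gi z i j) x)
    (hmul : ∀ᶠ z in nhds x, g z * gi z = 1) (k : Fin n) :
    (Matrix.of fun i j => pderiv k (fun z => gi z i j) x)
      = -(gi x * (Matrix.of fun i j => pderiv k (fun z => g z i j) x) * gi x) := by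
  set dg : Matrix (Fin n) (Fin n) ℝ := Matrix.of fun i j => pderiv k (fun z => g z i j) x
  set dgi : Matrix (Fin n) (Fin n) ℝ := Matrix.of fun i j => pderiv k (fun z => gi z i j) x
  -- differentiate `g g⁻¹ = 1`
  have h1 : dg * gi x + g x * dgi = 0 := by
    ext i j
    have h2 : HasPD (fun z => ∑ l, g z i l * gi z l j) _ x :=
      HasPD.sum Finset.univ fun l _ => ((hg i l).hasPD).mul ((hgi l j).hasPD)
    have h3 : HasPD (fun z => ∑ l, g z i l * gi z l j) (fun _ => 0) x := by
      refine (HasPD.const ((1 : Matrix (Fin n) (Fin n) ℝ) i j)).congr_of_eventuallyEq ?_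
      filter_upwards [hmul] with z hz
      rw [← hz, Matrix.mul_apply]
    have h4 := (h2.eq k).symm.trans (h3.eq k)
    rw [Finset.sum_add_distrib] at h4
    simpa [Matrix.mul_apply, dg, dgi] using h4
  have h5 : gi x * g x = 1 := mul_eq_one_comm.1 hmul.self_of_nhds
  have h6 : gi x * (dg * gi x + g x * dgi) = 0 := by rw [h1, mul_zero]
  rw [mul_add, ← mul_assoc, ← mul_assoc, h5, one_mul] at h6
  exact eq_neg_of_add_eq_zero_right h6

/-- The Ricci tensor as the contraction of the curvature tensor with lowered indices, so that only the
derivatives of the lowered Christoffel symbols enter. -/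
theorem ricci_eq_lower {n : ℕ} {g : E n → Matrix (Fin n) (Fin n) ℝ} {x : E n}
    (hs : ∀ z i j, g z i j = g z j i)
    (hg : ∀ i j, DifferentiableAt ℝ (fun z => g z i j) x)
    (hgi : ∀ i j, DifferentiableAt ℝ (fun z => (g z)⁻¹ i j) x)
    (hmul : ∀ᶠ z in nhds x, g z * (g z)⁻¹ = 1)
    (hC : ∀ l i j, DifferentiableAt ℝ (lowerChristoffel g l i j) x) (i j : Fin n) :
    ricci g i j x = ∑ k, ∑ q, (g x)⁻¹ k q *
      (pderiv k (lowerChristoffel g q i j) x - pderiv j (lowerChristoffel g q i k) x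
        - ∑ l, (lowerChristoffel g l k q x * christoffel g l i j x
          - lowerChristoffel g l j q x * christoffel g l i k x)) := by
  have hd : ∀ a k i j, pderiv a (christoffel g k i j) x
      = ∑ q, (g x)⁻¹ k q * (pderiv a (lowerChristoffel g q i j) x
        - ∑ l, (lowerChristoffel g q a l x + lowerChristoffel g l a q x)
          * christoffel g l i j x) := by
    intro a k i j
    have h1 : christoffel g k i j = fun z => ∑ l, (g z)⁻¹ k l * lowerChristoffel g l i j z :=
      funext fun z => christoffel_eq_sum_lower g k i j z
    rw [h1, (HasPD.sum Finset.univ fun l _ => ((hgi k l).hasPD).mul ((hC l i j).hasPD)).eq a,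
      Finset.sum_add_distrib]
    have h2 := pderiv_inv_metric hg hgi hmul a
    have h3 : ∑ l, pderiv a (fun z => (g z)⁻¹ k l) x * lowerChristoffel g l i j x
        = ((Matrix.of fun i j => pderiv a (fun z => (g z)⁻¹ i j) x).mulVec
          (fun l => lowerChristoffel g l i j x)) k := rfl
    have h4 : ((g x)⁻¹.mulVec fun l => lowerChristoffel g l i j x)
        = fun l => christoffel g l i j x := by
      funext l; rw [christoffel_eq_sum_lower]; rfl
    rw [h3, h2, Matrix.neg_mulVec, ← Matrix.mulVec_mulVec, ← Matrix.mulVec_mulVec, h4]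
    simp only [Matrix.mulVec, dotProduct, Pi.neg_apply, Matrix.of_apply, pderiv_metric_eq hs,
      mul_sub, Finset.sum_sub_distrib]
    ring
  simp only [ricci, hd]
  refine Finset.sum_congr rfl fun k _ => ?_
  have hk : ∀ a c d, ∑ l, christoffel g k a l x * christoffel g l c d x
      = ∑ q, (g x)⁻¹ k q * ∑ l, lowerChristoffel g q a l x * christoffel g l c d x := by
    intro a c d
    simp only [fun l => christoffel_eq_sum_lower g k a l x, Finset.sum_mul, Finset.mul_sum]
    rw [Finset.sum_comm]
    exact Finset.sum_congr rfl fun q _ => Finset.sum_congr rfl fun l _ => by ring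
  have hsub : ∑ l, (christoffel g k k l x * christoffel g l i j x
      - christoffel g k j l x * christoffel g l i k x)
      = ∑ q, (g x)⁻¹ k q * ∑ l, lowerChristoffel g q k l x * christoffel g l i j x
      - ∑ q, (g x)⁻¹ k q * ∑ l, lowerChristoffel g q j l x * christoffel g l i k x := by
    rw [← hk, ← hk]; exact Finset.sum_sub_distrib _ _
  rw [hsub, ← Finset.sum_sub_distrib, ← Finset.sum_sub_distrib, ← Finset.sum_add_distrib]
  refine Finset.sum_congr rfl fun q _ => ?_
  rw [← mul_sub, ← mul_sub, ← mul_add]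
  congr 1
  simp only [add_mul, Finset.sum_add_distrib, Finset.sum_sub_distrib]
  ring

/-! ### The Gauss equation for a graph in the Schwarzschild spacetime -/

/-- The graph of `u` is a smooth spacelike surface over the open set `U` of the exterior region. -/
structure SpacelikeOver (m : ℝ) (u : E 3 → ℝ) (U : Set (E 3)) : Prop where
  isOpen : IsOpen U
  smooth : ContDiffOn ℝ ∞ u U
  ne_zero : ∀ x ∈ U, x ≠ 0
  lapse_pos : ∀ x ∈ U, 0 < lapse m ‖x‖
  posDef : ∀ x ∈ U, (inducedMetric m u x).PosDef

theorem SpacelikeOver.normalFactor_pos {m : ℝ} {u : E 3 → ℝ} {U : Set (E 3)}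
    (h : SpacelikeOver m u U) {x : E 3} (hx : x ∈ U) : 0 < normalFactor m u x :=
  SchwarzschildCMC.normalFactor_pos (h.ne_zero x hx) (h.lapse_pos x hx) (h.posDef x hx)

theorem inducedMetric_symm (m : ℝ) (u : E 3 → ℝ) (x : E 3) (i j : Fin 3) :
    inducedMetric m u x i j = inducedMetric m u x j i := by
  simp only [inducedMetric_apply, spatialMetric, eq_comm (a := i)]; ring

theorem timeHess_symm {m : ℝ} {u : E 3 → ℝ} {U : Set (E 3)} (h : SpacelikeOver m u U)
    {x : E 3} (hx : x ∈ U) (i j : Fin 3) : timeHess m u x i j = timeHess m u x j i := by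
  rw [timeHess, timeHess, pderiv_comm h.isOpen h.smooth hx]; ring

theorem radialHess_symm (m : ℝ) (u : E 3 → ℝ) (x : E 3) (i j : Fin 3) :
    radialHess m u x i j = radialHess m u x j i := by
  simp only [radialHess, eq_comm (a := i)]; ring

theorem secondFF_symm {m : ℝ} {u : E 3 → ℝ} {U : Set (E 3)} (h : SpacelikeOver m u U)
    {x : E 3} (hx : x ∈ U) (i j : Fin 3) : secondFF m u x i j = secondFF m u x j i := by
  rw [secondFF_eq m u (h.ne_zero x hx) (h.lapse_pos x hx).ne',
    secondFF_eq m u (h.ne_zero x hx) (h.lapse_pos x hx).ne', timeHess_symm h hx, radialHess_symm]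

theorem mass_eq (m : ℝ) {x : E 3} (hx : x ≠ 0) : m = (1 - lapse m ‖x‖) * ‖x‖ / 2 := by
  have hr : ‖x‖ ≠ 0 := norm_ne_zero_iff.2 hx
  simp only [lapse]; field_simp; simp

section Gauss

variable {m : ℝ} {u : E 3 → ℝ} {U : Set (E 3)} {x : E 3}

theorem SpacelikeOver.hasPD_metric (h : SpacelikeOver m u U) (hx : x ∈ U) (i j : Fin 3) :
    HasPD (fun z => inducedMetric m u z i j) (fun k =>
      -(2 * m / ‖x‖ ^ 2) / lapse m ‖x‖ ^ 2 * unitDir x k * unitDir x i * unitDir x j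
      + ((lapse m ‖x‖)⁻¹ - 1) *
        (((if k = i then 1 else 0) - unitDir x k * unitDir x i) / ‖x‖ * unitDir x j
        + unitDir x i * (((if k = j then 1 else 0) - unitDir x k * unitDir x j) / ‖x‖))
      - (2 * m / ‖x‖ ^ 2 * unitDir x k * pderiv i u x * pderiv j u x
        + lapse m ‖x‖ * (pderiv k (pderiv i u) x * pderiv j u x
          + pderiv i u x * pderiv k (pderiv j u) x))) x := by
  have h0 := h.ne_zero x hx
  have hi := ContDiffOn.hasPD h.isOpen (contDiffOn_pderiv h.isOpen h.smooth i) hx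
  have hj := ContDiffOn.hasPD h.isOpen (contDiffOn_pderiv h.isOpen h.smooth j) hx
  simp only [inducedMetric_apply]
  exact ((hasPD_spatialMetric m h0 (h.lapse_pos x hx).ne' i j).sub
    (((hasPD_lapse m h0).mul hi).mul hj)).congr_deriv fun k => by ring

theorem SpacelikeOver.lowerChristoffel_eq (h : SpacelikeOver m u U) (hx : x ∈ U) (q i j : Fin 3) :
    lowerChristoffel (inducedMetric m u) q i j x
      = (lapse m ‖x‖)⁻¹ * unitDir x q * radialHess m u x i j
        - lapse m ‖x‖ * pderiv q u x * timeHess m u x i j := by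
  have h0 := h.ne_zero x hx
  have hr : ‖x‖ ≠ 0 := norm_ne_zero_iff.2 h0
  have hh := (h.lapse_pos x hx).ne'
  rw [lowerChristoffel, (h.hasPD_metric hx j q).eq, (h.hasPD_metric hx i q).eq,
    (h.hasPD_metric hx i j).eq, pderiv_comm h.isOpen h.smooth hx q i,
    pderiv_comm h.isOpen h.smooth hx q j, pderiv_comm h.isOpen h.smooth hx j i]
  simp only [radialHess, timeHess, eq_comm (a := q), eq_comm (a := j) (b := i)]
  have hm := mass_eq m h0
  generalize lapse m ‖x‖ = H at *
  subst hm
  field_simp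
  ring

theorem hasPD_mass_div_norm_sq (m : ℝ) (h0 : x ≠ 0) :
    HasPD (fun z : E 3 => m / ‖z‖ ^ 2) (fun k => -(2 * m / ‖x‖ ^ 3) * unitDir x k) x := by
  have hr : ‖x‖ ≠ 0 := norm_ne_zero_iff.2 h0
  have h1 : HasDerivAt (fun r : ℝ => m / r ^ 2) (-(2 * m / ‖x‖ ^ 3)) ‖x‖ := by
    refine ((hasDerivAt_const _ m).div (hasDerivAt_pow 2 ‖x‖) (pow_ne_zero 2 hr)).congr_deriv ?_
    field_simp; simp; ring
  exact HasPD.comp (φ := fun r => m / r ^ 2) h1 (HasPD.norm h0)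

theorem SpacelikeOver.hasPD_timeHess (h : SpacelikeOver m u U) (hx : x ∈ U) (i j : Fin 3) :
    HasPD (fun z => timeHess m u z i j) (fun k => pderiv k (pderiv i (pderiv j u)) x
      + ((-(2 * m / ‖x‖ ^ 3) / lapse m ‖x‖
        - 2 * m ^ 2 / ‖x‖ ^ 4 / lapse m ‖x‖ ^ 2) * unitDir x k
        * (unitDir x i * pderiv j u x + pderiv i u x * unitDir x j)
        + m / ‖x‖ ^ 2 / lapse m ‖x‖ *
        (((if k = i then 1 else 0) - unitDir x k * unitDir x i) / ‖x‖ * pderiv j u x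
          + unitDir x i * pderiv k (pderiv j u) x + pderiv k (pderiv i u) x * unitDir x j
          + pderiv i u x * (((if k = j then 1 else 0) - unitDir x k * unitDir x j) / ‖x‖)))) x := by
  have h0 := h.ne_zero x hx
  have hr : ‖x‖ ≠ 0 := norm_ne_zero_iff.2 h0
  have hh := (h.lapse_pos x hx).ne'
  have si := contDiffOn_pderiv h.isOpen h.smooth i
  have sj := contDiffOn_pderiv h.isOpen h.smooth j
  have hi := ContDiffOn.hasPD h.isOpen si hx
  have hj := ContDiffOn.hasPD h.isOpen sj hx
  have hij := ContDiffOn.hasPD h.isOpen (contDiffOn_pderiv h.isOpen sj i) hx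
  refine (hij.add (((hasPD_mass_div_norm_sq m h0).mul (hasPD_lapse_inv m h0 hh)).mul
    (((hasPD_unitDir h0 i).mul hj).add (hi.mul (hasPD_unitDir h0 j))))).congr_deriv ?_
  intro k
  field_simp
  ring

theorem SpacelikeOver.hasPD_radialHess (h : SpacelikeOver m u U) (hx : x ∈ U) (i j : Fin 3) :
    HasPD (fun z => radialHess m u z i j) (fun k =>
      (2 * m / ‖x‖ ^ 3 / lapse m ‖x‖ + 2 * m ^ 2 / ‖x‖ ^ 4 / lapse m ‖x‖ ^ 2) * unitDir x k
        * unitDir x i * unitDir x j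
      - (m / ‖x‖ ^ 2 / lapse m ‖x‖ + (1 - lapse m ‖x‖) / ‖x‖) *
        (((if k = i then 1 else 0) - unitDir x k * unitDir x i) / ‖x‖ * unitDir x j
        + unitDir x i * (((if k = j then 1 else 0) - unitDir x k * unitDir x j) / ‖x‖))
      - (2 * m / ‖x‖ ^ 3 + (1 - lapse m ‖x‖) / ‖x‖ ^ 2) * unitDir x k
        * ((if i = j then 1 else 0) - unitDir x i * unitDir x j)
      + (2 * m ^ 2 / ‖x‖ ^ 4 - 2 * m / ‖x‖ ^ 3 * lapse m ‖x‖) * unitDir x k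
        * pderiv i u x * pderiv j u x
      + m / ‖x‖ ^ 2 * lapse m ‖x‖ * (pderiv k (pderiv i u) x * pderiv j u x
          + pderiv i u x * pderiv k (pderiv j u) x)) x := by
  have h0 := h.ne_zero x hx
  have hr : ‖x‖ ≠ 0 := norm_ne_zero_iff.2 h0
  have hh := (h.lapse_pos x hx).ne'
  have hi := ContDiffOn.hasPD h.isOpen (contDiffOn_pderiv h.isOpen h.smooth i) hx
  have hj := ContDiffOn.hasPD h.isOpen (contDiffOn_pderiv h.isOpen h.smooth j) hx
  have yi := hasPD_unitDir h0 i
  have yj := hasPD_unitDir h0 j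
  have hM := hasPD_mass_div_norm_sq m h0
  have h1 := (((hM.mul (hasPD_lapse_inv m h0 hh)).neg.mul yi).mul yj)
  have h2 := (((HasPD.const 1).sub (hasPD_lapse m h0)).mul
    ((HasPD.norm h0).comp (hasDerivAt_inv hr))).mul
    ((HasPD.const (if i = j then (1 : ℝ) else 0)).sub (yi.mul yj))
  have h3 := ((hM.mul (hasPD_lapse m h0)).mul hi).mul hj
  refine ((h1.add h2).add h3).congr_deriv ?_
  intro k
  have hk : x k / ‖x‖ = unitDir x k := rfl
  simp only [hk]
  field_simp
  ring

/-- Pulled back to a graph, the curvature tensor of the Schwarzschild metric is `2m/r³` times this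
combination of the pullbacks of the metric `r² σ` of the spheres, here `S`, and of the
metric `-h dt² + h⁻¹ dr²` of the orthogonal planes, here `B`. -/
noncomputable def weylForm (B S : Matrix (Fin 3) (Fin 3) ℝ) (q i k j : Fin 3) : ℝ :=
  (S q k * S i j - S q j * S i k) + (B q k * B i j - B q j * B i k)
    - (1 / 2) * (B q k * S i j - B q j * S i k) - (1 / 2) * (S q k * B i j - S q j * B i k)

/-- The pullback of `r² σ` to the graph. -/
noncomputable def angularForm (x : E 3) : Matrix (Fin 3) (Fin 3) ℝ :=
  Matrix.of fun i j => (if i = j then 1 else 0) - unitDir x i * unitDir x j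

/-- The pullback of `-h dt² + h⁻¹ dr²` to the graph. -/
noncomputable def planeForm (m : ℝ) (u : E 3 → ℝ) (x : E 3) : Matrix (Fin 3) (Fin 3) ℝ :=
  Matrix.of fun i j => (lapse m ‖x‖)⁻¹ * unitDir x i * unitDir x j
    - lapse m ‖x‖ * pderiv i u x * pderiv j u x

theorem inducedMetric_eq_angular_add_plane (m : ℝ) (u : E 3 → ℝ) (x : E 3) :
    inducedMetric m u x = angularForm x + planeForm m u x := by
  ext i j
  simp only [inducedMetric_apply, spatialMetric, angularForm, planeForm, Matrix.add_apply,
    Matrix.of_apply]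
  ring

/-- Third derivatives of `u` cancel, and what remains beyond the products of covariant derivatives
`∇_{e_i} e_j` is the curvature of the spacetime. -/
theorem SpacelikeOver.curvature_identity (h : SpacelikeOver m u U) (hx : x ∈ U) (q i k j : Fin 3) :
    pderiv k (lowerChristoffel (inducedMetric m u) q i j) x
      - pderiv j (lowerChristoffel (inducedMetric m u) q i k) x
      - ((lapse m ‖x‖)⁻¹ * (radialHess m u x k q * radialHess m u x i j
          - radialHess m u x j q * radialHess m u x i k)
        - lapse m ‖x‖ * (timeHess m u x k q * timeHess m u x i j
          - timeHess m u x j q * timeHess m u x i k))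
      = 2 * m / ‖x‖ ^ 3 * weylForm (planeForm m u x) (angularForm x) q i k j := by
  have h0 := h.ne_zero x hx
  have hr : ‖x‖ ≠ 0 := norm_ne_zero_iff.2 h0
  have hh := (h.lapse_pos x hx).ne'
  have hq := ContDiffOn.hasPD h.isOpen (contDiffOn_pderiv h.isOpen h.smooth q) hx
  have hC : ∀ i j, HasPD (lowerChristoffel (inducedMetric m u) q i j) _ x := fun i j =>
    ((((hasPD_lapse_inv m h0 hh).mul (hasPD_unitDir h0 q)).mul (h.hasPD_radialHess hx i j)).sub
      (((hasPD_lapse m h0).mul hq).mul (h.hasPD_timeHess hx i j))).congr_of_eventuallyEq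
      (by filter_upwards [h.isOpen.mem_nhds hx] with z hz using h.lowerChristoffel_eq hz q i j)
  have hc := fun a b => pderiv_comm h.isOpen h.smooth hx a b
  have hc3 : pderiv k (pderiv i (pderiv j u)) x = pderiv j (pderiv i (pderiv k u)) x := by
    rw [pderiv_comm h.isOpen (contDiffOn_pderiv h.isOpen h.smooth j) hx k i,
      pderiv_comm h.isOpen (contDiffOn_pderiv h.isOpen h.smooth k) hx j i]
    refine pderiv_congr ?_ i
    filter_upwards [h.isOpen.mem_nhds hx] with z hz using pderiv_comm h.isOpen h.smooth hz k j
  rw [(hC i j).eq, (hC i k).eq]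
  obtain ⟨δ, hδ, hδs⟩ : ∃ δ : Fin 3 → Fin 3 → ℝ,
      (∀ a b, (if a = b then (1 : ℝ) else 0) = δ a b) ∧ ∀ a b, δ a b = δ b a :=
    ⟨fun a b => if a = b then 1 else 0, fun _ _ => rfl, fun a b => by simp only [eq_comm]⟩
  simp only [weylForm, planeForm, angularForm, Matrix.of_apply, radialHess, timeHess, hδ]
  rw [hc3, hδs k q, hδs j q, hδs k i, hδs j i, hδs k j, hc k q, hc j q, hc k i, hc j i, hc k j]
  have hm := mass_eq m h0
  generalize lapse m ‖x‖ = H at *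
  generalize ‖x‖ = r at *
  subst hm
  field_simp
  ring

/-- The Christoffel symbols of the graph are those of the spacetime, projected to the graph along the
normal. Hence their product is that of the covariant derivatives `∇_{e_i} e_j` plus the product of
the normal components. -/
theorem SpacelikeOver.sum_lowerChristoffel_mul (h : SpacelikeOver m u U) (hx : x ∈ U)
    (k q i j : Fin 3) :
    ∑ l, lowerChristoffel (inducedMetric m u) l k q x * christoffel (inducedMetric m u) l i j x
      = (lapse m ‖x‖)⁻¹ * (radialHess m u x k q * radialHess m u x i j)
        - lapse m ‖x‖ * (timeHess m u x k q * timeHess m u x i j)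
        + secondFF m u x k q * secondFF m u x i j := by
  have h0 := h.ne_zero x hx
  have hh := (h.lapse_pos x hx).ne'
  have hn := h.normalFactor_pos hx
  have hy := sum_unitDir_sq h0
  have hyw := sum_unitDir_mul_graphGrad (m := m) (u := u) h0
  have hS := lapse_mul_normalFactor (m := m) (u := u) h0 hh
  have hS' : ∑ k, pderiv k u x * graphGrad m u x k
      = (lapse m ‖x‖)⁻¹ - normalFactor m u x := by
    field_simp; linarith
  have hus : ∑ k, pderiv k u x * unitDir x k = radialDeriv u x := rfl
  have hGi : ∀ (v : Fin 3 → ℝ) l, ∑ p, inducedInv m u x l p * v p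
      = v l + (lapse m ‖x‖ - 1) * unitDir x l * (∑ p, v p * unitDir x p)
        + graphGrad m u x l / normalFactor m u x * ∑ p, v p * graphGrad m u x p := by
    intro v l
    simp only [inducedInv, Matrix.of_apply, add_mul, Finset.sum_add_distrib, ite_mul, one_mul,
      zero_mul, Finset.sum_ite_eq, Finset.mem_univ, if_true, Finset.mul_sum]
    congr 1
    · congr 1
      exact Finset.sum_congr rfl fun k _ => by ring
    · exact Finset.sum_congr rfl fun k _ => by ring
  -- the Gauss formula
  have hch : ∀ l, christoffel (inducedMetric m u) l i j x = unitDir x l * radialHess m u x i j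
      + graphGrad m u x l * (radialDeriv u x * radialHess m u x i j - timeHess m u x i j)
        / normalFactor m u x := by
    intro l
    rw [christoffel_eq_sum_lower, inducedMetric_inv h0 hh hn.ne']
    have : ∀ p, inducedInv m u x l p * lowerChristoffel (inducedMetric m u) p i j x
        = (lapse m ‖x‖)⁻¹ * radialHess m u x i j * (inducedInv m u x l p * unitDir x p)
          - lapse m ‖x‖ * timeHess m u x i j * (inducedInv m u x l p * pderiv p u x) := by
      intro p; rw [h.lowerChristoffel_eq hx]; ring
    simp only [this, Finset.sum_sub_distrib, ← Finset.mul_sum]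
    rw [hGi, hGi, hy, hyw, hus, hS']
    simp only [graphGrad]
    field_simp
    ring
  have : ∀ l, lowerChristoffel (inducedMetric m u) l k q x
      * christoffel (inducedMetric m u) l i j x
      = (lapse m ‖x‖)⁻¹ * radialHess m u x k q * radialHess m u x i j
          * (unitDir x l * unitDir x l)
        + (lapse m ‖x‖)⁻¹ * radialHess m u x k q
          * ((radialDeriv u x * radialHess m u x i j - timeHess m u x i j) / normalFactor m u x)
          * (unitDir x l * graphGrad m u x l)
        - lapse m ‖x‖ * timeHess m u x k q * radialHess m u x i j
          * (pderiv l u x * unitDir x l)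
        - lapse m ‖x‖ * timeHess m u x k q
          * ((radialDeriv u x * radialHess m u x i j - timeHess m u x i j) / normalFactor m u x)
          * (pderiv l u x * graphGrad m u x l) := by
    intro l; rw [hch, h.lowerChristoffel_eq hx]; ring
  simp only [this, Finset.sum_sub_distrib, Finset.sum_add_distrib, ← Finset.mul_sum, hy, hyw, hus,
    hS']
  have hsq : (Real.sqrt (normalFactor m u x))⁻¹ * (Real.sqrt (normalFactor m u x))⁻¹
      = (normalFactor m u x)⁻¹ := by
    rw [← mul_inv, Real.mul_self_sqrt hn.le]
  have hA : secondFF m u x k q * secondFF m u x i j = (normalFactor m u x)⁻¹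
      * ((timeHess m u x k q - radialDeriv u x * radialHess m u x k q)
        * (timeHess m u x i j - radialDeriv u x * radialHess m u x i j)) := by
    rw [secondFF_eq m u h0 hh, secondFF_eq m u h0 hh, ← hsq]; ring
  rw [hA]
  have := hn.ne'
  field_simp
  ring

theorem SpacelikeOver.hasPD_normalFactor (h : SpacelikeOver m u U) (hx : x ∈ U) :
    DifferentiableAt ℝ (normalFactor m u) x ∧
    ∀ i, DifferentiableAt ℝ (fun z => graphGrad m u z i) x := by
  have h0 := h.ne_zero x hx
  have hh := (h.lapse_pos x hx).ne'
  have hu := fun i => ContDiffOn.hasPD h.isOpen (contDiffOn_pderiv h.isOpen h.smooth i) hx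
  have hl := hasPD_lapse m h0
  have hrad : HasPD (radialDeriv u) _ x :=
    HasPD.sum Finset.univ fun k _ => (hu k).mul (hasPD_unitDir h0 k)
  refine ⟨?_, fun i => ((hu i).add (((hl.sub (HasPD.const 1)).mul hrad).mul
    (hasPD_unitDir h0 i))).diff⟩
  have h1 := (hasPD_lapse_inv m h0 hh).sub ((HasPD.sum Finset.univ fun i _ =>
    (hu i).mul (hu i)).add ((hl.sub (HasPD.const 1)).mul (hrad.mul hrad)))
  refine h1.diff.congr_of_eventuallyEq ?_
  filter_upwards [h.isOpen.mem_nhds hx] with z hz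
  rw [normalFactor_eq m u (h.ne_zero z hz) (h.lapse_pos z hz).ne', sq]

theorem SpacelikeOver.differentiableAt_inv (h : SpacelikeOver m u U) (hx : x ∈ U) (i j : Fin 3) :
    DifferentiableAt ℝ (fun z => (inducedMetric m u z)⁻¹ i j) x := by
  have h0 := h.ne_zero x hx
  obtain ⟨hn, hw⟩ := h.hasPD_normalFactor hx
  have h1 : DifferentiableAt ℝ (fun z => inducedInv m u z i j) x := by
    simp only [inducedInv, Matrix.of_apply]
    simp only [div_eq_mul_inv]
    exact ((differentiableAt_const _).add ((((hasPD_lapse m h0).diff.sub_const 1).mul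
      (hasPD_unitDir h0 i).diff).mul (hasPD_unitDir h0 j).diff)).add
      (((hw i).mul (hw j)).mul (hn.hasPD.comp (hasDerivAt_inv (h.normalFactor_pos hx).ne')).diff)
  refine h1.congr_of_eventuallyEq ?_
  filter_upwards [h.isOpen.mem_nhds hx] with z hz
  rw [inducedMetric_inv (h.ne_zero z hz) (h.lapse_pos z hz).ne' (h.normalFactor_pos hz).ne']

theorem SpacelikeOver.ricci_eq (h : SpacelikeOver m u U) (hx : x ∈ U) (i j : Fin 3) :
    ricci (inducedMetric m u) i j x = ∑ k, ∑ q, (inducedMetric m u x)⁻¹ k q *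
      (2 * m / ‖x‖ ^ 3 * weylForm (planeForm m u x) (angularForm x) q i k j
        - (secondFF m u x q k * secondFF m u x i j - secondFF m u x q j * secondFF m u x i k)) := by
  have h0 := h.ne_zero x hx
  have hh := (h.lapse_pos x hx).ne'
  rw [ricci_eq_lower (inducedMetric_symm m u) (fun i j => (h.hasPD_metric hx i j).diff)
    (h.differentiableAt_inv hx)]
  · refine Finset.sum_congr rfl fun k _ => Finset.sum_congr rfl fun q _ => ?_
    rw [← h.curvature_identity hx, Finset.sum_sub_distrib, h.sum_lowerChristoffel_mul hx,
      h.sum_lowerChristoffel_mul hx, secondFF_symm h hx q k, secondFF_symm h hx q j]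
    ring
  · filter_upwards [h.isOpen.mem_nhds hx] with z hz
    rw [inducedMetric_inv (h.ne_zero z hz) (h.lapse_pos z hz).ne' (h.normalFactor_pos hz).ne']
    exact inducedMetric_mul_inducedInv (h.ne_zero z hz) (h.lapse_pos z hz).ne'
      (h.normalFactor_pos hz).ne'
  · intro q i j
    have hq := ContDiffOn.hasPD h.isOpen (contDiffOn_pderiv h.isOpen h.smooth q) hx
    exact (((((hasPD_lapse_inv m h0 hh).mul (hasPD_unitDir h0 q)).mul
      (h.hasPD_radialHess hx i j)).sub
      (((hasPD_lapse m h0).mul hq).mul (h.hasPD_timeHess hx i j))).congr_of_eventuallyEq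
      (by filter_upwards [h.isOpen.mem_nhds hx] with z hz
          using h.lowerChristoffel_eq hz q i j)).diff

end Gauss

/-- The double trace of a form of the type of a curvature tensor, built from two forms. -/
theorem sum_mul_antisymm {g a b : Matrix (Fin 3) (Fin 3) ℝ} (hg : g.transpose = g)
    (ha : a.transpose = a) :
    ∑ i, ∑ j, g i j * ∑ k, ∑ q, g k q * (a q k * b i j - a q j * b i k)
      = (g * a).trace * (g * b.transpose).trace - (g * a * (g * b.transpose)).trace := by
  have hg' : ∀ i j, g i j = g j i := fun i j => congrFun (congrFun hg j) i
  have ha' : ∀ i j, a i j = a j i := fun i j => congrFun (congrFun ha j) i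
  simp only [Matrix.trace, Matrix.diag, Matrix.mul_apply, Fin.sum_univ_three,
    Matrix.transpose_apply, hg' 1 0, hg' 2 0, hg' 2 1, ha' 1 0, ha' 2 0, ha' 2 1]
  ring

/-- The pullbacks of `r² σ` and of the metric of the planes are both degenerate and add up to the
induced metric. With respect to it the former has therefore the eigenvalues `0`, `1` and `t - 1`,
where `t` is its trace. -/
theorem trace_angular {m : ℝ} {u : E 3 → ℝ} {x : E 3} (hx : x ≠ 0) :
    (inducedInv m u x * angularForm x * (inducedInv m u x * angularForm x)).trace
      = 1 + ((inducedInv m u x * angularForm x).trace - 1) ^ 2 := by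
  have hy := sum_unitDir_sq hx
  set y := unitDir x
  set w := graphGrad m u x
  set c := (normalFactor m u x)⁻¹
  have hyy : y ⬝ᵥ y = 1 := hy
  have hS : angularForm x = 1 - Matrix.vecMulVec y y := by
    ext i j; simp [angularForm, Matrix.vecMulVec_apply, Matrix.one_apply, y]
  have hGi : inducedInv m u x = 1 + (lapse m ‖x‖ - 1) • Matrix.vecMulVec y y
      + c • Matrix.vecMulVec w w := by
    ext i j
    simp [inducedInv, Matrix.vecMulVec_apply, Matrix.one_apply, y, w, c]
    ring
  set S := angularForm x with hSdef
  have hyS : Matrix.vecMul y S = 0 := by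
    rw [hS, Matrix.vecMul_sub, Matrix.vecMul_one, Matrix.vecMul_vecMulVec, hyy, one_smul, sub_self]
  have hSS : S * S = S := by
    conv_lhs => rw [hS, sub_mul, one_mul, ← hS, Matrix.vecMulVec_mul, hyS]
    simp
  set v := Matrix.vecMul w S
  have hGS : inducedInv m u x * S = S + c • Matrix.vecMulVec w v := by
    rw [hGi, add_mul, add_mul, one_mul, Matrix.smul_mul, Matrix.smul_mul, Matrix.vecMulVec_mul,
      Matrix.vecMulVec_mul, hyS]
    simp [v]
  have hvS : Matrix.vecMul v S = v := by simp only [v, Matrix.vecMul_vecMul, hSS]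
  have htS : S.trace = 2 := by
    rw [hS, Matrix.trace_sub, Matrix.trace_vecMulVec, hyy]; simp; norm_num
  have h1 : (S * Matrix.vecMulVec w v).trace = v ⬝ᵥ w := by
    rw [Matrix.trace_mul_comm, Matrix.vecMulVec_mul, hvS, Matrix.trace_vecMulVec, dotProduct_comm]
  have h2 : (Matrix.vecMulVec w v * S).trace = v ⬝ᵥ w := by
    rw [Matrix.vecMulVec_mul, hvS, Matrix.trace_vecMulVec, dotProduct_comm]
  have h3 : (Matrix.vecMulVec w v * Matrix.vecMulVec w v).trace = (v ⬝ᵥ w) ^ 2 := by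
    rw [Matrix.vecMulVec_mul_vecMulVec]
    simp [Matrix.trace_smul, Matrix.trace_vecMulVec, dotProduct_comm w v, sq]
  rw [hGS]
  simp only [mul_add, add_mul, Matrix.smul_mul, Matrix.mul_smul, Matrix.trace_add,
    Matrix.trace_smul, hSS, htS, h1, h2, h3, Matrix.trace_vecMulVec, dotProduct_comm w v,
    smul_eq_mul]
  ring

theorem SpacelikeOver.inducedInv_symm {m : ℝ} {u : E 3 → ℝ} {x : E 3} :
    (inducedInv m u x).transpose = inducedInv m u x := by
  ext i j
  simp only [inducedInv, Matrix.transpose_apply, Matrix.of_apply, eq_comm (a := j)]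
  ring

/-- The Gauss equation. The spacetime is Ricci flat, so that it reads `S = |A|² - (tr A)²`. -/
theorem SpacelikeOver.scalarCurvature_eq {m : ℝ} {u : E 3 → ℝ} {U : Set (E 3)}
    (h : SpacelikeOver m u U) {x : E 3} (hx : x ∈ U) :
    scalarCurvature (inducedMetric m u) x
      = ((inducedMetric m u x)⁻¹ * secondFF m u x * ((inducedMetric m u x)⁻¹
          * secondFF m u x)).trace - ((inducedMetric m u x)⁻¹ * secondFF m u x).trace ^ 2 := by
  have h0 := h.ne_zero x hx
  have hh := (h.lapse_pos x hx).ne'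
  have hn := (h.normalFactor_pos hx).ne'
  have hA : (secondFF m u x).transpose = secondFF m u x := by
    ext i j; exact secondFF_symm h hx j i
  have hS : (angularForm x).transpose = angularForm x := by
    ext i j; simp only [angularForm, Matrix.transpose_apply, Matrix.of_apply, eq_comm (a := j)]; ring
  have hB : (planeForm m u x).transpose = planeForm m u x := by
    ext i j; simp only [planeForm, Matrix.transpose_apply, Matrix.of_apply]; ring
  have hGi := SpacelikeOver.inducedInv_symm (m := m) (u := u) (x := x)
  have hGB : inducedInv m u x * planeForm m u x = 1 - inducedInv m u x * angularForm x := by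
    rw [eq_sub_iff_add_eq, add_comm, ← mul_add, ← inducedMetric_eq_angular_add_plane]
    exact mul_eq_one_comm.1 (inducedMetric_mul_inducedInv h0 hh hn)
  have hst := trace_angular (m := m) (u := u) h0
  have e1 := sum_mul_antisymm (b := secondFF m u x) hGi hA
  have e2 := sum_mul_antisymm (b := angularForm x) hGi hS
  have e3 := sum_mul_antisymm (b := planeForm m u x) hGi hB
  have e4 := sum_mul_antisymm (b := planeForm m u x) hGi hS
  have e5 := sum_mul_antisymm (b := angularForm x) hGi hB
  rw [hA] at e1
  rw [hS] at e2 e5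
  rw [hB] at e3 e4
  simp only [hGB, mul_sub, sub_mul, mul_one, one_mul, Matrix.trace_sub, hst, Matrix.trace_one,
    Fintype.card_fin, Nat.cast_ofNat] at e2 e3 e4 e5
  set g := inducedInv m u x with hg
  have key : ∑ i, ∑ j, g i j * ∑ k, ∑ q, g k q *
      (2 * m / ‖x‖ ^ 3 * weylForm (planeForm m u x) (angularForm x) q i k j
        - (secondFF m u x q k * secondFF m u x i j - secondFF m u x q j * secondFF m u x i k))
      = 2 * m / ‖x‖ ^ 3 * (
        (∑ i, ∑ j, g i j * ∑ k, ∑ q, g k q * (angularForm x q k * angularForm x i j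
          - angularForm x q j * angularForm x i k))
        + (∑ i, ∑ j, g i j * ∑ k, ∑ q, g k q * (planeForm m u x q k * planeForm m u x i j
          - planeForm m u x q j * planeForm m u x i k))
        - (1 / 2) * (∑ i, ∑ j, g i j * ∑ k, ∑ q, g k q * (planeForm m u x q k * angularForm x i j
          - planeForm m u x q j * angularForm x i k))
        - (1 / 2) * (∑ i, ∑ j, g i j * ∑ k, ∑ q, g k q * (angularForm x q k * planeForm m u x i j
          - angularForm x q j * planeForm m u x i k)))
        - ∑ i, ∑ j, g i j * ∑ k, ∑ q, g k q * (secondFF m u x q k * secondFF m u x i j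
          - secondFF m u x q j * secondFF m u x i k) := by
    simp only [weylForm, Finset.mul_sum, ← Finset.sum_sub_distrib, ← Finset.sum_add_distrib]
    refine Finset.sum_congr rfl fun i _ => Finset.sum_congr rfl fun j _ =>
      Finset.sum_congr rfl fun k _ => Finset.sum_congr rfl fun q _ => ?_
    ring
  simp only [scalarCurvature, h.ricci_eq hx]
  rw [inducedMetric_inv h0 hh hn, ← hg, key, e1]
  -- with the traces of `trace_angular`, the double trace of `weylForm` vanishes
  simp only [mul_sub] at e2 e3 e4 e5 ⊢
  rw [e2, e3, e4, e5]
  ring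

theorem meanCurvature_eq_trace {m : ℝ} {u : E 3 → ℝ} {U : Set (E 3)}
    (h : SpacelikeOver m u U) {x : E 3} (hx : x ∈ U) :
    meanCurvature m u x = (1 / 3) * ((inducedMetric m u x)⁻¹ * secondFF m u x).trace := by
  simp only [meanCurvature, Matrix.trace, Matrix.diag, Matrix.mul_apply]
  congr 1
  exact Finset.sum_congr rfl fun i _ => Finset.sum_congr rfl fun j _ => by
    rw [secondFF_symm h hx]

theorem tracelessNorm_eq_sqrt_trace {m : ℝ} {u : E 3 → ℝ} {U : Set (E 3)}
    (h : SpacelikeOver m u U) {x : E 3} (hx : x ∈ U) :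
    tracelessNorm m u x = Real.sqrt ((inducedMetric m u x)⁻¹ * tracelessFF m u x
      * ((inducedMetric m u x)⁻¹ * tracelessFF m u x)).trace := by
  have h1 : ∀ i j, tracelessFF m u x i j = tracelessFF m u x j i := by
    intro i j
    simp only [tracelessFF, Matrix.sub_apply, Matrix.smul_apply, secondFF_symm h hx i,
      inducedMetric_symm m u x i]
  have h2 : ∀ i j, (inducedMetric m u x)⁻¹ i j = (inducedMetric m u x)⁻¹ j i := by
    rw [inducedMetric_inv (h.ne_zero x hx) (h.lapse_pos x hx).ne' (h.normalFactor_pos hx).ne']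
    exact fun i j => congrFun (congrFun SpacelikeOver.inducedInv_symm j) i
  rw [tracelessNorm]
  congr 1
  simp only [Matrix.trace, Matrix.diag, Matrix.mul_apply, Fin.sum_univ_three, h2 1 0, h2 2 0,
    h2 2 1, h1 1 0, h1 2 0, h1 2 1]
  ring

/-- The Gauss equation in terms of the traceless part of the second fundamental form. -/
theorem SpacelikeOver.scalarCurvature_eq_traceless {m : ℝ} {u : E 3 → ℝ} {U : Set (E 3)}
    (h : SpacelikeOver m u U) {x : E 3} (hx : x ∈ U) :
    scalarCurvature (inducedMetric m u) x
      = ((inducedMetric m u x)⁻¹ * tracelessFF m u x * ((inducedMetric m u x)⁻¹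
          * tracelessFF m u x)).trace - 6 * meanCurvature m u x ^ 2 := by
  have hG : (inducedMetric m u x)⁻¹ * inducedMetric m u x = 1 := by
    rw [inducedMetric_inv (h.ne_zero x hx) (h.lapse_pos x hx).ne' (h.normalFactor_pos hx).ne']
    exact mul_eq_one_comm.1 (inducedMetric_mul_inducedInv (h.ne_zero x hx)
      (h.lapse_pos x hx).ne' (h.normalFactor_pos hx).ne')
  rw [h.scalarCurvature_eq hx, tracelessFF]
  have hH := meanCurvature_eq_trace h hx
  simp only [mul_sub, sub_mul, Matrix.mul_smul, Matrix.smul_mul, hG, mul_one, one_mul,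
    Matrix.trace_sub, Matrix.trace_smul, Matrix.trace_one, smul_eq_mul, Fintype.card_fin]
  rw [hH]
  push_cast
  ring

/-! ### Functions up to null infinity as functions on `(ℝ³ ∖ {0}) × [0, s₀)` -/

/-- The domain `(ℝ³ ∖ {0}) × [0, s₀)`. -/
def scriDomain (s₀ : ℝ) : Set (E 3 × ℝ) := {0}ᶜ ×ˢ Ico 0 s₀

/-- The extension of a function of `(y, s)` that is constant along the rays in `ℝ³`. -/
noncomputable def rayExt (Q : S2 × ℝ → ℝ) (z : E 3 × ℝ) : ℝ :=
  radialExtension (fun y => Q (y, z.2)) z.1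

theorem radialExtension_coe (f : S2 → ℝ) (y : S2) : radialExtension f (y : E 3) = f y := by
  have h1 : ‖(y : E 3)‖ = 1 := mem_sphere_zero_iff_norm.1 y.2
  have h0 : (y : E 3) ≠ 0 := by
    intro h; rw [h, norm_zero] at h1; exact zero_ne_one h1
  rw [radialExtension, dif_neg h0]
  congr 1
  ext i
  simp [h1]

theorem radialExtension_smul (f : S2 → ℝ) {t : ℝ} (ht : 0 < t) (x : E 3) :
    radialExtension f (t • x) = radialExtension f x := by
  by_cases hx : x = 0
  · simp [hx]
  have h0 : t • x ≠ 0 := smul_ne_zero ht.ne' hx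
  rw [radialExtension, radialExtension, dif_neg h0, dif_neg hx]
  congr 1
  ext i
  simp only [norm_smul, Real.norm_eq_abs, abs_of_pos ht, PiLp.smul_apply, smul_eq_mul, mul_inv]
  field_simp

/-- Near a nonzero vector the identity agrees with a smooth map of the whole space that does not
vanish. -/
theorem exists_nonvanishing_extension {x₀ : E 3} (hx₀ : x₀ ≠ 0) :
    ∃ f : E 3 → E 3, ContDiff ℝ ∞ f ∧ (∀ x, f x ≠ 0) ∧ f =ᶠ[nhds x₀] id := by
  have hn : 0 < ‖x₀‖ := norm_pos_iff.2 hx₀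
  let χ : ContDiffBump x₀ := ⟨‖x₀‖ / 4, ‖x₀‖ / 2, by linarith, by linarith⟩
  refine ⟨fun x => x₀ + χ x • (x - x₀), ?_, ?_, ?_⟩
  · exact contDiff_const.add (χ.contDiff.smul (contDiff_id.sub contDiff_const))
  · intro x h
    have h1 : χ x • (x - x₀) = -x₀ := by rw [← add_eq_zero_iff_eq_neg, add_comm]; exact h
    by_cases hx : dist x x₀ < ‖x₀‖ / 2
    · have h2 := congrArg norm h1
      rw [norm_smul, norm_neg, Real.norm_eq_abs, abs_of_nonneg χ.nonneg, ← dist_eq_norm] at h2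
      have h3 := χ.le_one (x := x)
      have h4 : χ x * dist x x₀ ≤ 1 * dist x x₀ := mul_le_mul_of_nonneg_right h3 dist_nonneg
      linarith
    · rw [χ.zero_of_le_dist (by simpa [χ] using hx), zero_smul] at h1
      exact hx₀ (neg_eq_zero.1 h1.symm)
  · filter_upwards [χ.eventuallyEq_one] with x hx
    simp [hx]

theorem contDiffOn_rayExt {s₀ : ℝ} {Q : S2 × ℝ → ℝ} (hQ : SmoothUpToScri s₀ Q) :
    ContDiffOn ℝ ∞ (rayExt Q) (scriDomain s₀) := by
  intro z₀ hz₀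
  obtain ⟨f, hf, hf0, hfe⟩ := exists_nonvanishing_extension (x₀ := z₀.1) hz₀.1
  have hunit : ∀ x : E 3, ‖f x‖⁻¹ • f x ∈ sphere (0 : E 3) 1 := fun x => by
    rw [mem_sphere_zero_iff_norm, norm_smul, norm_inv, norm_norm,
      inv_mul_cancel₀ (norm_ne_zero_iff.2 (hf0 x))]
  have hg : ContMDiff 𝓘(ℝ, E 3) 𝓘(ℝ, E 3) ∞ (fun x : E 3 => ‖f x‖⁻¹ • f x) :=
    (((hf.norm ℝ hf0).inv fun x => norm_ne_zero_iff.2 (hf0 x)).smul hf).contMDiff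
  have hg' : ContMDiff 𝓘(ℝ, E 3) (𝓡 2) ∞ (fun x : E 3 => (⟨‖f x‖⁻¹ • f x, hunit x⟩ : S2)) :=
    haveI : Fact (Module.finrank ℝ (E 3) = 2 + 1) := ⟨by simp⟩
    hg.codRestrict_sphere hunit
  have hΦ : ContMDiff 𝓘(ℝ, E 3 × ℝ) ((𝓡 2).prod 𝓘(ℝ, ℝ)) ∞
      (fun z : E 3 × ℝ => ((⟨‖f z.1‖⁻¹ • f z.1, hunit z.1⟩ : S2), z.2)) :=
    (hg'.comp contDiff_fst.contMDiff).prodMk contDiff_snd.contMDiff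
  have hcomp : ContMDiffWithinAt 𝓘(ℝ, E 3 × ℝ) 𝓘(ℝ, ℝ) ∞
      (Q ∘ fun z : E 3 × ℝ => ((⟨‖f z.1‖⁻¹ • f z.1, hunit z.1⟩ : S2), z.2)) (scriDomain s₀) z₀ :=
    (hQ _ ⟨mem_univ _, hz₀.2⟩).comp z₀ hΦ.contMDiffAt.contMDiffWithinAt
      (fun z hz => ⟨mem_univ _, hz.2⟩)
  refine (contMDiffWithinAt_iff_contDiffWithinAt.1 hcomp).congr_of_eventuallyEq_of_mem ?_ hz₀
  have h1 : ∀ᶠ z : E 3 × ℝ in nhds z₀, f z.1 = z.1 :=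
    (continuous_fst.tendsto z₀).eventually hfe
  filter_upwards [h1.filter_mono nhdsWithin_le_nhds, self_mem_nhdsWithin] with z hz hzD
  have h0 : z.1 ≠ 0 := hzD.1
  simp only [rayExt, radialExtension, dif_neg h0, Function.comp_apply]
  congr 3
  rw [hz]

theorem uniqueDiffOn_scriDomain (s₀ : ℝ) : UniqueDiffOn ℝ (scriDomain s₀) :=
  isOpen_compl_singleton.uniqueDiffOn.prod (uniqueDiffOn_Ico 0 s₀)

/-- The partial derivative in the direction of `x i`, up to the boundary. -/
noncomputable def dX (s₀ : ℝ) (i : Fin 3) (f : E 3 × ℝ → ℝ) (z : E 3 × ℝ) : ℝ :=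
  fderivWithin ℝ f (scriDomain s₀) z (EuclideanSpace.single i 1, 0)

/-- The partial derivative in the direction of `s`, up to the boundary. -/
noncomputable def dS (s₀ : ℝ) (f : E 3 × ℝ → ℝ) (z : E 3 × ℝ) : ℝ :=
  fderivWithin ℝ f (scriDomain s₀) z (0, 1)

section

variable {s₀ : ℝ} {f : E 3 × ℝ → ℝ}

theorem contDiffOn_dX (hf : ContDiffOn ℝ ∞ f (scriDomain s₀)) (i : Fin 3) :
    ContDiffOn ℝ ∞ (dX s₀ i f) (scriDomain s₀) :=
  (hf.fderivWithin (uniqueDiffOn_scriDomain s₀) (m := ∞) le_rfl).clm_apply contDiffOn_const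

theorem contDiffOn_dS (hf : ContDiffOn ℝ ∞ f (scriDomain s₀)) :
    ContDiffOn ℝ ∞ (dS s₀ f) (scriDomain s₀) :=
  (hf.fderivWithin (uniqueDiffOn_scriDomain s₀) (m := ∞) le_rfl).clm_apply contDiffOn_const

theorem hasFDerivWithinAt_of_contDiffOn (hf : ContDiffOn ℝ ∞ f (scriDomain s₀)) {z : E 3 × ℝ}
    (hz : z ∈ scriDomain s₀) :
    HasFDerivWithinAt f (fderivWithin ℝ f (scriDomain s₀) z) (scriDomain s₀) z :=
  ((hf z hz).differentiableWithinAt (by simp)).hasFDerivWithinAt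

theorem second_fderivWithin (hf : ContDiffOn ℝ ∞ f (scriDomain s₀)) {z : E 3 × ℝ}
    (hz : z ∈ scriDomain s₀) (v w : E 3 × ℝ) :
    fderivWithin ℝ (fun z => fderivWithin ℝ f (scriDomain s₀) z w) (scriDomain s₀) z v
      = fderivWithin ℝ (fun z => fderivWithin ℝ f (scriDomain s₀) z v) (scriDomain s₀) z w := by
  have hu := uniqueDiffOn_scriDomain s₀ z hz
  have hd : DifferentiableWithinAt ℝ (fderivWithin ℝ f (scriDomain s₀)) (scriDomain s₀) z :=
    ((hf.fderivWithin (uniqueDiffOn_scriDomain s₀) (m := ∞) le_rfl) z hz).differentiableWithinAt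
      (by simp)
  have hcl : z ∈ closure (interior (scriDomain s₀)) := by
    have h1 : ({0}ᶜ : Set (E 3)) ×ˢ Ioo 0 s₀ ⊆ interior (scriDomain s₀) := by
      rw [scriDomain, interior_prod_eq, isOpen_compl_singleton.interior_eq, interior_Ico]
    refine closure_mono h1 ?_
    rw [closure_prod_eq]
    refine ⟨subset_closure hz.1, ?_⟩
    rw [closure_Ioo (hz.2.1.trans_lt hz.2.2).ne]
    exact ⟨hz.2.1, hz.2.2.le⟩
  have hs : IsSymmSndFDerivWithinAt ℝ f (scriDomain s₀) z :=
    (hf z hz).isSymmSndFDerivWithinAt (by simp; exact WithTop.coe_le_coe.2 le_top)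
      (uniqueDiffOn_scriDomain s₀) hcl hz
  have key : ∀ v w, fderivWithin ℝ (fun z => fderivWithin ℝ f (scriDomain s₀) z w)
      (scriDomain s₀) z v
      = fderivWithin ℝ (fderivWithin ℝ f (scriDomain s₀)) (scriDomain s₀) z v w := by
    intro v w
    have := (hd.hasFDerivWithinAt.clm_apply
      (hasFDerivWithinAt_const w z (scriDomain s₀))).fderivWithin hu
    rw [this]; simp
  rw [key, key, hs.eq]

theorem dX_dS_comm (hf : ContDiffOn ℝ ∞ f (scriDomain s₀)) {z : E 3 × ℝ}
    (hz : z ∈ scriDomain s₀) (i : Fin 3) : dX s₀ i (dS s₀ f) z = dS s₀ (dX s₀ i f) z :=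
  second_fderivWithin hf hz _ _

theorem dX_comm (hf : ContDiffOn ℝ ∞ f (scriDomain s₀)) {z : E 3 × ℝ}
    (hz : z ∈ scriDomain s₀) (i j : Fin 3) : dX s₀ i (dX s₀ j f) z = dX s₀ j (dX s₀ i f) z :=
  second_fderivWithin hf hz _ _

theorem dS_congr {g : E 3 × ℝ → ℝ} (h : EqOn f g (scriDomain s₀)) :
    EqOn (dS s₀ f) (dS s₀ g) (scriDomain s₀) := fun z hz => by
  rw [dS, dS, fderivWithin_congr h (h hz)]

theorem hasDerivWithinAt_dS (hf : ContDiffOn ℝ ∞ f (scriDomain s₀)) {x : E 3} {s : ℝ}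
    (hz : (x, s) ∈ scriDomain s₀) :
    HasDerivWithinAt (fun t => f (x, t)) (dS s₀ f (x, s)) (Ico 0 s₀) s := by
  have h1 : HasDerivWithinAt (fun t : ℝ => ((x, t) : E 3 × ℝ)) (0, 1) (Ico 0 s₀) s :=
    (hasDerivWithinAt_const s _ x).prodMk (hasDerivWithinAt_id s _)
  exact (hasFDerivWithinAt_of_contDiffOn hf hz).comp_hasDerivWithinAt s h1
    (fun t ht => ⟨hz.1, ht⟩)

/-- At a fixed value of `s`, the operator `dX` is the partial derivative. -/
theorem hasPD_slice (hf : ContDiffOn ℝ ∞ f (scriDomain s₀)) {x : E 3} {s : ℝ}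
    (hz : (x, s) ∈ scriDomain s₀) :
    HasPD (fun x' => f (x', s)) (fun i => dX s₀ i f (x, s)) x := by
  have h1 : HasFDerivWithinAt (fun x' : E 3 => ((x', s) : E 3 × ℝ))
      ((ContinuousLinearMap.id ℝ (E 3)).prod 0) {0}ᶜ x :=
    (hasFDerivWithinAt_id x _).prodMk (hasFDerivWithinAt_const s x _)
  have hmaps : MapsTo (fun x' : E 3 => ((x', s) : E 3 × ℝ)) {0}ᶜ (scriDomain s₀) :=
    fun t ht => ⟨ht, hz.2⟩
  have h2 := (hasFDerivWithinAt_of_contDiffOn hf hz).comp x h1 hmaps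
  have h3 := h2.hasFDerivAt (isOpen_compl_singleton.mem_nhds hz.1)
  refine ⟨h3.differentiableAt, fun i => ?_⟩
  have h4 := h3.fderiv
  simp only [Function.comp_def] at h4
  rw [pderiv, h4]
  simp [dX]

theorem contDiffOn_slice (hf : ContDiffOn ℝ ∞ f (scriDomain s₀)) {s : ℝ} (hs : s ∈ Ico 0 s₀) :
    ContDiffOn ℝ ∞ (fun x => f (x, s)) {0}ᶜ := by
  have h : ContDiffOn ℝ ∞ (fun x : E 3 => ((x, s) : E 3 × ℝ)) {0}ᶜ :=
    (contDiff_id.prodMk contDiff_const).contDiffOn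
  exact hf.comp h fun x hx => ⟨hx, hs⟩

/-- The derivative of `x ↦ f (x, 1 / |x|)`. -/
theorem hasPD_comp_inv_norm (hf : ContDiffOn ℝ ∞ f (scriDomain s₀)) {x : E 3} (hx : x ≠ 0)
    (hs : ‖x‖⁻¹ < s₀) :
    HasPD (fun x => f (x, ‖x‖⁻¹))
      (fun i => dX s₀ i f (x, ‖x‖⁻¹) - unitDir x i / ‖x‖ ^ 2 * dS s₀ f (x, ‖x‖⁻¹)) x := by
  have hr : 0 < ‖x‖ := norm_pos_iff.2 hx
  have hz : (x, ‖x‖⁻¹) ∈ scriDomain s₀ := ⟨hx, (inv_pos.2 hr).le, hs⟩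
  have hnhds : scriDomain s₀ ∈ nhds (x, ‖x‖⁻¹) :=
    prod_mem_nhds (isOpen_compl_singleton.mem_nhds hx) (Ico_mem_nhds (inv_pos.2 hr) hs)
  have h1 := (HasPD.norm hx).comp (hasDerivAt_inv hr.ne')
  have h2 := (hasFDerivAt_id x).prodMk h1.diff.hasFDerivAt
  have h3 := ((hasFDerivWithinAt_of_contDiffOn hf hz).hasFDerivAt hnhds).comp x h2
  refine ⟨h3.differentiableAt, fun i => ?_⟩
  have h4 := h3.fderiv
  simp only [Function.comp_def, id] at h4
  rw [pderiv, h4]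
  have h5 : (fderiv ℝ (fun z : E 3 => ‖z‖⁻¹) x) (EuclideanSpace.single i 1)
      = -(unitDir x i / ‖x‖ ^ 2) := by
    refine (h1.eq i).trans ?_
    simp only [unitDir]; field_simp
  simp only [ContinuousLinearMap.comp_apply, ContinuousLinearMap.prod_apply, h5,
    ContinuousLinearMap.id_apply]
  have h6 : ((EuclideanSpace.single i 1 : E 3), -(unitDir x i / ‖x‖ ^ 2))
      = (EuclideanSpace.single i (1 : ℝ), (0 : ℝ)) + (-(unitDir x i / ‖x‖ ^ 2)) • ((0 : E 3), (1 : ℝ)) := by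
    simp
  rw [h6, map_add, map_smul]
  simp only [dX, dS, smul_eq_mul]
  ring

end

/-! ### Homogeneous functions -/

/-- `g` is positively homogeneous of degree `k` on `ℝ³ ∖ {0}`. -/
def IsHomog (k : ℤ) (g : E 3 → ℝ) : Prop := ∀ t : ℝ, 0 < t → ∀ x, x ≠ 0 → g (t • x) = t ^ k * g x

theorem IsHomog.pderiv {k : ℤ} {g : E 3 → ℝ} (hg : IsHomog k g) (hd : ContDiffOn ℝ ∞ g {0}ᶜ)
    (i : Fin 3) : IsHomog (k - 1) (pderiv i g) := by
  intro t ht x hx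
  have hx' : t • x ≠ 0 := smul_ne_zero ht.ne' hx
  have h1 := (ContDiffOn.hasPD isOpen_compl_singleton hd (x := t • x) hx').diff
  have h0 := ContDiffOn.hasPD isOpen_compl_singleton hd (x := x) hx
  have h2 : HasFDerivAt (fun x : E 3 => g (t • x))
      ((fderiv ℝ g (t • x)).comp (t • ContinuousLinearMap.id ℝ (E 3))) x :=
    h1.hasFDerivAt.comp x ((hasFDerivAt_id x).const_smul t)
  have h3 : (fun x : E 3 => g (t • x)) =ᶠ[nhds x] fun x => t ^ k * g x := by
    filter_upwards [isOpen_compl_singleton.mem_nhds hx] with z hz using hg t ht z hz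
  have h4 := (h0.const_mul (t ^ k)).congr_of_eventuallyEq h3
  have h5 := h4.eq i
  rw [SchwarzschildCMC.pderiv, h2.fderiv] at h5
  have h6 : t * SchwarzschildCMC.pderiv i g (t • x) = t ^ k * SchwarzschildCMC.pderiv i g x := by
    simpa [SchwarzschildCMC.pderiv] using h5
  rw [zpow_sub_one₀ ht.ne']
  field_simp
  linarith

/-- Euler's identity. -/
theorem IsHomog.euler {k : ℤ} {g : E 3 → ℝ} (hg : IsHomog k g) {x : E 3}
    (hd : DifferentiableAt ℝ g x) (hx : x ≠ 0) : ∑ i, x i * SchwarzschildCMC.pderiv i g x = k * g x := by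
  rw [← fderiv_eq_sum_pderiv]
  have h1 : HasDerivAt (fun t : ℝ => t • x) x 1 := by
    simpa using (hasDerivAt_id (1 : ℝ)).smul_const x
  have h2 : HasFDerivAt g (fderiv ℝ g x) ((1 : ℝ) • x) := by simpa using hd.hasFDerivAt
  have h3 := h2.comp_hasDerivAt 1 h1
  have h4 : HasDerivAt (fun t : ℝ => t ^ k * g x) (k * g x) 1 := by
    simpa using (hasDerivAt_zpow k (1 : ℝ) (Or.inl one_ne_zero)).mul_const (g x)
  have h5 : (g ∘ fun t : ℝ => t • x) =ᶠ[nhds 1] fun t => t ^ k * g x := by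
    filter_upwards [lt_mem_nhds (zero_lt_one (α := ℝ))] with t ht using hg t ht x hx
  exact (h3.congr_of_eventuallyEq h5.symm).unique h4

theorem isHomog_rayExt (Q : S2 × ℝ → ℝ) (s : ℝ) : IsHomog 0 (fun x => rayExt Q (x, s)) :=
  fun t ht x _ => by simp [rayExt, radialExtension_smul _ ht]

theorem isHomog_dX {s₀ : ℝ} {f : E 3 × ℝ → ℝ} (hf : ContDiffOn ℝ ∞ f (scriDomain s₀)) {k : ℤ}
    (hk : ∀ s ∈ Ico 0 s₀, IsHomog k (fun x => f (x, s))) (i : Fin 3) :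
    ∀ s ∈ Ico 0 s₀, IsHomog (k - 1) (fun x => dX s₀ i f (x, s)) := by
  intro s hs t ht x hx
  have h := (hk s hs).pderiv (contDiffOn_slice hf hs) i t ht x hx
  rwa [(hasPD_slice hf (x := t • x) ⟨smul_ne_zero ht.ne' hx, hs⟩).eq i,
    (hasPD_slice hf (x := x) ⟨hx, hs⟩).eq i] at h

theorem isHomog_dS {s₀ : ℝ} {f : E 3 × ℝ → ℝ} (hf : ContDiffOn ℝ ∞ f (scriDomain s₀)) {k : ℤ}
    (hk : ∀ s ∈ Ico 0 s₀, IsHomog k (fun x => f (x, s))) :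
    ∀ s ∈ Ico 0 s₀, IsHomog k (fun x => dS s₀ f (x, s)) := by
  intro s hs t ht x hx
  have h1 := hasDerivWithinAt_dS hf (x := t • x) (s := s) ⟨smul_ne_zero ht.ne' hx, hs⟩
  have h2 := (hasDerivWithinAt_dS hf (x := x) (s := s) ⟨hx, hs⟩).const_mul (t ^ k)
  have h3 : HasDerivWithinAt (fun s => f (t • x, s)) (t ^ k * dS s₀ f (x, s)) (Ico 0 s₀) s :=
    h2.congr (fun s' hs' => hk s' hs' t ht x hx) (hk s hs t ht x hx)
  exact (uniqueDiffOn_Ico 0 s₀ s hs).eq_deriv _ h1 h3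

theorem sum_mul_dX {s₀ : ℝ} {f : E 3 × ℝ → ℝ} (hf : ContDiffOn ℝ ∞ f (scriDomain s₀)) {k : ℤ}
    (hk : ∀ s ∈ Ico 0 s₀, IsHomog k (fun x => f (x, s))) {z : E 3 × ℝ} (hz : z ∈ scriDomain s₀) :
    ∑ i, z.1 i * dX s₀ i f z = k * f z := by
  have h := hasPD_slice hf (x := z.1) (s := z.2) hz
  rw [← (hk z.2 hz.2).euler h.diff hz.1]
  exact Finset.sum_congr rfl fun i _ => by rw [h.eq i]

/-! ### Uniform Taylor expansions at null infinity -/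

/-- The filter of `(y, s)` with `|y| = 1` and `s → 0+`, uniformly in `y`. -/
def scriFilter : Filter (E 3 × ℝ) := 𝓟 (sphere 0 1) ×ˢ nhdsWithin 0 (Ioi 0)

theorem eventually_scriFilter {p : E 3 × ℝ → Prop} :
    (∀ᶠ z in scriFilter, p z) ↔ ∃ δ > 0, ∀ y ∈ sphere (0 : E 3) 1, ∀ s ∈ Ioo 0 δ, p (y, s) := by
  rw [scriFilter, ((hasBasis_principal _).prod (nhdsGT_basis (0 : ℝ))).eventually_iff]
  constructor
  · rintro ⟨⟨_, δ⟩, ⟨_, hδ⟩, h⟩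
    exact ⟨δ, hδ, fun y hy s hs => h ⟨hy, hs⟩⟩
  · rintro ⟨δ, hδ, h⟩
    exact ⟨⟨(), δ⟩, ⟨trivial, hδ⟩, fun z hz => h z.1 hz.1 z.2 hz.2⟩

theorem sphere_ne_zero {y : E 3} (hy : y ∈ sphere (0 : E 3) 1) : y ≠ 0 := by
  rintro rfl; simp at hy

theorem eventually_scriFilter_mem {s₀ : ℝ} (hs₀ : 0 < s₀) :
    ∀ᶠ z in scriFilter, z ∈ scriDomain s₀ ∧ z.1 ∈ sphere (0 : E 3) 1 ∧ 0 < z.2 ∧ z.2 < s₀ :=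
  eventually_scriFilter.2 ⟨s₀, hs₀, fun _ hy _ hs =>
    ⟨⟨sphere_ne_zero hy, hs.1.le, hs.2⟩, hy, hs.1, hs.2⟩⟩

/-- `f = O(s^k)` at null infinity, uniformly on the sphere. -/
def ScriO (f : E 3 × ℝ → ℝ) (k : ℕ) : Prop := f =O[scriFilter] fun z => z.2 ^ k

theorem scriO_iff {f : E 3 × ℝ → ℝ} {k : ℕ} : ScriO f k ↔
    ∃ C, 0 ≤ C ∧ ∃ δ > 0, ∀ y ∈ sphere (0 : E 3) 1, ∀ s ∈ Ioo 0 δ, |f (y, s)| ≤ C * s ^ k := by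
  constructor
  · intro h
    obtain ⟨C, hC, h1⟩ := h.exists_nonneg
    obtain ⟨δ, hδ, h2⟩ := eventually_scriFilter.1 h1.bound
    refine ⟨C, hC, δ, hδ, fun y hy s hs => ?_⟩
    have := h2 y hy s hs
    rwa [Real.norm_eq_abs, Real.norm_eq_abs, abs_of_nonneg (pow_nonneg hs.1.le k)] at this
  · rintro ⟨C, _, δ, hδ, h⟩
    refine IsBigO.of_bound C (eventually_scriFilter.2 ⟨δ, hδ, fun y hy s hs => ?_⟩)
    rw [Real.norm_eq_abs, Real.norm_eq_abs, abs_of_nonneg (pow_nonneg hs.1.le k)]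
    exact h y hy s hs

/-- The change of variables `𝐱 = y / s`. -/
theorem isBigOScri_iff {F : E 3 → ℝ} {k : ℕ} :
    IsBigOScri F k ↔ ScriO (fun z => F (z.2⁻¹ • z.1)) k := by
  rw [scriO_iff, IsBigOScri]
  constructor
  · intro h
    obtain ⟨C, hC, h1⟩ := h.exists_nonneg
    obtain ⟨R, -, hR⟩ := (hasBasis_cobounded_norm (E := E 3)).eventually_iff.1 h1.bound
    refine ⟨C, hC, (max R 1)⁻¹, by positivity, fun y hy s hs => ?_⟩
    have hn : ‖s⁻¹ • y‖ = s⁻¹ := by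
      rw [norm_smul, mem_sphere_zero_iff_norm.1 hy, mul_one, norm_inv, Real.norm_eq_abs,
        abs_of_pos hs.1]
    have hs' : R ≤ s⁻¹ := (le_max_left R 1).trans ((lt_inv_comm₀ hs.1 (by positivity)).1 hs.2).le
    have := hR (x := s⁻¹ • y) (by simpa [hn] using hs')
    rwa [hn, inv_inv, Real.norm_eq_abs, Real.norm_eq_abs,
      abs_of_nonneg (pow_nonneg hs.1.le k)] at this
  · rintro ⟨C, _, δ, hδ, h⟩
    refine IsBigO.of_bound C ?_
    refine (hasBasis_cobounded_norm (E := E 3)).eventually_iff.2 ⟨δ⁻¹ + 1, trivial, fun x hx => ?_⟩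
    have hx' : δ⁻¹ < ‖x‖ := by
      have : δ⁻¹ + 1 ≤ ‖x‖ := hx
      linarith
    have hr : 0 < ‖x‖ := (inv_pos.2 hδ).trans hx'
    have hy : ‖x‖⁻¹ • x ∈ sphere (0 : E 3) 1 := by
      rw [mem_sphere_zero_iff_norm, norm_smul, norm_inv, norm_norm, inv_mul_cancel₀ hr.ne']
    have := h _ hy ‖x‖⁻¹ ⟨inv_pos.2 hr, (inv_lt_comm₀ hδ hr).1 hx'⟩
    rw [inv_inv, smul_smul, mul_inv_cancel₀ hr.ne', one_smul] at this
    rwa [Real.norm_eq_abs, Real.norm_eq_abs, abs_of_nonneg (pow_nonneg (inv_pos.2 hr).le k)]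

/-- A term `a(y) s^k` that is `O(s^{k+1})` vanishes. -/
theorem eq_zero_of_scriO {a : E 3 → ℝ} {k : ℕ} (h : ScriO (fun z => a z.1 * z.2 ^ k) (k + 1))
    {y : E 3} (hy : y ∈ sphere (0 : E 3) 1) : a y = 0 := by
  obtain ⟨C, hC, δ, hδ, h1⟩ := scriO_iff.1 h
  have h2 : ∀ s ∈ Ioo 0 δ, |a y| ≤ C * s := by
    intro s hs
    have := h1 y hy s hs
    have hk : 0 < s ^ k := pow_pos hs.1 k
    rw [abs_mul, abs_of_pos hk, pow_succ, mul_comm (s ^ k), ← mul_assoc] at this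
    exact le_of_mul_le_mul_right this hk
  by_contra ha
  have ha' : 0 < |a y| := abs_pos.2 ha
  have hlt : min (δ / 2) (|a y| / (2 * (C + 1))) ∈ Ioo 0 δ :=
    ⟨by positivity, (min_le_left _ _).trans_lt (by linarith)⟩
  have h3 := h2 _ hlt
  have h4 : C * min (δ / 2) (|a y| / (2 * (C + 1))) ≤ C * (|a y| / (2 * (C + 1))) :=
    mul_le_mul_of_nonneg_left (min_le_right _ _) hC
  have h5 : C * (|a y| / (2 * (C + 1))) < |a y| := by
    rw [mul_div_assoc', div_lt_iff₀ (by positivity)]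
    nlinarith
  linarith

/-- By induction on the order: integrate the estimate for `∂ₛf`. -/
theorem taylor_bound {s₀ : ℝ} (hs₀ : 0 < s₀) (n : ℕ) : ∀ {f : E 3 × ℝ → ℝ},
    ContDiffOn ℝ ∞ f (scriDomain s₀) →
    ∃ C, 0 ≤ C ∧ ∀ y ∈ sphere (0 : E 3) 1, ∀ s ∈ Icc 0 (s₀ / 2),
      |f (y, s) - ∑ j ∈ Finset.range n, s ^ j / (j.factorial : ℝ) * (dS s₀)^[j] f (y, 0)|
        ≤ C * s ^ n := by
  induction n with
  | zero =>
    intro f hf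
    have hsub : sphere (0 : E 3) 1 ×ˢ Icc 0 (s₀ / 2) ⊆ scriDomain s₀ := fun z hz =>
      ⟨sphere_ne_zero hz.1, hz.2.1, by have := hz.2.2; linarith⟩
    obtain ⟨C, hC⟩ := ((isCompact_sphere (0 : E 3) 1).prod
      (isCompact_Icc (a := (0 : ℝ)) (b := s₀ / 2))).exists_bound_of_continuousOn
      (hf.continuousOn.mono hsub)
    refine ⟨max C 0, le_max_right _ _, fun y hy s hs => ?_⟩
    simpa using Or.inl (hC (y, s) ⟨hy, hs⟩)
  | succ n ih =>
    intro f hf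
    obtain ⟨C, hC, h⟩ := ih (contDiffOn_dS hf)
    refine ⟨C, hC, fun y hy s hs => ?_⟩
    set g : ℝ → ℝ := fun t =>
      f (y, t) - ∑ j ∈ Finset.range (n + 1), t ^ j / (j.factorial : ℝ) * (dS s₀)^[j] f (y, 0)
      with hg
    have hsub : Icc 0 s ⊆ Ico 0 s₀ := fun t ht => ⟨ht.1, by have := ht.2; have := hs.2; linarith⟩
    have hder : ∀ t ∈ Icc 0 s, HasDerivWithinAt g (dS s₀ f (y, t)
        - ∑ j ∈ Finset.range n, t ^ j / (j.factorial : ℝ) * (dS s₀)^[j] (dS s₀ f) (y, 0))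
        (Icc 0 s) t := by
      intro t ht
      have h1 := (hasDerivWithinAt_dS hf (x := y) (s := t) ⟨sphere_ne_zero hy, hsub ht⟩).mono hsub
      have h2 : HasDerivWithinAt (fun t => ∑ j ∈ Finset.range (n + 1),
          t ^ j / (j.factorial : ℝ) * (dS s₀)^[j] f (y, 0))
          (∑ j ∈ Finset.range (n + 1), (j : ℝ) * t ^ (j - 1) / (j.factorial : ℝ)
            * (dS s₀)^[j] f (y, 0)) (Icc 0 s) t := by
        refine HasDerivWithinAt.fun_sum fun j _ => ?_
        exact (((hasDerivAt_pow j t).div_const _).mul_const _).hasDerivWithinAt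
      refine (h1.sub h2).congr_deriv ?_
      rw [Finset.sum_range_succ']
      simp only [CharP.cast_eq_zero, zero_mul, zero_div, add_zero, Nat.add_sub_cancel,
        Function.iterate_succ, Function.comp_apply]
      congr 1
      refine Finset.sum_congr rfl fun j _ => ?_
      rw [Nat.factorial_succ]
      push_cast
      have : (j.factorial : ℝ) ≠ 0 := by positivity
      have : (j : ℝ) + 1 ≠ 0 := by positivity
      field_simp
    have hb : ∀ t ∈ Icc 0 s, ‖dS s₀ f (y, t)
        - ∑ j ∈ Finset.range n, t ^ j / (j.factorial : ℝ) * (dS s₀)^[j] (dS s₀ f) (y, 0)‖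
        ≤ C * s ^ n := by
      intro t ht
      refine (h y hy t ⟨ht.1, ht.2.trans hs.2⟩).trans ?_
      exact mul_le_mul_of_nonneg_left (pow_le_pow_left₀ ht.1 ht.2 n) hC
    have h0 : g 0 = 0 := by
      simp [hg, Finset.sum_range_succ']
    have hmv := (convex_Icc 0 s).norm_image_sub_le_of_norm_hasDerivWithin_le hder hb
      (left_mem_Icc.2 hs.1) (right_mem_Icc.2 hs.1)
    rw [h0, sub_zero, sub_zero, Real.norm_eq_abs, Real.norm_eq_abs, abs_of_nonneg hs.1] at hmv
    rw [pow_succ, ← mul_assoc]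
    exact hmv

/-- The Taylor expansion in `s`, uniformly on the sphere. -/
theorem taylor_scriO {s₀ : ℝ} (hs₀ : 0 < s₀) {f : E 3 × ℝ → ℝ}
    (hf : ContDiffOn ℝ ∞ f (scriDomain s₀)) (n : ℕ) :
    ScriO (fun z => f z - ∑ j ∈ Finset.range n,
      z.2 ^ j / (j.factorial : ℝ) * (dS s₀)^[j] f (z.1, 0)) n := by
  obtain ⟨C, hC, h⟩ := taylor_bound hs₀ n hf
  exact scriO_iff.2 ⟨C, hC, s₀ / 2, by linarith, fun y hy s hs => h y hy s ⟨hs.1.le, hs.2.le⟩⟩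

theorem iteratedDerivWithin_eq_dS {s₀ : ℝ} (n : ℕ) : ∀ {f : E 3 × ℝ → ℝ},
    ContDiffOn ℝ ∞ f (scriDomain s₀) → ∀ {y : E 3}, y ≠ 0 → ∀ {s : ℝ}, s ∈ Ico 0 s₀ →
    iteratedDerivWithin n (fun t => f (y, t)) (Ico 0 s₀) s = (dS s₀)^[n] f (y, s) := by
  induction n with
  | zero => intro f hf y hy s hs; simp
  | succ n ih =>
    intro f hf y hy s hs
    rw [iteratedDerivWithin_succ', Function.iterate_succ, Function.comp_apply,
      ← ih (contDiffOn_dS hf) hy hs]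
    refine iteratedDerivWithin_congr (fun t ht => ?_) hs
    exact (hasDerivWithinAt_dS hf (x := y) ⟨hy, ht⟩).derivWithin (uniqueDiffOn_Ico 0 s₀ t ht)

/-! ### The conformal metric at null infinity -/

/-- The second order jet of `P` at a point `(y, s)`: `X` and `H` are the gradient and the Hessian
at `y` of the extension of `P(·, s)` that is constant along rays, `Z` is the gradient of `∂ₛP`, and
`p₁`, `p₂` are the derivatives of `P` in `s`. -/
structure ScriJet where
  (m s p₁ p₂ : ℝ)
  (y X Z : Fin 3 → ℝ)
  H : Matrix (Fin 3) (Fin 3) ℝ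
  y_sq : y ⬝ᵥ y = 1
  y_X : y ⬝ᵥ X = 0
  y_Z : y ⬝ᵥ Z = 0
  H_y : H.mulVec y = -X
  H_symm : H.transpose = H

namespace ScriJet

variable (J : ScriJet)

/-- `s² h`. -/
def q : ℝ := J.s ^ 2 - 2 * J.m * J.s ^ 3

/-- The derivative of `s² h` in `s`. -/
def dq : ℝ := 2 * J.s - 6 * J.m * J.s ^ 2

/-- The component in the direction of `s` of the gradient of `v + P` in the metric `s² g`, where
`v = t - r_*`. -/
def w : ℝ := 1 + J.q * J.p₁

/-- Minus the square of the gradient of `v + P` in the metric `s² g`. -/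
def Q : ℝ := -2 * J.p₁ - J.q * J.p₁ ^ 2 - J.X ⬝ᵥ J.X

/-- The projection to the tangent space of the sphere. -/
def Pr : Matrix (Fin 3) (Fin 3) ℝ := 1 - Matrix.vecMulVec J.y J.y

/-- The Hessian on the sphere. -/
def HT : Matrix (Fin 3) (Fin 3) ℝ :=
  J.H + Matrix.vecMulVec J.y J.X + Matrix.vecMulVec J.X J.y

/-- The metric `s² G` in the coordinates `(y, s)`, with `∂ₛ` in the place of the vector `y`. -/
def metric : Matrix (Fin 3) (Fin 3) ℝ :=
  (-2 * J.p₁ - J.q * J.p₁ ^ 2) • Matrix.vecMulVec J.y J.y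
    - J.w • (Matrix.vecMulVec J.y J.X + Matrix.vecMulVec J.X J.y)
    + J.Pr - J.q • Matrix.vecMulVec J.X J.X

/-- The inverse of `ScriJet.metric`. -/
noncomputable def inv : Matrix (Fin 3) (Fin 3) ℝ :=
  J.Pr + J.Q⁻¹ • ((1 - J.q * (J.X ⬝ᵥ J.X)) • Matrix.vecMulVec J.y J.y
    + J.w • (Matrix.vecMulVec J.y J.X + Matrix.vecMulVec J.X J.y) + Matrix.vecMulVec J.X J.X)

/-- The component of `ScriJet.hess` along `∂ₛ`. -/
noncomputable def k₀ : ℝ := J.p₂ - 3 / 2 * J.dq * J.p₁ ^ 2 - 1 / 2 * J.q * J.dq * J.p₁ ^ 3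

/-- The mixed components of `ScriJet.hess`. -/
noncomputable def ζ : Fin 3 → ℝ := J.Z - (J.dq * J.p₁ + 1 / 2 * J.q * J.dq * J.p₁ ^ 2) • J.X

/-- The components of `ScriJet.hess` tangential to the sphere. -/
noncomputable def T : Matrix (Fin 3) (Fin 3) ℝ :=
  J.HT - (1 / 2 * J.dq * J.w) • Matrix.vecMulVec J.X J.X

/-- The Hessian of `v + P` in the metric `s² g`, restricted to the surface. -/
noncomputable def hess : Matrix (Fin 3) (Fin 3) ℝ :=
  J.k₀ • Matrix.vecMulVec J.y J.y + (Matrix.vecMulVec J.y J.ζ + Matrix.vecMulVec J.ζ J.y) + J.T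

/-- The trace of `ScriJet.hess`. -/
noncomputable def tr : ℝ := (J.inv * J.hess).trace

/-- The derivative of `Q` in `s`. -/
def dsQ : ℝ := -2 * J.p₂ - J.dq * J.p₁ ^ 2 - 2 * J.q * J.p₁ * J.p₂ - 2 * (J.X ⬝ᵥ J.Z)

/-- The derivative of `Q` along the gradient `X` of `P`. -/
def dXQ : ℝ := -2 * J.w * (J.Z ⬝ᵥ J.X) - 2 * (J.X ⬝ᵥ J.HT.mulVec J.X)

variable {J}

theorem X_y : J.X ⬝ᵥ J.y = 0 := by rw [dotProduct_comm, J.y_X]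
theorem Z_y : J.Z ⬝ᵥ J.y = 0 := by rw [dotProduct_comm, J.y_Z]

theorem ζ_y : J.ζ ⬝ᵥ J.y = 0 := by
  rw [ζ, sub_dotProduct, smul_dotProduct, X_y, Z_y]; simp

theorem HT_symm : J.HT.transpose = J.HT := by
  simp only [HT, Matrix.transpose_add, J.H_symm, Matrix.transpose_vecMulVec]
  abel

theorem HT_y : J.HT.mulVec J.y = 0 := by
  rw [HT, Matrix.add_mulVec, Matrix.add_mulVec, J.H_y, Matrix.vecMulVec_mulVec,
    Matrix.vecMulVec_mulVec, X_y, J.y_sq]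
  simp

theorem y_HT : Matrix.vecMul J.y J.HT = 0 := by
  rw [← HT_symm, Matrix.vecMul_transpose, HT_y]

theorem metric_mul_inv (hQ : J.Q ≠ 0) : J.metric * J.inv = 1 := by
  have h1 : J.X ⬝ᵥ J.X = -2 * J.p₁ - J.q * J.p₁ ^ 2 - J.Q := by rw [Q]; ring
  have hy := J.y_sq
  have hyX := J.y_X
  have hXy := X_y (J := J)
  rw [metric, inv, Pr]
  simp only [mul_add, add_mul, sub_mul, mul_sub, Matrix.smul_mul, Matrix.mul_smul, one_mul, mul_one,
    Matrix.vecMulVec_mul_vecMulVec, hy, hyX, hXy, h1, one_smul, zero_smul,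
    Matrix.vecMulVec_zero, Matrix.vecMulVec_smul]
  ext i j
  simp only [Matrix.add_apply, Matrix.sub_apply, Matrix.smul_apply, Matrix.vecMulVec_apply,
    smul_eq_mul, Matrix.zero_apply, w]
  field_simp
  ring

theorem metric_inv (hQ : J.Q ≠ 0) : J.metric⁻¹ = J.inv :=
  Matrix.inv_eq_right_inv (metric_mul_inv hQ)

theorem tr_eq (hQ : J.Q ≠ 0) : J.tr = J.dq * J.p₁ + J.q * J.p₂ + J.HT.trace
    - (J.w * J.dsQ + J.dXQ) / (2 * J.Q) := by
  have h1 : J.X ⬝ᵥ J.X = -2 * J.p₁ - J.q * J.p₁ ^ 2 - J.Q := by rw [Q]; ring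
  have hy := J.y_sq
  have hyX := J.y_X
  have hXy := X_y (J := J)
  have hζy := ζ_y (J := J)
  have hyζ : J.y ⬝ᵥ J.ζ = 0 := by rw [dotProduct_comm, hζy]
  have hXζ : J.X ⬝ᵥ J.ζ = J.X ⬝ᵥ J.Z
      - (J.dq * J.p₁ + 1 / 2 * J.q * J.dq * J.p₁ ^ 2) * (J.X ⬝ᵥ J.X) := by
    rw [ζ, dotProduct_sub, dotProduct_smul]; rfl
  have hZX : J.Z ⬝ᵥ J.X = J.X ⬝ᵥ J.Z := dotProduct_comm _ _
  have hyHT : ∀ a : Fin 3 → ℝ, Matrix.vecMulVec a J.y * J.HT = 0 := fun a => by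
    rw [Matrix.vecMulVec_mul, y_HT, Matrix.vecMulVec_zero]
  have hXHT : ∀ a : Fin 3 → ℝ, Matrix.vecMulVec a J.X * J.HT
      = Matrix.vecMulVec a (Matrix.vecMul J.X J.HT) := fun a => Matrix.vecMulVec_mul _ _ _
  rw [tr, inv, hess, Pr, T]
  simp only [mul_add, add_mul, sub_mul, mul_sub, Matrix.smul_mul, Matrix.mul_smul, one_mul, mul_one,
    Matrix.vecMulVec_mul_vecMulVec, hy, hyX, hXy, hyζ, hζy, one_smul, zero_smul,
    hyHT, hXHT, smul_zero, sub_zero,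
    Matrix.vecMulVec_zero, Matrix.vecMulVec_smul, Matrix.trace_add,
    Matrix.trace_sub, Matrix.trace_smul, Matrix.trace_vecMulVec, smul_eq_mul, Matrix.trace_zero]
  have h2 : J.y ⬝ᵥ Matrix.vecMul J.X J.HT = 0 := by
    rw [dotProduct_comm, ← Matrix.dotProduct_mulVec, HT_y, dotProduct_zero]
  have h3 : J.X ⬝ᵥ Matrix.vecMul J.X J.HT = J.X ⬝ᵥ J.HT.mulVec J.X := by
    rw [dotProduct_comm, Matrix.dotProduct_mulVec]
  simp only [h2, h3, hXζ, dXQ, dsQ, hZX, h1, k₀, w]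
  field_simp
  ring

/-- The change of coordinates from `(y, s)` to `𝐱 = y / s`. -/
noncomputable def M (J : ScriJet) : Matrix (Fin 3) (Fin 3) ℝ :=
  -(J.s ^ 2)⁻¹ • Matrix.vecMulVec J.y J.y + J.s⁻¹ • J.Pr

theorem M_symm : J.M.transpose = J.M := by
  simp [M, Pr, Matrix.transpose_add, Matrix.transpose_vecMulVec]

theorem M_y : J.M.mulVec J.y = -(J.s ^ 2)⁻¹ • J.y := by
  rw [M, Matrix.add_mulVec, Matrix.smul_mulVec, Matrix.smul_mulVec, Pr, Matrix.sub_mulVec,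
    Matrix.one_mulVec, Matrix.vecMulVec_mulVec, J.y_sq]
  simp

theorem M_tangential {v : Fin 3 → ℝ} (hv : J.y ⬝ᵥ v = 0) : J.M.mulVec v = J.s⁻¹ • v := by
  rw [M, Matrix.add_mulVec, Matrix.smul_mulVec, Matrix.smul_mulVec, Pr, Matrix.sub_mulVec,
    Matrix.one_mulVec, Matrix.vecMulVec_mulVec, hv]
  simp

theorem M_conj_vecMulVec (a b : Fin 3 → ℝ) :
    J.M * Matrix.vecMulVec a b * J.M = Matrix.vecMulVec (J.M.mulVec a) (J.M.mulVec b) := by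
  have h : Matrix.vecMul b J.M = J.M.mulVec b := by rw [← Matrix.mulVec_transpose, M_symm]
  rw [Matrix.mul_vecMulVec, Matrix.vecMulVec_mul, h]

theorem Pr_mul_Pr : J.Pr * J.Pr = J.Pr := by
  rw [Pr, mul_sub, sub_mul, sub_mul, Matrix.vecMulVec_mul_vecMulVec, J.y_sq]
  simp

theorem M_conj_Pr : J.M * J.Pr * J.M = (J.s ^ 2)⁻¹ • J.Pr := by
  have h1 : J.M * J.Pr = J.s⁻¹ • J.Pr := by
    rw [M, add_mul, Matrix.smul_mul, Matrix.smul_mul, Pr_mul_Pr, Pr, mul_sub,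
      Matrix.vecMulVec_mul_vecMulVec, J.y_sq]
    simp
  have h2 : J.Pr * J.M = J.s⁻¹ • J.Pr := by
    have := congrArg Matrix.transpose h1
    simpa [Matrix.transpose_mul, M_symm, Pr, Matrix.transpose_vecMulVec] using this
  rw [h1, Matrix.smul_mul, h2, smul_smul, sq, mul_inv]

theorem M_conj_HT : J.M * J.HT * J.M = (J.s ^ 2)⁻¹ • J.HT := by
  have hP : J.Pr * J.HT = J.HT := by
    rw [Pr, sub_mul, one_mul, Matrix.vecMulVec_mul, y_HT]; simp
  have h1 : J.M * J.HT = J.s⁻¹ • J.HT := by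
    rw [M, add_mul, Matrix.smul_mul, Matrix.smul_mul, hP, Matrix.vecMulVec_mul, y_HT]
    simp
  have h2 : J.HT * J.M = J.s⁻¹ • J.HT := by
    have := congrArg Matrix.transpose h1
    rwa [Matrix.transpose_mul, M_symm, HT_symm, Matrix.transpose_smul, HT_symm] at this
  rw [h1, Matrix.smul_mul, h2, smul_smul, sq, mul_inv]

theorem isUnit_M (hs : J.s ≠ 0) : IsUnit J.M := by
  have h : J.M * (-(J.s ^ 2) • Matrix.vecMulVec J.y J.y + J.s • J.Pr) = 1 := by
    have h1 : Matrix.vecMulVec J.y J.y * Matrix.vecMulVec J.y J.y = Matrix.vecMulVec J.y J.y := by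
      rw [Matrix.vecMulVec_mul_vecMulVec, J.y_sq, one_smul]
    have h2 : Matrix.vecMulVec J.y J.y * J.Pr = 0 := by rw [Pr, mul_sub, h1]; simp
    have h3 : J.Pr * Matrix.vecMulVec J.y J.y = 0 := by rw [Pr, sub_mul, h1]; simp
    rw [M, mul_add, add_mul, add_mul]
    simp only [Matrix.smul_mul, Matrix.mul_smul, h1, h2, h3, Pr_mul_Pr, smul_zero, add_zero,
      zero_add, smul_smul]
    have h4 : -(J.s ^ 2) * -(J.s ^ 2)⁻¹ = 1 := by field_simp
    rw [h4, mul_inv_cancel₀ hs, one_smul, one_smul, Pr]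
    abel
  exact IsUnit.of_mul_eq_one _ h

/-- The jet `J` determines the derivatives of `u = r_* - P` at the point `x = y / s`. -/
structure Matches (J : ScriJet) (m : ℝ) (u : E 3 → ℝ) (x : E 3) : Prop where
  m_eq : J.m = m
  s_eq : J.s = ‖x‖⁻¹
  y_eq : ∀ i, J.y i = unitDir x i
  first : ∀ i, pderiv i u x
    = ((lapse m ‖x‖)⁻¹ + J.s ^ 2 * J.p₁) * J.y i - J.s * J.X i
  second : ∀ i j, pderiv i (pderiv j u) x
    = -(2 * m * J.s ^ 2) / lapse m ‖x‖ ^ 2 * (J.y i * J.y j)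
      + J.s / lapse m ‖x‖ * ((if i = j then 1 else 0) - J.y i * J.y j)
      - J.s ^ 2 * J.H i j + J.s ^ 3 * (J.Z i * J.y j + J.y i * J.Z j)
      - J.s ^ 4 * J.p₂ * (J.y i * J.y j)
      + J.p₁ * J.s ^ 3 * ((if i = j then 1 else 0) - 3 * (J.y i * J.y j))

section Matches

variable {m : ℝ} {u : E 3 → ℝ} {x : E 3}

theorem Matches.s_pos (hJ : J.Matches m u x) (hx : x ≠ 0) : 0 < J.s := by
  rw [hJ.s_eq]; exact inv_pos.2 (norm_pos_iff.2 hx)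

theorem Matches.q_eq (hJ : J.Matches m u x) : J.q = J.s ^ 2 * lapse m ‖x‖ := by
  rw [q, hJ.m_eq, hJ.s_eq, lapse]; ring

theorem Matches.lapse_eq (hJ : J.Matches m u x) : lapse m ‖x‖ = 1 - 2 * m * J.s := by
  rw [hJ.s_eq, lapse]; ring

theorem Matches.radialDeriv_eq (hJ : J.Matches m u x) :
    radialDeriv u x = (lapse m ‖x‖)⁻¹ + J.s ^ 2 * J.p₁ := by
  have h1 : radialDeriv u x = ((lapse m ‖x‖)⁻¹ + J.s ^ 2 * J.p₁) * (J.y ⬝ᵥ J.y)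
      - J.s * (J.X ⬝ᵥ J.y) := by
    simp only [radialDeriv, dotProduct, Finset.mul_sum, ← Finset.sum_sub_distrib]
    refine Finset.sum_congr rfl fun k _ => ?_
    rw [hJ.first, ← hJ.y_eq]; ring
  rw [h1, J.y_sq, X_y]; ring

theorem Matches.normalFactor_eq (hJ : J.Matches m u x) (hx : x ≠ 0) (hh : 0 < lapse m ‖x‖) :
    normalFactor m u x = J.s ^ 2 * J.Q := by
  have h1 : ∑ i, pderiv i u x * pderiv i u x
      = ((lapse m ‖x‖)⁻¹ + J.s ^ 2 * J.p₁) ^ 2 * (J.y ⬝ᵥ J.y)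
      - 2 * J.s * ((lapse m ‖x‖)⁻¹ + J.s ^ 2 * J.p₁) * (J.y ⬝ᵥ J.X)
      + J.s ^ 2 * (J.X ⬝ᵥ J.X) := by
    simp only [dotProduct, Finset.mul_sum, ← Finset.sum_sub_distrib, ← Finset.sum_add_distrib]
    refine Finset.sum_congr rfl fun k _ => ?_
    rw [hJ.first]; ring
  rw [SchwarzschildCMC.normalFactor_eq m u hx hh.ne', h1, J.y_sq, J.y_X, hJ.radialDeriv_eq, Q,
    hJ.q_eq]
  have := hh.ne'
  field_simp
  ring

/-- In the coordinates `(y, s)` the metric `s² G` is `ScriJet.metric`. -/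
theorem Matches.metric_eq (hJ : J.Matches m u x) (hx : x ≠ 0) (hh : 0 < lapse m ‖x‖) :
    J.s ^ 2 • (J.M * inducedMetric m u x * J.M) = J.metric := by
  have hs := (hJ.s_pos hx).ne'
  have hl := hh.ne'
  have hq := hJ.q_eq
  -- the radial derivative of `u`, so that `∇u = c y - s X`
  set c := (lapse m ‖x‖)⁻¹ + J.s ^ 2 * J.p₁ with hc
  have hG : inducedMetric m u x = J.Pr + (lapse m ‖x‖)⁻¹ • Matrix.vecMulVec J.y J.y
      - lapse m ‖x‖ • Matrix.vecMulVec (c • J.y - J.s • J.X) (c • J.y - J.s • J.X) := by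
    ext i j
    simp only [inducedMetric_apply, spatialMetric, hJ.first, ← hJ.y_eq, Pr, Matrix.add_apply,
      Matrix.sub_apply, Matrix.smul_apply, Matrix.one_apply, Matrix.vecMulVec_apply, smul_eq_mul,
      Pi.sub_apply, Pi.smul_apply]
    ring
  rw [hG, mul_sub, mul_add, sub_mul, add_mul, Matrix.mul_smul, Matrix.mul_smul, Matrix.smul_mul,
    Matrix.smul_mul, M_conj_vecMulVec, M_conj_vecMulVec, M_conj_Pr, Matrix.mulVec_sub,
    Matrix.mulVec_smul, Matrix.mulVec_smul, M_y, M_tangential J.y_X]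
  ext i j
  simp only [metric, Matrix.add_apply,
      Matrix.sub_apply, Matrix.smul_apply, Matrix.vecMulVec_apply, smul_eq_mul,
      Pi.sub_apply, Pi.smul_apply, w, hq, hc]
  field_simp
  ring

/-- The second fundamental form under the conformal change of the metric from `g` to `s² g`. -/
theorem Matches.hess_eq (hJ : J.Matches m u x) (hx : x ≠ 0) (hh : 0 < lapse m ‖x‖)
    (hQ : 0 < J.Q) :
    J.s ^ 2 • (J.M * secondFF m u x * J.M) = (Real.sqrt J.Q)⁻¹ • (J.w • J.metric - J.s • J.hess) := by
  have hs := (hJ.s_pos hx).ne'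
  have hl := hh.ne'
  have hq := hJ.q_eq
  have hW : Real.sqrt (normalFactor m u x) = J.s * Real.sqrt J.Q := by
    rw [hJ.normalFactor_eq hx hh, Real.sqrt_mul (by positivity), Real.sqrt_sq (hJ.s_pos hx).le]
  have hW0 : Real.sqrt J.Q ≠ 0 := (Real.sqrt_pos.2 hQ).ne'
  set c := (lapse m ‖x‖)⁻¹ + J.s ^ 2 * J.p₁ with hc
  have hr : ‖x‖ = J.s⁻¹ := by rw [hJ.s_eq, inv_inv]
  have hA : secondFF m u x = (J.s * Real.sqrt J.Q)⁻¹ • (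
      (-(2 * m * J.s ^ 2) / lapse m ‖x‖ ^ 2 - J.s ^ 4 * J.p₂ - 2 * J.p₁ * J.s ^ 3
          + c * (m * J.s ^ 2 / lapse m ‖x‖)) • Matrix.vecMulVec J.y J.y
      + (J.s / lapse m ‖x‖ + J.p₁ * J.s ^ 3 - c * (2 * m * J.s ^ 2)) • J.Pr
      - J.s ^ 2 • (J.HT - Matrix.vecMulVec J.y J.X - Matrix.vecMulVec J.X J.y)
      + J.s ^ 3 • (Matrix.vecMulVec J.Z J.y + Matrix.vecMulVec J.y J.Z)
      + (m * J.s ^ 2 / lapse m ‖x‖) • (Matrix.vecMulVec J.y (c • J.y - J.s • J.X)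
        + Matrix.vecMulVec (c • J.y - J.s • J.X) J.y)
      - (c * (m * J.s ^ 2 * lapse m ‖x‖))
        • Matrix.vecMulVec (c • J.y - J.s • J.X) (c • J.y - J.s • J.X)) := by
    ext i j
    rw [secondFF_eq m u hx hl, hW, hJ.radialDeriv_eq, ← hc]
    have h1 : 1 - lapse m ‖x‖ = 2 * m * J.s := by rw [hJ.lapse_eq]; ring
    simp only [timeHess, radialHess, h1, hJ.first, hJ.second, ← hJ.y_eq, Pr, HT, Matrix.add_apply,
      Matrix.sub_apply, Matrix.smul_apply, Matrix.one_apply, Matrix.vecMulVec_apply, smul_eq_mul,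
      Pi.sub_apply, Pi.smul_apply]
    rw [← hc]
    have h2 : m / ‖x‖ ^ 2 = m * J.s ^ 2 := by rw [hr]; field_simp
    have h3 : 2 * m * J.s / ‖x‖ = 2 * m * J.s ^ 2 := by rw [hr]; field_simp
    rw [h2, h3]
    ring
  have hm : lapse m ‖x‖ = 1 - 2 * m * J.s := hJ.lapse_eq
  have hm' : m = (1 - lapse m ‖x‖) / (2 * J.s) := by rw [hm]; field_simp; ring
  have hdq : J.dq = 3 * J.s * lapse m ‖x‖ - J.s := by rw [dq, hm, hJ.m_eq]; ring
  rw [hA, Matrix.mul_smul, Matrix.smul_mul]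
  simp only [mul_sub, mul_add, sub_mul, add_mul, Matrix.mul_smul, Matrix.smul_mul,
    M_conj_vecMulVec, M_conj_Pr, M_conj_HT, Matrix.mulVec_sub,
    Matrix.mulVec_smul, M_y, M_tangential J.y_X, M_tangential J.y_Z]
  ext i j
  simp only [metric, hess, k₀, ζ, T, hdq, Matrix.add_apply,
      Matrix.sub_apply, Matrix.smul_apply, Matrix.vecMulVec_apply, smul_eq_mul,
      Pi.sub_apply, Pi.smul_apply, w, hq, hc]
  generalize lapse m ‖x‖ = h at *
  generalize Real.sqrt J.Q = W at *
  subst hm'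
  field_simp
  ring

theorem conj_inv_mul {g M A : Matrix (Fin 3) (Fin 3) ℝ} {c : ℝ} (hc : c ≠ 0) (hM : IsUnit M) :
    (c • (M * g * M))⁻¹ * (c • (M * A * M)) = M⁻¹ * (g⁻¹ * A) * M := by
  have hM' : IsUnit M.det := (Matrix.isUnit_iff_isUnit_det M).1 hM
  have h1 : (c • (M * g * M))⁻¹ = c⁻¹ • (M⁻¹ * (g⁻¹ * M⁻¹)) := by
    by_cases hg : IsUnit g.det
    · have hd : IsUnit (M * g * M).det := by
        rw [Matrix.det_mul, Matrix.det_mul]; exact (hM'.mul hg).mul hM'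
      have h2 := Matrix.inv_smul' (A := M * g * M) (Units.mk0 c hc) hd
      have h3 : (Units.mk0 c hc) • (M * g * M) = c • (M * g * M) := rfl
      rw [h3] at h2
      rw [h2, Matrix.mul_inv_rev, Matrix.mul_inv_rev]
      rfl
    · have hd : ¬ IsUnit (c • (M * g * M)).det := by
        rw [Matrix.det_smul, Matrix.det_mul, Matrix.det_mul]
        intro h
        exact hg (isUnit_iff_ne_zero.2 fun h0 => by rw [h0] at h; simp at h)
      rw [Matrix.nonsing_inv_apply_not_isUnit _ hd, Matrix.nonsing_inv_apply_not_isUnit _ hg]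
      simp
  rw [h1, Matrix.smul_mul, Matrix.mul_smul, smul_smul, inv_mul_cancel₀ hc, one_smul]
  simp only [mul_assoc]
  rw [← mul_assoc M⁻¹ M, Matrix.nonsing_inv_mul _ hM', one_mul]

variable (J) in
/-- The traceless part of `ScriJet.hess`. -/
noncomputable def traceless : Matrix (Fin 3) (Fin 3) ℝ := J.hess - (J.tr / 3) • J.metric

theorem Matches.Q_pos (hJ : J.Matches m u x) (hx : x ≠ 0) (hh : 0 < lapse m ‖x‖)
    (hG : (inducedMetric m u x).PosDef) : 0 < J.Q := by
  have h := normalFactor_pos hx hh hG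
  rw [hJ.normalFactor_eq hx hh] at h
  exact (mul_pos_iff_of_pos_left (pow_pos (hJ.s_pos hx) 2)).1 h

theorem Matches.inv_mul_conj (hJ : J.Matches m u x) (hx : x ≠ 0) (hh : 0 < lapse m ‖x‖)
    (hQ : 0 < J.Q) (A : Matrix (Fin 3) (Fin 3) ℝ) :
    J.inv * (J.s ^ 2 • (J.M * A * J.M)) = J.M⁻¹ * ((inducedMetric m u x)⁻¹ * A) * J.M := by
  rw [← metric_inv hQ.ne', ← hJ.metric_eq hx hh]
  exact conj_inv_mul (pow_ne_zero 2 (hJ.s_pos hx).ne') (isUnit_M (hJ.s_pos hx).ne')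

theorem trace_conj {M A : Matrix (Fin 3) (Fin 3) ℝ} (hM : IsUnit M) :
    (M⁻¹ * A * M).trace = A.trace := by
  rw [Matrix.trace_mul_comm, ← mul_assoc,
    Matrix.mul_nonsing_inv _ ((Matrix.isUnit_iff_isUnit_det M).1 hM), one_mul]

theorem inv_mul_metric (hQ : J.Q ≠ 0) : J.inv * J.metric = 1 :=
  mul_eq_one_comm.1 (metric_mul_inv hQ)

theorem Matches.meanCurvature_eq (hJ : J.Matches m u x) {U : Set (E 3)} (hU : SpacelikeOver m u U)
    (hx : x ∈ U) : 3 * meanCurvature m u x * Real.sqrt J.Q = 3 * J.w - J.s * J.tr := by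
  have h0 := hU.ne_zero x hx
  have hh := hU.lapse_pos x hx
  have hQ := hJ.Q_pos h0 hh (hU.posDef x hx)
  have hW0 : Real.sqrt J.Q ≠ 0 := (Real.sqrt_pos.2 hQ).ne'
  rw [meanCurvature_eq_trace hU hx, ← trace_conj (isUnit_M (hJ.s_pos h0).ne'),
    ← hJ.inv_mul_conj h0 hh hQ, hJ.hess_eq h0 hh hQ, Matrix.mul_smul, mul_sub, Matrix.mul_smul,
    Matrix.mul_smul, inv_mul_metric hQ.ne']
  simp only [Matrix.trace_smul, Matrix.trace_sub, Matrix.trace_one, smul_eq_mul, Fintype.card_fin]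
  rw [← tr]
  push_cast
  field_simp

/-- `|Å|² = s² / Q |K°|²`, where `K°` is the traceless part of `ScriJet.hess`. -/
theorem Matches.trace_traceless_sq (hJ : J.Matches m u x) {U : Set (E 3)}
    (hU : SpacelikeOver m u U) (hx : x ∈ U) :
    ((inducedMetric m u x)⁻¹ * tracelessFF m u x
      * ((inducedMetric m u x)⁻¹ * tracelessFF m u x)).trace
      = J.s ^ 2 / J.Q * (J.inv * J.traceless * (J.inv * J.traceless)).trace := by
  have h0 := hU.ne_zero x hx
  have hh := hU.lapse_pos x hx
  have hQ := hJ.Q_pos h0 hh (hU.posDef x hx)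
  have hW0 : Real.sqrt J.Q ≠ 0 := (Real.sqrt_pos.2 hQ).ne'
  have hM := isUnit_M (hJ.s_pos h0).ne'
  have hM' : IsUnit J.M.det := (Matrix.isUnit_iff_isUnit_det J.M).1 hM
  have hH := hJ.meanCurvature_eq hU hx
  have h1 : J.s ^ 2 • (J.M * tracelessFF m u x * J.M) = (-(J.s / Real.sqrt J.Q)) • J.traceless := by
    have h2 : meanCurvature m u x = (J.w - J.s * (J.tr / 3)) / Real.sqrt J.Q := by
      field_simp; linarith
    rw [tracelessFF, mul_sub, sub_mul, smul_sub, hJ.hess_eq h0 hh hQ, Matrix.mul_smul,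
      Matrix.smul_mul, smul_comm, hJ.metric_eq h0 hh, traceless, h2]
    ext i j
    simp only [Matrix.sub_apply, Matrix.smul_apply, smul_eq_mul]
    field_simp
    ring
  set B := (inducedMetric m u x)⁻¹ * tracelessFF m u x
  have h3 : J.M⁻¹ * (B * B) * J.M = (J.M⁻¹ * B * J.M) * (J.M⁻¹ * B * J.M) := by
    have : J.M * (J.M⁻¹ * (B * J.M)) = B * J.M := by
      rw [← mul_assoc, Matrix.mul_nonsing_inv _ hM', one_mul]
    simp only [mul_assoc]
    rw [this]
  rw [← trace_conj hM, h3, ← hJ.inv_mul_conj h0 hh hQ, h1, Matrix.mul_smul, Matrix.smul_mul,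
    Matrix.mul_smul, smul_smul, Matrix.trace_smul, smul_eq_mul]
  congr 1
  have := Real.sq_sqrt hQ.le
  rw [neg_mul_neg, div_mul_div_comm, ← sq, ← sq, this]

theorem Matches.metric_posDef (hJ : J.Matches m u x) (hx : x ≠ 0) (hh : 0 < lapse m ‖x‖)
    (hG : (inducedMetric m u x).PosDef) : J.metric.PosDef := by
  rw [← hJ.metric_eq hx hh]
  refine Matrix.PosDef.smul ?_ (pow_pos (hJ.s_pos hx) 2)
  have h := hG.conjTranspose_mul_mul_same (B := J.M)
    (Matrix.mulVec_injective_of_isUnit (isUnit_M (hJ.s_pos hx).ne'))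
  rwa [Matrix.conjTranspose_eq_transpose_of_trivial, M_symm] at h

end Matches

end ScriJet

open scoped MatrixOrder in
theorem exists_eq_transpose_mul_self {g : Matrix (Fin 3) (Fin 3) ℝ} (hg : g.PosSemidef) :
    ∃ C : Matrix (Fin 3) (Fin 3) ℝ, g = C.transpose * C := by
  obtain ⟨C, hC⟩ := CStarAlgebra.nonneg_iff_eq_star_mul_self.mp hg.nonneg
  rw [Matrix.star_eq_conjTranspose, Matrix.conjTranspose_eq_transpose_of_trivial] at hC
  exact ⟨C, hC⟩

/-- For a positive definite metric `g`, the entries of a symmetric form are bounded by its norm. -/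
theorem abs_apply_le_of_posDef {g K : Matrix (Fin 3) (Fin 3) ℝ} (hg : g.PosDef)
    (hK : K.transpose = K) :
    0 ≤ (g⁻¹ * K * (g⁻¹ * K)).trace ∧
      ∀ i j, |K i j| ≤ 9 * g.trace * Real.sqrt (g⁻¹ * K * (g⁻¹ * K)).trace := by
  obtain ⟨C, hC⟩ := exists_eq_transpose_mul_self hg.posSemidef
  have hdet : IsUnit C.det := by
    have h1 : g.det = C.det * C.det := by rw [hC, Matrix.det_mul, Matrix.det_transpose]
    have h2 := hg.det_pos
    exact isUnit_iff_ne_zero.2 fun h => by rw [h1, h] at h2; simp at h2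
  have hdetT : IsUnit C.transpose.det := by rwa [Matrix.det_transpose]
  -- with `g = Cᵀ C`, the form `R` is `K` in an orthonormal basis
  set R := C.transpose⁻¹ * K * C⁻¹ with hR
  have hRs : R.transpose = R := by
    rw [hR, Matrix.transpose_mul, Matrix.transpose_mul, hK, Matrix.transpose_nonsing_inv,
      Matrix.transpose_nonsing_inv, Matrix.transpose_transpose, mul_assoc]
  have hKR : K = C.transpose * R * C := by
    rw [hR]
    calc K = 1 * K * 1 := by simp
      _ = (C.transpose * C.transpose⁻¹) * K * (C⁻¹ * C) := by
        rw [Matrix.mul_nonsing_inv _ hdetT, Matrix.nonsing_inv_mul _ hdet]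
      _ = _ := by simp only [mul_assoc]
  have hgi : g⁻¹ = C⁻¹ * C.transpose⁻¹ := by rw [hC, Matrix.mul_inv_rev]
  have htr : (g⁻¹ * K * (g⁻¹ * K)).trace = ∑ a, ∑ b, R a b ^ 2 := by
    have h1 : g⁻¹ * K = C⁻¹ * R * C := by
      rw [hgi, hR]
      calc C⁻¹ * C.transpose⁻¹ * K = C⁻¹ * C.transpose⁻¹ * K * (C⁻¹ * C) := by
            rw [Matrix.nonsing_inv_mul _ hdet, mul_one]
        _ = _ := by simp only [mul_assoc]
    have h2 : C⁻¹ * R * C * (C⁻¹ * R * C) = C⁻¹ * (R * R) * C := by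
      calc C⁻¹ * R * C * (C⁻¹ * R * C) = C⁻¹ * R * (C * C⁻¹) * (R * C) := by
            simp only [mul_assoc]
        _ = _ := by rw [Matrix.mul_nonsing_inv _ hdet, mul_one]; simp only [mul_assoc]
    rw [h1, h2, ScriJet.trace_conj ((Matrix.isUnit_iff_isUnit_det C).2 hdet)]
    simp only [Matrix.trace, Matrix.diag, Matrix.mul_apply]
    refine Finset.sum_congr rfl fun a _ => Finset.sum_congr rfl fun b _ => ?_
    have : R b a = R a b := congrFun (congrFun hRs a) b
    rw [this, sq]
  have hgtr : g.trace = ∑ i, ∑ a, C a i ^ 2 := by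
    rw [hC]
    simp only [Matrix.trace, Matrix.diag, Matrix.mul_apply, Matrix.transpose_apply, sq]
  rw [htr]
  refine ⟨Finset.sum_nonneg fun a _ => Finset.sum_nonneg fun b _ => sq_nonneg _, fun i j => ?_⟩
  have hRb : ∀ a b, |R a b| ≤ Real.sqrt (∑ a, ∑ b, R a b ^ 2) := by
    intro a b
    refine Real.abs_le_sqrt ?_
    refine (Finset.single_le_sum (f := fun b => R a b ^ 2) (fun _ _ => sq_nonneg _)
      (Finset.mem_univ b)).trans ?_
    exact Finset.single_le_sum (f := fun a => ∑ b, R a b ^ 2)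
      (fun _ _ => Finset.sum_nonneg fun _ _ => sq_nonneg _) (Finset.mem_univ a)
  have hCb : ∀ a i, C a i ^ 2 ≤ g.trace := by
    intro a i
    rw [hgtr]
    refine (Finset.single_le_sum (f := fun a => C a i ^ 2) (fun _ _ => sq_nonneg _)
      (Finset.mem_univ a)).trans ?_
    exact Finset.single_le_sum (f := fun i => ∑ a, C a i ^ 2)
      (fun _ _ => Finset.sum_nonneg fun _ _ => sq_nonneg _) (Finset.mem_univ i)
  have hKij : K i j = ∑ b, ∑ a, C a i * R a b * C b j := by
    conv_lhs => rw [hKR]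
    simp only [Matrix.mul_apply, Matrix.transpose_apply, Finset.sum_mul]
  set ρ := Real.sqrt (∑ a, ∑ b, R a b ^ 2)
  have hρ : 0 ≤ ρ := Real.sqrt_nonneg _
  have hterm : ∀ a b, |C a i * R a b * C b j| ≤ g.trace * ρ := by
    intro a b
    have h1 : |C a i| * |C b j| ≤ g.trace := by
      nlinarith [hCb a i, hCb b j, sq_nonneg (|C a i| - |C b j|), sq_abs (C a i), sq_abs (C b j)]
    rw [abs_mul, abs_mul]
    calc |C a i| * |R a b| * |C b j| = |C a i| * |C b j| * |R a b| := by ring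
      _ ≤ g.trace * ρ := mul_le_mul h1 (hRb a b) (abs_nonneg _)
          ((sq_nonneg _).trans (hCb a i))
  rw [hKij]
  calc |∑ b, ∑ a, C a i * R a b * C b j| ≤ ∑ b, ∑ a, |C a i * R a b * C b j| :=
        (Finset.abs_sum_le_sum_abs _ _).trans
          (Finset.sum_le_sum fun b _ => Finset.abs_sum_le_sum_abs _ _)
    _ ≤ ∑ _b : Fin 3, ∑ _a : Fin 3, g.trace * ρ :=
        Finset.sum_le_sum fun b _ => Finset.sum_le_sum fun a _ => hterm a b
    _ = 9 * g.trace * ρ := by simp; ring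

/-! ### The jet of `P` along the graph -/

/-- A spacelike graph `t = u(𝐱)` over `r > 1 / s₀` such that `P = r_* - u` is smooth up to future
null infinity. -/
structure ScriGraph (m s₀ : ℝ) (u : E 3 → ℝ) (P : S2 × ℝ → ℝ) : Prop where
  m_nonneg : 0 ≤ m
  s₀_pos : 0 < s₀
  two_m_s₀ : 2 * m * s₀ ≤ 1
  eq_sub : ∀ y : S2, ∀ s ∈ Ioo 0 s₀, P (y, s) = tortoise m s⁻¹ - u (s⁻¹ • (y : E 3))
  smooth : SmoothUpToScri s₀ P
  spacelike : ∀ x : E 3, s₀⁻¹ < ‖x‖ → (inducedMetric m u x).PosDef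

theorem hasDerivAt_tortoise {m r : ℝ} (hm : 0 ≤ m) (hr : 0 < r) (hh : 0 < lapse m r) :
    HasDerivAt (tortoise m) (lapse m r)⁻¹ r := by
  rcases hm.eq_or_lt with rfl | hm
  · have h1 : tortoise 0 = fun r => r := by funext r; simp [tortoise]
    have h2 : (lapse 0 r)⁻¹ = 1 := by simp [lapse]
    rw [h1, h2]
    exact hasDerivAt_id' r
  · have h2 : r / (2 * m) - 1 ≠ 0 := by
      intro h
      have : r = 2 * m := by field_simp at h; linarith
      rw [lapse, this, div_self (by positivity)] at hh
      simp at hh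
    have h1 : tortoise m = fun r => r + 2 * m * Real.log (r / (2 * m) - 1) := by
      funext r; simp [tortoise]
    rw [h1]
    refine ((hasDerivAt_id r).add ((((hasDerivAt_id r).div_const (2 * m)).sub_const 1).log
      h2 |>.const_mul (2 * m))).congr_deriv ?_
    have hh' := hh.ne'
    simp only [lapse, id] at *
    have h3 : r - 2 * m ≠ 0 := by
      intro h; apply h2; field_simp; linarith
    have h4 : 1 - 2 * m / r ≠ 0 := hh'
    have h5 : 1 - 2 * m / r = (r - 2 * m) / r := by field_simp
    rw [h5]
    have h6 : r / (2 * m) - 1 = (r - 2 * m) / (2 * m) := by field_simp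
    rw [h6]
    field_simp
    ring

namespace ScriGraph

variable {m s₀ : ℝ} {u : E 3 → ℝ} {P : S2 × ℝ → ℝ}

theorem norm_pos (h : ScriGraph m s₀ u P) {x : E 3} (hx : s₀⁻¹ < ‖x‖) : 0 < ‖x‖ :=
  (inv_pos.2 h.s₀_pos).trans hx

theorem ne_zero (h : ScriGraph m s₀ u P) {x : E 3} (hx : s₀⁻¹ < ‖x‖) : x ≠ 0 :=
  norm_pos_iff.1 (h.norm_pos hx)

theorem inv_norm_lt (h : ScriGraph m s₀ u P) {x : E 3} (hx : s₀⁻¹ < ‖x‖) : ‖x‖⁻¹ < s₀ :=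
  (inv_lt_comm₀ h.s₀_pos (h.norm_pos hx)).1 hx

theorem lapse_pos (h : ScriGraph m s₀ u P) {x : E 3} (hx : s₀⁻¹ < ‖x‖) : 0 < lapse m ‖x‖ := by
  have h1 := h.inv_norm_lt hx
  have h2 := inv_pos.2 (h.norm_pos hx)
  rw [lapse, div_eq_mul_inv]
  rcases h.m_nonneg.eq_or_lt with h0 | h0
  · simp [← h0]
  · have : 2 * m * ‖x‖⁻¹ < 2 * m * s₀ := mul_lt_mul_of_pos_left h1 (by linarith)
    linarith [h.two_m_s₀]

theorem eq_tortoise_sub (h : ScriGraph m s₀ u P) {x : E 3} (hx : s₀⁻¹ < ‖x‖) :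
    u x = tortoise m ‖x‖ - rayExt P (x, ‖x‖⁻¹) := by
  have h0 := h.ne_zero hx
  have hr := h.norm_pos hx
  have hy : ‖x‖⁻¹ • x ∈ sphere (0 : E 3) 1 := by
    rw [mem_sphere_zero_iff_norm, norm_smul, norm_inv, norm_norm, inv_mul_cancel₀ hr.ne']
  have h1 := h.eq_sub ⟨_, hy⟩ ‖x‖⁻¹ ⟨inv_pos.2 hr, h.inv_norm_lt hx⟩
  rw [inv_inv] at h1
  simp only [smul_smul, mul_inv_cancel₀ hr.ne', one_smul] at h1
  rw [rayExt, radialExtension, dif_neg h0]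
  simp only
  linarith

theorem isOpen_exterior : IsOpen {x : E 3 | s₀⁻¹ < ‖x‖} := isOpen_lt continuous_const continuous_norm

theorem hasPD (h : ScriGraph m s₀ u P) {x : E 3} (hx : s₀⁻¹ < ‖x‖) :
    HasPD u (fun i => (lapse m ‖x‖)⁻¹ * unitDir x i - (dX s₀ i (rayExt P) (x, ‖x‖⁻¹)
      - unitDir x i / ‖x‖ ^ 2 * dS s₀ (rayExt P) (x, ‖x‖⁻¹))) x := by
  have h0 := h.ne_zero hx
  refine (((HasPD.norm h0).comp (hasDerivAt_tortoise h.m_nonneg (h.norm_pos hx)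
    (h.lapse_pos hx))).sub (hasPD_comp_inv_norm (contDiffOn_rayExt h.smooth) h0
    (h.inv_norm_lt hx))).congr_of_eventuallyEq ?_
  filter_upwards [isOpen_exterior.mem_nhds hx] with z hz using h.eq_tortoise_sub hz

theorem pderiv_pderiv (h : ScriGraph m s₀ u P) {x : E 3} (hx : s₀⁻¹ < ‖x‖) (i j : Fin 3) :
    pderiv i (pderiv j u) x = -(2 * m / ‖x‖ ^ 2) / lapse m ‖x‖ ^ 2 * (unitDir x i * unitDir x j)
      + (lapse m ‖x‖)⁻¹ / ‖x‖ * ((if i = j then 1 else 0) - unitDir x i * unitDir x j)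
      - dX s₀ i (dX s₀ j (rayExt P)) (x, ‖x‖⁻¹)
      + (unitDir x i * dX s₀ j (dS s₀ (rayExt P)) (x, ‖x‖⁻¹)
        + unitDir x j * dX s₀ i (dS s₀ (rayExt P)) (x, ‖x‖⁻¹)) / ‖x‖ ^ 2
      - unitDir x i * unitDir x j / ‖x‖ ^ 4 * dS s₀ (dS s₀ (rayExt P)) (x, ‖x‖⁻¹)
      + ((if i = j then 1 else 0) - 3 * (unitDir x i * unitDir x j)) / ‖x‖ ^ 3
        * dS s₀ (rayExt P) (x, ‖x‖⁻¹) := by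
  have h0 := h.ne_zero hx
  have hr := (h.norm_pos hx).ne'
  have hf := contDiffOn_rayExt h.smooth
  have hs := h.inv_norm_lt hx
  have hz : (x, ‖x‖⁻¹) ∈ scriDomain s₀ := ⟨h0, (inv_pos.2 (h.norm_pos hx)).le, hs⟩
  have h1 := (((hasPD_lapse_inv m h0 (h.lapse_pos hx).ne').mul (hasPD_unitDir h0 j)).sub
    ((hasPD_comp_inv_norm (contDiffOn_dX hf j) h0 hs).sub
      (((hasPD_unitDir h0 j).mul ((HasPD.norm h0).comp (hasDerivAt_zpow (-2) ‖x‖ (Or.inl hr)))).mul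
        (hasPD_comp_inv_norm (contDiffOn_dS hf) h0 hs))))
  have h2 : pderiv j u =ᶠ[nhds x] fun z => (lapse m ‖z‖)⁻¹ * unitDir z j -
      (dX s₀ j (rayExt P) (z, ‖z‖⁻¹) - unitDir z j * ‖z‖ ^ (-2 : ℤ) * dS s₀ (rayExt P) (z, ‖z‖⁻¹)) := by
    filter_upwards [isOpen_exterior.mem_nhds hx] with z hz
    rw [(h.hasPD hz).eq j, zpow_neg]
    norm_cast
  rw [pderiv_congr h2, h1.eq i, ← dX_dS_comm hf hz]
  have hk : x i / ‖x‖ = unitDir x i := rfl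
  have h3 : ‖x‖ ^ (-2 : ℤ) = (‖x‖ ^ 2)⁻¹ := by rw [zpow_neg]; norm_cast
  have h4 : ‖x‖ ^ (-2 - 1 : ℤ) = (‖x‖ ^ 3)⁻¹ := by
    rw [show (-2 - 1 : ℤ) = -3 by norm_num, zpow_neg]; norm_cast
  simp only [hk, h3, h4]
  push_cast
  field_simp
  ring

theorem spacelikeOver (h : ScriGraph m s₀ u P) : SpacelikeOver m u {x | s₀⁻¹ < ‖x‖} where
  isOpen := isOpen_exterior
  ne_zero x hx := h.ne_zero hx
  lapse_pos x hx := h.lapse_pos hx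
  posDef x hx := h.spacelike x hx
  smooth := by
    have hf := contDiffOn_rayExt h.smooth
    have h1 : ContDiffOn ℝ ∞ (fun x : E 3 => ((x, ‖x‖⁻¹) : E 3 × ℝ)) {x | s₀⁻¹ < ‖x‖} :=
      contDiffOn_id.prodMk ((contDiffOn_id.norm ℝ fun x hx => h.ne_zero hx).inv
        fun x hx => (h.norm_pos hx).ne')
    have h2 := hf.comp h1 fun x hx => ⟨h.ne_zero hx, (inv_pos.2 (h.norm_pos hx)).le,
      h.inv_norm_lt hx⟩
    have h3 : ContDiffOn ℝ ∞ (fun x : E 3 => tortoise m ‖x‖) {x | s₀⁻¹ < ‖x‖} := by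
      rcases h.m_nonneg.eq_or_lt with h0 | h0
      · have : ∀ r, tortoise m r = r := fun r => by simp [tortoise, ← h0]
        simp only [this]
        exact contDiffOn_id.norm ℝ fun x hx => h.ne_zero hx
      · have : ∀ r, tortoise m r = r + 2 * m * Real.log (r / (2 * m) - 1) :=
          fun r => by simp [tortoise]
        simp only [this]
        have hn : ContDiffOn ℝ ∞ (fun x : E 3 => ‖x‖) {x | s₀⁻¹ < ‖x‖} :=
          contDiffOn_id.norm ℝ fun x hx => h.ne_zero hx
        refine hn.add (contDiffOn_const.mul (((hn.div_const _).sub contDiffOn_const).log ?_))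
        intro x hx h5
        have h6 := h.lapse_pos hx
        have : ‖x‖ = 2 * m := by field_simp at h5; linarith
        rw [lapse, this, div_self (by positivity)] at h6
        simp at h6
    exact (h3.sub h2).congr fun x hx => h.eq_tortoise_sub hx

end ScriGraph

/-- The jet of the zero function, the value of `jetAt` where no jet is available. -/
def ScriJet.default : ScriJet where
  m := 0
  s := 0
  p₁ := 0
  p₂ := 0
  y := Pi.single 0 1
  X := 0
  Z := 0
  H := 0
  y_sq := by simp
  y_X := by simp
  y_Z := by simp
  H_y := by rw [Matrix.zero_mulVec]; simp
  H_symm := by simp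

open Classical in
/-- The jet of a function that is constant along rays, at a point `(y, s)` with `|y| = 1`. Elsewhere,
and for other functions, the value is `ScriJet.default`. -/
noncomputable def jetAt (m s₀ : ℝ) (f : E 3 × ℝ → ℝ) (z : E 3 × ℝ) : ScriJet :=
  if h : (ContDiffOn ℝ ∞ f (scriDomain s₀) ∧ ∀ s ∈ Ico 0 s₀, IsHomog 0 (fun x => f (x, s)))
      ∧ z ∈ scriDomain s₀ ∧ z.1 ∈ sphere (0 : E 3) 1 then
    { m := m
      s := z.2
      p₁ := dS s₀ f z
      p₂ := dS s₀ (dS s₀ f) z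
      y := fun i => z.1 i
      X := fun i => dX s₀ i f z
      Z := fun i => dX s₀ i (dS s₀ f) z
      H := Matrix.of fun i j => dX s₀ i (dX s₀ j f) z
      y_sq := by
        simp only [dotProduct]
        rw [sum_sq_eq_norm_sq, mem_sphere_zero_iff_norm.1 h.2.2]; norm_num
      y_X := by simpa [dotProduct] using sum_mul_dX h.1.1 h.1.2 h.2.1
      y_Z := by
        simpa [dotProduct] using sum_mul_dX (contDiffOn_dS h.1.1) (isHomog_dS h.1.1 h.1.2) h.2.1
      H_y := by
        funext i
        have h1 := sum_mul_dX (contDiffOn_dX h.1.1 i) (isHomog_dX h.1.1 h.1.2 i) h.2.1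
        simp only [Matrix.mulVec, dotProduct, Matrix.of_apply, Pi.neg_apply]
        have h2 : ((0 - 1 : ℤ) : ℝ) * dX s₀ i f z = -dX s₀ i f z := by norm_num
        rw [← h2, ← h1]
        exact Finset.sum_congr rfl fun j _ => by rw [dX_comm h.1.1 h.2.1, mul_comm]
      H_symm := by
        ext i j
        exact dX_comm h.1.1 h.2.1 j i }
  else ScriJet.default

section jetAt

variable {m s₀ : ℝ} {f : E 3 × ℝ → ℝ} {z : E 3 × ℝ}

theorem jetAt_spec (hf : ContDiffOn ℝ ∞ f (scriDomain s₀))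
    (hk : ∀ s ∈ Ico 0 s₀, IsHomog 0 (fun x => f (x, s))) (hz : z ∈ scriDomain s₀)
    (hy : z.1 ∈ sphere (0 : E 3) 1) :
    (jetAt m s₀ f z).m = m ∧ (jetAt m s₀ f z).s = z.2 ∧ (jetAt m s₀ f z).p₁ = dS s₀ f z ∧
    (jetAt m s₀ f z).p₂ = dS s₀ (dS s₀ f) z ∧ ((jetAt m s₀ f z).y = fun i => z.1 i) ∧
    ((jetAt m s₀ f z).X = fun i => dX s₀ i f z) ∧
    ((jetAt m s₀ f z).Z = fun i => dX s₀ i (dS s₀ f) z) ∧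
    (jetAt m s₀ f z).H = Matrix.of fun i j => dX s₀ i (dX s₀ j f) z := by
  rw [jetAt, dif_pos ⟨⟨hf, hk⟩, hz, hy⟩]
  simp

theorem ScriGraph.matches {u : E 3 → ℝ} {P : S2 × ℝ → ℝ} (h : ScriGraph m s₀ u P)
    (hz : z ∈ scriDomain s₀) (hy : z.1 ∈ sphere (0 : E 3) 1) (hs : 0 < z.2) :
    (jetAt m s₀ (rayExt P) z).Matches m u (z.2⁻¹ • z.1) := by
  obtain ⟨y, s⟩ := z
  have hf := contDiffOn_rayExt h.smooth
  have hk : ∀ s ∈ Ico 0 s₀, IsHomog 0 (fun x => rayExt P (x, s)) := fun s _ => isHomog_rayExt P s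
  obtain ⟨e1, e2, e3, e4, e5, e6, e7, e8⟩ := jetAt_spec (m := m) hf hk hz hy
  simp only at hs hy e2 e5 ⊢
  have hs₀ : s < s₀ := hz.2.2
  have hI : s ∈ Ico 0 s₀ := ⟨hs.le, hs₀⟩
  have hn : ‖s⁻¹ • y‖ = s⁻¹ := by
    rw [norm_smul, mem_sphere_zero_iff_norm.1 hy, mul_one, norm_inv, Real.norm_eq_abs, abs_of_pos hs]
  have hx : s₀⁻¹ < ‖s⁻¹ • y‖ := by rw [hn]; exact (inv_lt_inv₀ h.s₀_pos hs).2 hs₀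
  have hu : ∀ i, unitDir (s⁻¹ • y) i = y i := by
    intro i; rw [unitDir, hn]; simp; field_simp
  have y0 := sphere_ne_zero hy
  have hs' : 0 < s⁻¹ := inv_pos.2 hs
  have d1 : dS s₀ (rayExt P) (s⁻¹ • y, s) = dS s₀ (rayExt P) (y, s) := by
    simpa using isHomog_dS hf hk s hI s⁻¹ hs' y y0
  have d2 : dS s₀ (dS s₀ (rayExt P)) (s⁻¹ • y, s) = dS s₀ (dS s₀ (rayExt P)) (y, s) := by
    simpa using isHomog_dS (contDiffOn_dS hf) (isHomog_dS hf hk) s hI s⁻¹ hs' y y0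
  have d3 : ∀ i, dX s₀ i (rayExt P) (s⁻¹ • y, s) = s * dX s₀ i (rayExt P) (y, s) := fun i => by
    simpa using isHomog_dX hf hk i s hI s⁻¹ hs' y y0
  have d4 : ∀ i, dX s₀ i (dS s₀ (rayExt P)) (s⁻¹ • y, s) = s * dX s₀ i (dS s₀ (rayExt P)) (y, s) :=
    fun i => by
    simpa using isHomog_dX (contDiffOn_dS hf) (isHomog_dS hf hk) i s hI s⁻¹ hs' y y0
  have d5 : ∀ i j, dX s₀ i (dX s₀ j (rayExt P)) (s⁻¹ • y, s)
      = s ^ 2 * dX s₀ i (dX s₀ j (rayExt P)) (y, s) := fun i j => by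
    have := isHomog_dX (contDiffOn_dX hf j) (isHomog_dX hf hk j) i s hI s⁻¹ hs' y y0
    refine this.trans ?_
    congr 1
    rw [show (0 - 1 - 1 : ℤ) = -2 by norm_num, inv_zpow, zpow_neg, inv_inv]
    norm_cast
  refine ⟨e1, by rw [e2, hn, inv_inv], fun i => by rw [e5, hu], fun i => ?_, fun i j => ?_⟩
  · rw [(h.hasPD hx).eq i, hn, inv_inv, hu, d1, d3, e2, e3, e5, e6]
    field_simp
    ring
  · rw [h.pderiv_pderiv hx i j, hn, inv_inv, hu, hu, d1, d2, d4, d4, d5, e2, e3, e4, e5, e7, e8]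
    simp only [Matrix.of_apply]
    have := (h.lapse_pos hx).ne'
    rw [hn] at this
    field_simp
    ring

end jetAt

/-! ### The first eigenfunctions of the sphere -/

/-- The Euclidean Laplacian in coordinates. -/
noncomputable def lap (g : E 3 → ℝ) (x : E 3) : ℝ := ∑ i, pderiv i (pderiv i g) x

theorem one_lt_rank_space : 1 < Module.rank ℝ (E 3) := by
  rw [← Module.finrank_eq_rank]
  simp

theorem const_of_pderiv_eq_zero {g : E 3 → ℝ} (hg : ContDiffOn ℝ ∞ g {0}ᶜ)
    (h : ∀ x ≠ 0, ∀ i, pderiv i g x = 0) : ∃ c, ∀ x ≠ 0, g x = c := by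
  have hc : IsPreconnected ({0}ᶜ : Set (E 3)) :=
    (isConnected_compl_singleton_of_one_lt_rank one_lt_rank_space 0).isPreconnected
  refine (isOpen_compl_singleton.exists_is_const_of_fderiv_eq_zero hc
    (hg.differentiableOn (by simp)) fun x hx => ?_).imp fun c hc x hx => hc x hx
  ext v
  rw [fderiv_eq_sum_pderiv]
  simp [h x hx]

theorem laplacian_eq_lap {g : E 3 → ℝ} {U : Set (E 3)} (hU : IsOpen U) (hg : ContDiffOn ℝ ∞ g U)
    {x : E 3} (hx : x ∈ U) : Laplacian.laplacian g x = lap g x := by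
  have hc : ContDiffAt ℝ ∞ g x := hg.contDiffAt (hU.mem_nhds hx)
  have hd : DifferentiableAt ℝ (fderiv ℝ g) x :=
    (hc.fderiv_right (m := 1) (by exact WithTop.coe_le_coe.2 le_top)).differentiableAt (by simp)
  rw [InnerProductSpace.laplacian_eq_iteratedFDeriv_orthonormalBasis g
    (EuclideanSpace.basisFun (Fin 3) ℝ), lap]
  refine Finset.sum_congr rfl fun i _ => ?_
  have := (hd.hasFDerivAt.clm_apply (hasFDerivAt_const (EuclideanSpace.single i (1 : ℝ)) x)).fderiv
  rw [pderiv, iteratedFDeriv_two_apply]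
  change _ = fderiv ℝ (fun z => fderiv ℝ g z (EuclideanSpace.single i 1)) x _
  rw [this]
  simp

theorem isHomog_lap {k : ℤ} {g : E 3 → ℝ} (hg : ContDiffOn ℝ ∞ g {0}ᶜ) (hk : IsHomog k g) :
    IsHomog (k - 1 - 1) (lap g) := by
  intro t ht x hx
  rw [lap, lap, Finset.mul_sum]
  exact Finset.sum_congr rfl fun i _ => (hk.pderiv hg i).pderiv
    (contDiffOn_pderiv isOpen_compl_singleton hg i) i t ht x hx

section Extension

variable {f : S2 → ℝ}

theorem contDiffOn_radialExtension (hf : ContMDiff (𝓡 2) 𝓘(ℝ, ℝ) ∞ f) :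
    ContDiffOn ℝ ∞ (radialExtension f) {0}ᶜ := by
  have h : SmoothUpToScri 1 (fun z : S2 × ℝ => f z.1) := (hf.comp contMDiff_fst).contMDiffOn
  exact contDiffOn_slice (contDiffOn_rayExt h) (s := 0) ⟨le_rfl, one_pos⟩

theorem isHomog_radialExtension (f : S2 → ℝ) : IsHomog 0 (radialExtension f) :=
  isHomog_rayExt (fun z => f z.1) 0

theorem sphereLaplacian_eq_lap (hf : ContMDiff (𝓡 2) 𝓘(ℝ, ℝ) ∞ f) (y : S2) :
    sphereLaplacian f y = lap (radialExtension f) y :=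
  laplacian_eq_lap isOpen_compl_singleton (contDiffOn_radialExtension hf) (sphere_ne_zero y.2)

end Extension

theorem IsHomog.eq_of_eqOn_sphere {k : ℤ} {f g : E 3 → ℝ} (hf : IsHomog k f) (hg : IsHomog k g)
    (h : ∀ y ∈ sphere (0 : E 3) 1, f y = g y) {x : E 3} (hx : x ≠ 0) : f x = g x := by
  have h0 : 0 < ‖x‖ := norm_pos_iff.2 hx
  have hy : ‖x‖⁻¹ • x ∈ sphere (0 : E 3) 1 := by
    rw [mem_sphere_zero_iff_norm, norm_smul, norm_inv, norm_norm, inv_mul_cancel₀ h0.ne']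
  have hx' : x = ‖x‖ • ‖x‖⁻¹ • x := by rw [smul_smul, mul_inv_cancel₀ h0.ne', one_smul]
  rw [hx', hf _ h0 _ (sphere_ne_zero hy), hg _ h0 _ (sphere_ne_zero hy), h _ hy]

theorem integrable_pderiv {F : E 3 → ℝ} (hF : ContDiff ℝ ∞ F) (hc : HasCompactSupport F)
    (i : Fin 3) : MeasureTheory.Integrable (pderiv i F) := by
  have hF' : Continuous (pderiv i F) := (hF.continuous_fderiv (by simp)).clm_apply continuous_const
  refine hF'.integrable_of_hasCompactSupport
    (HasCompactSupport.of_support_subset_isCompact hc fun x hx => ?_)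
  by_contra h
  refine hx ?_
  rw [pderiv, image_eq_zero_of_notMem_tsupport fun h' => h (tsupport_fderiv_subset ℝ h')]
  rfl

theorem integral_pderiv_eq_zero {F : E 3 → ℝ} (hF : ContDiff ℝ ∞ F) (hc : HasCompactSupport F)
    (i : Fin 3) : ∫ x, pderiv i F x = 0 := by
  have h1 := integrable_pderiv hF hc i
  have h2 := integral_mul_fderiv_eq_neg_fderiv_mul_of_integrable (𝕜 := ℝ) (μ := MeasureTheory.volume)
    (f := fun _ => (1 : ℝ)) (g := F) (v := EuclideanSpace.single i 1)
    (by simp) (by simp only [one_mul]; exact h1)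
    (by simpa using hF.continuous.integrable_of_hasCompactSupport hc)
    (fun _ _ => differentiableAt_const _) (fun x _ => hF.differentiable (by simp) x)
  simpa [pderiv] using h2

/-- A function of `|x|²` that is supported in an annulus and equal to `1` on the unit sphere. -/
noncomputable def annulusBump (x : E 3) : ℝ :=
  (⟨1 / 4, 1 / 2, by norm_num, by norm_num⟩ : ContDiffBump (1 : ℝ)) (‖x‖ ^ 2)

theorem contDiff_annulusBump : ContDiff ℝ ∞ annulusBump :=
  (ContDiffBump.contDiff _).comp (contDiff_norm_sq ℝ)

theorem annulusBump_nonneg (x : E 3) : 0 ≤ annulusBump x := ContDiffBump.nonneg' _ _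

theorem annulusBump_sphere {y : E 3} (hy : y ∈ sphere (0 : E 3) 1) : annulusBump y = 1 := by
  rw [annulusBump, mem_sphere_zero_iff_norm.1 hy]
  exact ContDiffBump.one_of_mem_closedBall _ (by simp)

theorem annulusBump_of_norm_sq_le {x : E 3} (hx : ‖x‖ ^ 2 ≤ 1 / 2) : annulusBump x = 0 :=
  ContDiffBump.zero_of_le_dist _ (by
    rw [Real.dist_eq, abs_sub_comm, abs_of_nonneg (by linarith)]; simp; linarith)

theorem annulusBump_of_le_norm_sq {x : E 3} (hx : 3 / 2 ≤ ‖x‖ ^ 2) : annulusBump x = 0 :=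
  ContDiffBump.zero_of_le_dist _ (by
    rw [Real.dist_eq, abs_of_nonneg (by linarith)]; simp; linarith)

theorem sum_mul_pderiv_annulusBump {ψ : E 3 → ℝ} (hk : IsHomog 0 ψ) (hψ : ContDiffOn ℝ ∞ ψ {0}ᶜ)
    {x : E 3} (hx : x ≠ 0) : ∑ i, pderiv i annulusBump x * pderiv i ψ x = 0 := by
  have h1 : HasPD (fun x : E 3 => ‖x‖ ^ 2) (fun i => 2 * ‖x‖ * (x i / ‖x‖)) x :=
    ((HasPD.norm hx).comp (hasDerivAt_pow 2 ‖x‖)).congr_deriv fun i => by simp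
  have h2 : ContDiff ℝ ∞ ((⟨1 / 4, 1 / 2, by norm_num, by norm_num⟩ : ContDiffBump (1 : ℝ)) : ℝ → ℝ) :=
    ContDiffBump.contDiff _
  have h3 := h1.comp (f := fun x : E 3 => ‖x‖ ^ 2)
    ((h2.differentiable (by simp) (‖x‖ ^ 2)).hasDerivAt)
  have h4 := hk.euler ((ContDiffOn.hasPD isOpen_compl_singleton hψ hx).diff) hx
  have h5 : ‖x‖ ≠ 0 := norm_ne_zero_iff.2 hx
  set d := deriv ((⟨1 / 4, 1 / 2, by norm_num, by norm_num⟩ : ContDiffBump (1 : ℝ)) : ℝ → ℝ) (‖x‖ ^ 2)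
  have h6 : ∀ i, pderiv i annulusBump x = 2 * d * x i := fun i => by
    refine (h3.eq i).trans ?_
    field_simp
  simp only [h6, mul_assoc, ← Finset.mul_sum, h4]
  simp

/-- A harmonic function that is constant along rays is constant: integrate
`div (η ψ ∇ψ) = η |∇ψ|²` over `ℝ³`, where `η` is radial and supported in an annulus. -/
theorem const_of_lap_eq_zero {ψ : E 3 → ℝ} (hψ : ContDiffOn ℝ ∞ ψ {0}ᶜ) (hk : IsHomog 0 ψ)
    (h : ∀ x ≠ 0, lap ψ x = 0) : ∃ c, ∀ x ≠ 0, ψ x = c := by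
  have hO : IsOpen ({0}ᶜ : Set (E 3)) := isOpen_compl_singleton
  let F : Fin 3 → E 3 → ℝ := fun i x => annulusBump x * (ψ x * pderiv i ψ x)
  have hz : ∀ {G : E 3 → ℝ}, ContDiffOn ℝ ∞ G {0}ᶜ → ContDiff ℝ ∞ fun x => annulusBump x * G x := by
    intro G hG
    rw [contDiff_iff_contDiffAt]
    intro x
    by_cases hx : x = 0
    · refine (contDiffAt_const (c := (0 : ℝ))).congr_of_eventuallyEq ?_
      have : {x : E 3 | ‖x‖ ^ 2 < 1 / 2} ∈ nhds x :=
        (isOpen_lt (by fun_prop) continuous_const).mem_nhds (by simp [hx])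
      filter_upwards [this] with z hz
      rw [annulusBump_of_norm_sq_le (le_of_lt hz), zero_mul]
    · exact contDiff_annulusBump.contDiffAt.mul (hG.contDiffAt (hO.mem_nhds hx))
  have hcs : ∀ G : E 3 → ℝ, HasCompactSupport fun x => annulusBump x * G x := fun G =>
    HasCompactSupport.of_support_subset_isCompact (isCompact_closedBall (0 : E 3) 2) fun x hx => by
      by_contra hx'
      have : 2 < ‖x‖ := by simpa using hx'
      exact hx (by simp only; rw [annulusBump_of_le_norm_sq (by nlinarith), zero_mul])
  have hF : ∀ i, ContDiff ℝ ∞ (F i) := fun i => hz (hψ.mul (contDiffOn_pderiv hO hψ i))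
  let e : E 3 → ℝ := fun x => annulusBump x * ∑ i, pderiv i ψ x * pderiv i ψ x
  have he : ContDiff ℝ ∞ e :=
    hz (ContDiffOn.sum fun i _ => (contDiffOn_pderiv hO hψ i).mul (contDiffOn_pderiv hO hψ i))
  -- the cutoff is radial and `ψ` is constant along rays, so that their gradients are orthogonal
  have hde : ∀ x, ∑ i, pderiv i (F i) x = e x := by
    intro x
    by_cases hx : x = 0
    · have : {x : E 3 | ‖x‖ ^ 2 < 1 / 2} ∈ nhds x :=
        (isOpen_lt (by fun_prop) continuous_const).mem_nhds (by simp [hx])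
      have h0 : ∀ i, F i =ᶠ[nhds x] fun _ => 0 := fun i => by
        filter_upwards [this] with z hz
        simp only [F]
        rw [annulusBump_of_norm_sq_le (le_of_lt hz), zero_mul]
      have h1 : e x = 0 := by
        simp only [e]; rw [annulusBump_of_norm_sq_le (by simp [hx]), zero_mul]
      rw [h1]
      exact Finset.sum_eq_zero fun i _ => by rw [pderiv_congr (h0 i), (HasPD.const 0).eq]
    · have h0 : ∀ i, pderiv i (F i) x = pderiv i annulusBump x * pderiv i ψ x * ψ x
          + annulusBump x * (pderiv i ψ x * pderiv i ψ x) + annulusBump x * ψ x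
            * pderiv i (pderiv i ψ) x := fun i => by
        have h1 : HasPD annulusBump _ x :=
          ContDiffOn.hasPD isOpen_univ contDiff_annulusBump.contDiffOn (mem_univ x)
        rw [(h1.mul ((ContDiffOn.hasPD hO hψ hx).mul
          (ContDiffOn.hasPD hO (contDiffOn_pderiv hO hψ i) hx))).eq i]
        ring
      simp only [h0, Finset.sum_add_distrib, ← Finset.sum_mul, ← Finset.mul_sum,
        sum_mul_pderiv_annulusBump hk hψ hx]
      have := h x hx
      rw [lap] at this
      rw [this]
      simp [e]
  have hint : ∫ x, e x = 0 := by
    simp only [← hde]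
    rw [MeasureTheory.integral_finsetSum _ fun i _ => integrable_pderiv (hF i) (hcs _) i]
    exact Finset.sum_eq_zero fun i _ => integral_pderiv_eq_zero (hF i) (hcs _) i
  have he0 : ∀ x, e x = 0 := by
    intro x
    by_contra hx
    have hnn : 0 ≤ e := fun _ => mul_nonneg (annulusBump_nonneg _)
      (Finset.sum_nonneg fun i _ => mul_self_nonneg _)
    exact (he.continuous.integral_pos_of_hasCompactSupport_nonneg_nonzero (hcs _) hnn hx).ne' hint
  refine const_of_pderiv_eq_zero hψ fun x hx i => ?_
  refine (hk.pderiv hψ i).eq_of_eqOn_sphere (g := fun _ => 0) (fun t _ x _ => by simp) ?_ hx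
  intro y hy
  have h1 := he0 y
  simp only [e, annulusBump_sphere hy, one_mul] at h1
  exact mul_self_eq_zero.1 ((Finset.sum_eq_zero_iff_of_nonneg fun i _ => mul_self_nonneg _).1 h1 i
    (Finset.mem_univ i))

theorem hasPD_norm_inv {x : E 3} (hx : x ≠ 0) :
    HasPD (fun z : E 3 => ‖z‖⁻¹) (fun i => -(x i / ‖x‖ ^ 3)) x := by
  have h0 := norm_ne_zero_iff.2 hx
  refine ((HasPD.norm hx).comp (hasDerivAt_inv h0)).congr_deriv fun i => ?_
  field_simp

section FirstEigenfunctions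

variable {ψ : E 3 → ℝ}

theorem contDiffOn_norm_mul (hψ : ContDiffOn ℝ ∞ ψ {0}ᶜ) :
    ContDiffOn ℝ ∞ (fun x => ‖x‖ * ψ x) {0}ᶜ :=
  (contDiffOn_id.norm ℝ fun _ hx => hx).mul hψ

theorem isHomog_norm_mul (hk : IsHomog 0 ψ) : IsHomog 1 fun x => ‖x‖ * ψ x := fun t ht x hx => by
  simp only [hk t ht x hx, norm_smul, Real.norm_eq_abs, abs_of_pos ht]
  simp; ring

theorem pderiv_norm_mul (hψ : ContDiffOn ℝ ∞ ψ {0}ᶜ) {x : E 3} (hx : x ≠ 0) (j : Fin 3) :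
    pderiv j (fun x => ‖x‖ * ψ x) x = unitDir x j * ψ x + ‖x‖ * pderiv j ψ x :=
  ((HasPD.norm hx).mul (ContDiffOn.hasPD isOpen_compl_singleton hψ hx)).eq j

theorem pderiv_pderiv_norm_mul (hψ : ContDiffOn ℝ ∞ ψ {0}ᶜ) {x : E 3} (hx : x ≠ 0) (i j : Fin 3) :
    pderiv i (pderiv j fun x => ‖x‖ * ψ x) x
      = ((if i = j then 1 else 0) - unitDir x i * unitDir x j) / ‖x‖ * ψ x
        + (unitDir x j * pderiv i ψ x + unitDir x i * pderiv j ψ x)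
        + ‖x‖ * pderiv i (pderiv j ψ) x := by
  have hO : IsOpen ({0}ᶜ : Set (E 3)) := isOpen_compl_singleton
  have h1 : pderiv j (fun x => ‖x‖ * ψ x) =ᶠ[nhds x]
      fun z => unitDir z j * ψ z + ‖z‖ * pderiv j ψ z := by
    filter_upwards [hO.mem_nhds hx] with z hz using pderiv_norm_mul hψ hz j
  rw [pderiv_congr h1, (((hasPD_unitDir hx j).mul (ContDiffOn.hasPD hO hψ hx)).add
    ((HasPD.norm hx).mul (ContDiffOn.hasPD hO (contDiffOn_pderiv hO hψ j) hx))).eq i]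
  simp only [unitDir]
  ring

/-- If the gradient of `|x| ψ` is constant up to a multiple of `∇|x|`, then `ψ` is affine on the
sphere. -/
theorem eq_add_of_pderiv_norm_mul (hψ : ContDiffOn ℝ ∞ ψ {0}ᶜ) (hk : IsHomog 0 ψ) (c : ℝ)
    (b : Fin 3 → ℝ) (h : ∀ x ≠ 0, ∀ i, pderiv i (fun x => ‖x‖ * ψ x) x = b i + c * unitDir x i) :
    ∀ y ∈ sphere (0 : E 3) 1, ψ y = c + ∑ i, b i * y i := by
  intro y hy
  have hy0 := sphere_ne_zero hy
  have h1 := (isHomog_norm_mul hk).euler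
    (ContDiffOn.hasPD isOpen_compl_singleton (contDiffOn_norm_mul hψ) hy0).diff hy0
  have hn := mem_sphere_zero_iff_norm.1 hy
  have h2 := sum_sq_eq_norm_sq y
  simp only [h y hy0, hn, unitDir] at h1 h2
  simp only [Fin.sum_univ_three] at *
  push_cast at h1
  linear_combination -h1 + c * h2

/-- A function on the sphere with trace free Hessian zero is a linear function plus a constant. -/
theorem eq_add_of_traceless_hessian (hψ : ContDiffOn ℝ ∞ ψ {0}ᶜ) (hk : IsHomog 0 ψ) (ν : E 3 → ℝ)
    (h : ∀ y ∈ sphere (0 : E 3) 1, ∀ i j, pderiv i (pderiv j ψ) y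
      + (y i * pderiv j ψ y + y j * pderiv i ψ y) = ν y * ((if i = j then 1 else 0) - y i * y j)) :
    ∃ (a : ℝ) (b : Fin 3 → ℝ), ∀ y ∈ sphere (0 : E 3) 1, ψ y = a + ∑ i, b i * y i := by
  have hO : IsOpen ({0}ᶜ : Set (E 3)) := isOpen_compl_singleton
  set Φ : E 3 → ℝ := fun x => ‖x‖ * ψ x with hΦdef
  have hΦ : ContDiffOn ℝ ∞ Φ {0}ᶜ := contDiffOn_norm_mul hψ
  have hΦk : IsHomog 1 Φ := isHomog_norm_mul hk
  have hP : ∀ i, ContDiffOn ℝ ∞ (pderiv i Φ) {0}ᶜ := fun i => contDiffOn_pderiv hO hΦ i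
  -- the Hessian of `Φ` is a multiple of the Hessian of `|x|`
  set l : E 3 → ℝ := fun x => lap Φ x / 2 with hl
  have hlc : ContDiffOn ℝ ∞ l {0}ᶜ :=
    (ContDiffOn.sum fun i _ => contDiffOn_pderiv hO (hP i) i).div_const 2
  have hH : ∀ x ≠ 0, ∀ i j, pderiv i (pderiv j Φ) x
      = l x * ((if i = j then 1 else 0) - unitDir x i * unitDir x j) := by
    intro x hx i j
    refine ((hΦk.pderiv hΦ j).pderiv (hP j) i).eq_of_eqOn_sphere
      (g := fun x => l x * ((if i = j then 1 else 0) - unitDir x i * unitDir x j)) ?_ ?_ hx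
    · intro t ht x hx
      have h1 : ∀ k, unitDir (t • x) k = unitDir x k := fun k => by
        have := norm_ne_zero_iff.2 hx
        simp [unitDir, norm_smul, abs_of_pos ht]; field_simp
      simp only [hl, h1, isHomog_lap hΦ hΦk t ht x hx]
      ring
    · intro y hy
      have hn := mem_sphere_zero_iff_norm.1 hy
      have h1 : ∀ i j, pderiv i (pderiv j Φ) y
          = (ψ y + ν y) * ((if i = j then 1 else 0) - y i * y j) := fun i j => by
        rw [hΦdef, pderiv_pderiv_norm_mul hψ (sphere_ne_zero hy)]
        simp only [unitDir, hn]
        linear_combination h y hy i j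
      have h2 : l y = ψ y + ν y := by
        have h3 := sum_sq_eq_norm_sq y
        rw [hn] at h3
        simp only [hl, lap, h1, Fin.sum_univ_three] at h3 ⊢
        simp
        linear_combination (-(ψ y + ν y) / 2) * h3
      rw [h1, h2]
      simp only [unitDir, hn, div_one]
  -- the divergence of the Hessian is the gradient of the Laplacian
  have hdl : ∀ x ≠ 0, ∀ i, pderiv i l x = -(unitDir x i / ‖x‖) * l x := by
    intro x hx i
    have h0 := norm_ne_zero_iff.2 hx
    have hL := ContDiffOn.hasPD hO hlc hx
    have hlk : IsHomog (-1) l := fun t ht x hx => by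
      simp only [hl, isHomog_lap hΦ hΦk t ht x hx]; norm_num; ring
    have h1 : ∀ j, pderiv j (pderiv j (pderiv i Φ)) x
        = pderiv j l x * ((if j = i then 1 else 0) - unitDir x j * unitDir x i)
          - l x * ((1 - unitDir x j * unitDir x j) / ‖x‖ * unitDir x i
          + unitDir x j * (((if j = i then 1 else 0) - unitDir x j * unitDir x i) / ‖x‖)) := by
      intro j
      have h2 : pderiv j (pderiv i Φ) =ᶠ[nhds x]
          fun z => l z * ((if j = i then 1 else 0) - unitDir z j * unitDir z i) := by
        filter_upwards [hO.mem_nhds hx] with z hz using hH z hz j i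
      rw [pderiv_congr h2, (hL.mul ((HasPD.const _).sub
        ((hasPD_unitDir hx j).mul (hasPD_unitDir hx i)))).eq j]
      simp
      ring
    have h3 : ∑ j, pderiv j (pderiv j (pderiv i Φ)) x = 2 * pderiv i l x := by
      have h4 : ∀ j, pderiv j (pderiv j (pderiv i Φ)) x = pderiv i (pderiv j (pderiv j Φ)) x := by
        intro j
        have h5 : pderiv j (pderiv i Φ) =ᶠ[nhds x] pderiv i (pderiv j Φ) := by
          filter_upwards [hO.mem_nhds hx] with z hz using pderiv_comm hO hΦ hz j i
        rw [pderiv_congr h5, pderiv_comm hO (hP j) hx]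
      have h6 := ((HasPD.sum Finset.univ fun j _ =>
        ContDiffOn.hasPD hO (contDiffOn_pderiv hO (hP j) j) hx).const_mul (1 / 2)).eq i
      have h7 : l = fun z => 1 / 2 * ∑ j, pderiv j (pderiv j Φ) z := by
        funext z; simp only [hl, lap]; ring
      rw [h7, h6]
      simp only [h4]
      ring
    have h8 := hlk.euler hL.diff hx
    have h9 := sum_unitDir_sq hx
    have h10 : ∑ j, pderiv j l x * unitDir x j = -l x / ‖x‖ := by
      rw [eq_div_iff h0, Finset.sum_mul]
      have : (-1 : ℝ) * l x = ((-1 : ℤ) : ℝ) * l x := by norm_num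
      rw [← neg_one_mul, this, ← h8]
      refine Finset.sum_congr rfl fun j _ => ?_
      rw [unitDir]; field_simp
    have h11 : ∑ j, pderiv j l x * (if j = i then (1 : ℝ) else 0) = pderiv i l x := by simp
    have h12 : ∑ j, unitDir x j * (if j = i then (1 : ℝ) else 0) = unitDir x i := by simp
    simp only [h1] at h3
    simp only [Fin.sum_univ_three] at h3 h9 h10 h11 h12
    generalize pderiv i l x = A at *
    generalize (if (0 : Fin 3) = i then (1 : ℝ) else 0) = d0 at *
    generalize (if (1 : Fin 3) = i then (1 : ℝ) else 0) = d1 at *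
    generalize (if (2 : Fin 3) = i then (1 : ℝ) else 0) = d2 at *
    field_simp at h3 h10 ⊢
    linear_combination (-1 : ℝ) * h3 + ‖x‖ * h11 - unitDir x i * h10
      - l x * h12 + 2 * l x * unitDir x i * h9
  -- by `hdl` the gradient of `|x| l` vanishes
  have hc : ∃ c, ∀ x ≠ 0, ‖x‖ * l x = c := by
    refine const_of_pderiv_eq_zero (contDiffOn_norm_mul hlc) fun x hx i => ?_
    have := norm_ne_zero_iff.2 hx
    rw [pderiv_norm_mul hlc hx, hdl x hx]
    field_simp
    ring
  obtain ⟨c, hc⟩ := hc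
  have hb : ∀ i, ∃ b, ∀ x ≠ 0, pderiv i Φ x - c * unitDir x i = b := by
    intro i
    have hu : ContDiffOn ℝ ∞ (fun x => unitDir x i) {0}ᶜ :=
      (contDiffOn_euclidean.1 contDiffOn_id i).div (contDiffOn_id.norm ℝ fun x hx => hx)
        fun x hx => norm_ne_zero_iff.2 hx
    refine const_of_pderiv_eq_zero ((hP i).sub (contDiffOn_const.mul hu)) fun x hx j => ?_
    rw [((ContDiffOn.hasPD hO (hP i) hx).sub ((hasPD_unitDir hx i).const_mul c)).eq j,
      hH x hx, ← hc x hx]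
    have := norm_ne_zero_iff.2 hx
    field_simp
    ring
  choose b hb using hb
  exact ⟨c, b, eq_add_of_pderiv_norm_mul hψ hk c b fun x hx i => by rw [← hb i x hx]; ring⟩

/-- If `ψ` is an eigenfunction for the eigenvalue `2`, then `|x| ψ` is harmonic, and so are its
partial derivatives, which are constant along rays. -/
theorem eq_sum_of_lap_eq (hψ : ContDiffOn ℝ ∞ ψ {0}ᶜ) (hk : IsHomog 0 ψ)
    (h : ∀ y ∈ sphere (0 : E 3) 1, lap ψ y = -2 * ψ y) :
    ∃ b : Fin 3 → ℝ, ∀ y ∈ sphere (0 : E 3) 1, ψ y = ∑ i, b i * y i := by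
  have hO : IsOpen ({0}ᶜ : Set (E 3)) := isOpen_compl_singleton
  set Φ : E 3 → ℝ := fun x => ‖x‖ * ψ x with hΦdef
  have hΦ : ContDiffOn ℝ ∞ Φ {0}ᶜ := contDiffOn_norm_mul hψ
  have hΦk : IsHomog 1 Φ := isHomog_norm_mul hk
  have hP : ∀ i, ContDiffOn ℝ ∞ (pderiv i Φ) {0}ᶜ := fun i => contDiffOn_pderiv hO hΦ i
  have h1 : ∀ x ≠ 0, lap Φ x = 0 := by
    intro x hx
    refine (isHomog_lap hΦ hΦk).eq_of_eqOn_sphere (g := fun _ => 0)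
      (fun t _ x _ => by simp) (fun y hy => ?_) hx
    have hy0 := sphere_ne_zero hy
    have hn := mem_sphere_zero_iff_norm.1 hy
    have h2 := hk.euler (ContDiffOn.hasPD hO hψ hy0).diff hy0
    have h3 := sum_sq_eq_norm_sq y
    have h4 := h y hy
    simp only [lap, hΦdef, pderiv_pderiv_norm_mul hψ hy0, Fin.sum_univ_three, hn, unitDir] at *
    simp at *
    linear_combination 2 * h2 - ψ y * h3 + h4
  have h2 : ∀ i, ∃ b, ∀ x ≠ 0, pderiv i Φ x = b := by
    intro i
    refine const_of_lap_eq_zero (hP i) (hΦk.pderiv hΦ i) fun x hx => ?_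
    have h4 : ∀ j, pderiv j (pderiv j (pderiv i Φ)) x = pderiv i (pderiv j (pderiv j Φ)) x := by
      intro j
      have h5 : pderiv j (pderiv i Φ) =ᶠ[nhds x] pderiv i (pderiv j Φ) := by
        filter_upwards [hO.mem_nhds hx] with z hz using pderiv_comm hO hΦ hz j i
      rw [pderiv_congr h5, pderiv_comm hO (hP j) hx]
    have h6 := (HasPD.sum Finset.univ fun j _ =>
      ContDiffOn.hasPD hO (contDiffOn_pderiv hO (hP j) j) hx).eq i
    have h7 : (fun z => ∑ j, pderiv j (pderiv j Φ) z) =ᶠ[nhds x] fun _ => 0 := by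
      filter_upwards [hO.mem_nhds hx] with z hz using h1 z hz
    rw [pderiv_congr h7, (HasPD.const 0).eq] at h6
    simp only [lap, h4, ← h6]
  choose b hb using h2
  refine ⟨b, fun y hy => ?_⟩
  simpa using eq_add_of_pderiv_norm_mul hψ hk 0 b (fun x hx i => by simp [← hb i x hx, hΦdef]) y hy

end FirstEigenfunctions

theorem isSphereEigenfunction_const (a : ℝ) : IsSphereEigenfunction 0 fun _ => a := by
  refine ⟨contMDiff_const, fun y => ?_⟩
  have hO : IsOpen ({0}ᶜ : Set (E 3)) := isOpen_compl_singleton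
  rw [sphereLaplacian_eq_lap contMDiff_const]
  have h1 : ∀ x ≠ 0, radialExtension (fun _ => a) x = a := fun x hx => by
    rw [radialExtension, dif_neg hx]
  have h2 : ∀ x ≠ 0, ∀ i, pderiv i (radialExtension fun _ => a) x = 0 := fun x hx i => by
    have : radialExtension (fun _ => a) =ᶠ[nhds x] fun _ => a := by
      filter_upwards [hO.mem_nhds hx] with z hz using h1 z hz
    rw [pderiv_congr this, (HasPD.const a).eq]
  have h3 : ∀ i, pderiv i (pderiv i (radialExtension fun _ => a)) y = 0 := fun i => by
    have : pderiv i (radialExtension fun _ => a) =ᶠ[nhds (y : E 3)] fun _ => 0 := by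
      filter_upwards [hO.mem_nhds (sphere_ne_zero y.2)] with z hz using h2 z hz i
    rw [pderiv_congr this, (HasPD.const 0).eq]
  simp [lap, h3]

theorem contMDiff_linear (b : Fin 3 → ℝ) :
    ContMDiff (𝓡 2) 𝓘(ℝ, ℝ) ∞ fun y : S2 => ∑ i, b i * (y : E 3) i := by
  have : Fact (Module.finrank ℝ (E 3) = 2 + 1) := ⟨by simp⟩
  have h1 : ContDiff ℝ ∞ fun x : E 3 => ∑ i, b i * x i :=
    ContDiff.sum fun i _ => contDiff_const.mul (contDiff_euclidean.1 contDiff_id i)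
  exact h1.contMDiff.comp contMDiff_coe_sphere

theorem isSphereEigenfunction_linear (b : Fin 3 → ℝ) :
    IsSphereEigenfunction 2 fun y : S2 => ∑ i, b i * (y : E 3) i := by
  have hc := contMDiff_linear b
  refine ⟨hc, fun y => ?_⟩
  have hO : IsOpen ({0}ᶜ : Set (E 3)) := isOpen_compl_singleton
  rw [sphereLaplacian_eq_lap hc]
  set f : S2 → ℝ := fun y => ∑ i, b i * (y : E 3) i with hf
  have hψ := contDiffOn_radialExtension hc
  have hk := isHomog_radialExtension f
  have hy0 := sphere_ne_zero y.2
  have hn := mem_sphere_zero_iff_norm.1 y.2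
  have h1 : ∀ x ≠ 0, ‖x‖ * radialExtension f x = ∑ i, b i * x i := fun x hx => by
    have := norm_ne_zero_iff.2 hx
    rw [radialExtension, dif_neg hx, hf, Finset.mul_sum]
    refine Finset.sum_congr rfl fun i _ => ?_
    simp
    field_simp
  have h2 : ∀ x ≠ 0, ∀ i, pderiv i (fun x => ‖x‖ * radialExtension f x) x = b i := fun x hx i => by
    have : (fun x => ‖x‖ * radialExtension f x) =ᶠ[nhds x] fun x => ∑ i, b i * x i := by
      filter_upwards [hO.mem_nhds hx] with z hz using h1 z hz
    rw [pderiv_congr this, (HasPD.sum Finset.univ fun j _ => (HasPD.coord j).const_mul (b j)).eq]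
    simp
  have h3 : ∀ i, pderiv i (pderiv i fun x => ‖x‖ * radialExtension f x) y = 0 := fun i => by
    have : pderiv i (fun x => ‖x‖ * radialExtension f x) =ᶠ[nhds (y : E 3)] fun _ => b i := by
      filter_upwards [hO.mem_nhds hy0] with z hz using h2 z hz i
    rw [pderiv_congr this, (HasPD.const _).eq]
  have h4 := hk.euler (ContDiffOn.hasPD hO hψ hy0).diff hy0
  have h5 := sum_sq_eq_norm_sq (y : E 3)
  have h6 := radialExtension_coe f y
  simp only [pderiv_pderiv_norm_mul hψ hy0, hn, unitDir] at h3
  rw [hn] at h5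
  simp only [lap, Fin.sum_univ_three] at h4 h5 ⊢
  have h30 := h3 0
  have h31 := h3 1
  have h32 := h3 2
  rw [← h6]
  simp at h30 h31 h32 h4
  linear_combination -h30 - h31 - h32 + 2 * h4 - radialExtension f y * h5

/-- The combinations of the first four eigenfunctions are the restrictions to the sphere of the
affine functions. -/
theorem isFirstFourCombination_iff {f : S2 → ℝ} : IsFirstFourCombination f ↔
    ∃ (a : ℝ) (b : Fin 3 → ℝ), ∀ y : S2, f y = a + ∑ i, b i * (y : E 3) i := by
  constructor
  · intro h
    induction h using Submodule.span_induction with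
    | mem φ hφ =>
      rcases hφ with ⟨hφ, h⟩ | ⟨hφ, h⟩
      · obtain ⟨c, hc⟩ := const_of_lap_eq_zero (contDiffOn_radialExtension hφ)
          (isHomog_radialExtension φ) fun x hx =>
            (isHomog_lap (contDiffOn_radialExtension hφ) (isHomog_radialExtension φ)).eq_of_eqOn_sphere
              (g := fun _ => 0) (fun t _ x _ => by simp) (fun y hy => by
                have := h ⟨y, hy⟩
                rw [sphereLaplacian_eq_lap hφ] at this
                simpa using this) hx
        exact ⟨c, 0, fun y => by
          rw [← radialExtension_coe φ y, hc _ (sphere_ne_zero y.2)]; simp⟩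
      · obtain ⟨b, hb⟩ := eq_sum_of_lap_eq (contDiffOn_radialExtension hφ)
          (isHomog_radialExtension φ) fun y hy => by
            have := h ⟨y, hy⟩
            rw [sphereLaplacian_eq_lap hφ, ← radialExtension_coe φ] at this
            linarith
        exact ⟨0, b, fun y => by rw [← radialExtension_coe φ y, hb _ y.2, zero_add]⟩
    | zero => exact ⟨0, 0, fun y => by simp⟩
    | add f g _ _ hf hg =>
      obtain ⟨a, b, h⟩ := hf
      obtain ⟨a', b', h'⟩ := hg
      refine ⟨a + a', b + b', fun y => ?_⟩
      simp only [Pi.add_apply, h y, h' y, add_mul, Finset.sum_add_distrib]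
      ring
    | smul c f _ hf =>
      obtain ⟨a, b, h⟩ := hf
      refine ⟨c * a, c • b, fun y => ?_⟩
      simp only [Pi.smul_apply, h y, smul_eq_mul, mul_assoc, ← Finset.mul_sum]
      ring
  · rintro ⟨a, b, h⟩
    have : f = (fun _ => a) + fun y : S2 => ∑ i, b i * (y : E 3) i := funext h
    rw [this]
    exact Submodule.add_mem _ (Submodule.subset_span (Or.inl (isSphereEigenfunction_const a)))
      (Submodule.subset_span (Or.inr (isSphereEigenfunction_linear b)))

/-! ### Bounded functions near null infinity -/

/-- `f` is bounded near null infinity. This is a separate predicate so that `fun_prop` can prove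
boundedness of polynomials in bounded functions. -/
@[fun_prop]
def ScriBdd (f : E 3 × ℝ → ℝ) : Prop := ScriO f 0

section ScriBdd

variable {f g : E 3 × ℝ → ℝ} {k : ℕ}

theorem scriBdd_iff_isBigO : ScriBdd f ↔ f =O[scriFilter] fun _ => (1 : ℝ) := by
  simp [ScriBdd, ScriO]

@[fun_prop]
theorem ScriBdd.const (c : ℝ) : ScriBdd fun _ => c :=
  scriBdd_iff_isBigO.2 (isBigO_const_const c one_ne_zero _)

@[fun_prop]
theorem ScriBdd.add (hf : ScriBdd f) (hg : ScriBdd g) : ScriBdd fun z => f z + g z :=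
  IsBigO.add hf hg

@[fun_prop]
theorem ScriBdd.sub (hf : ScriBdd f) (hg : ScriBdd g) : ScriBdd fun z => f z - g z :=
  IsBigO.sub hf hg

@[fun_prop]
theorem ScriBdd.neg (hf : ScriBdd f) : ScriBdd fun z => -f z := IsBigO.neg_left hf

@[fun_prop]
theorem ScriBdd.mul (hf : ScriBdd f) (hg : ScriBdd g) : ScriBdd fun z => f z * g z := by
  have := (scriBdd_iff_isBigO.1 hf).mul (scriBdd_iff_isBigO.1 hg)
  simp only [mul_one] at this
  exact scriBdd_iff_isBigO.2 this

@[fun_prop]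
theorem ScriBdd.pow (hf : ScriBdd f) (n : ℕ) : ScriBdd fun z => f z ^ n := by
  induction n with
  | zero => simpa using ScriBdd.const 1
  | succ n ih => simpa only [pow_succ] using ih.mul hf

@[fun_prop]
theorem ScriBdd.div_const (hf : ScriBdd f) (c : ℝ) : ScriBdd fun z => f z / c := by
  simpa only [div_eq_mul_inv] using hf.mul (ScriBdd.const c⁻¹)

theorem ScriBdd.congr (hf : ScriBdd f) (h : ∀ᶠ z in scriFilter, g z = f z) : ScriBdd g :=
  IsBigO.congr' hf (h.mono fun _ hz => hz.symm) EventuallyEq.rfl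

theorem ScriO.congr (hf : ScriO f k) (h : ∀ᶠ z in scriFilter, g z = f z) : ScriO g k :=
  IsBigO.congr' hf (h.mono fun _ hz => hz.symm) EventuallyEq.rfl

theorem eventually_scriFilter_pos :
    ∀ᶠ z in scriFilter, z.1 ∈ sphere (0 : E 3) 1 ∧ 0 < z.2 ∧ z.2 < 1 :=
  (eventually_scriFilter_mem one_pos).mono fun _ h => h.2

@[fun_prop]
theorem scriBdd_snd : ScriBdd fun z => z.2 :=
  scriO_iff.2 ⟨1, zero_le_one, 1, one_pos, fun _ _ s hs => by
    simp only [pow_zero, mul_one]; rw [abs_of_pos hs.1]; exact hs.2.le⟩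

theorem ScriBdd.scriO (hf : ScriBdd f) (h : ∀ᶠ z in scriFilter, g z = z.2 ^ k * f z) :
    ScriO g k := by
  have := (isBigO_refl (fun z : E 3 × ℝ => z.2 ^ k) scriFilter).mul (scriBdd_iff_isBigO.1 hf)
  simp only [mul_one] at this
  exact ScriO.congr this h

/-- `O(s^k)` is `s^k` times a bounded function. -/
theorem ScriO.exists_bdd (hf : ScriO f k) :
    ∃ r, ScriBdd r ∧ ∀ᶠ z in scriFilter, f z = z.2 ^ k * r z := by
  refine ⟨fun z => (z.2 ^ k)⁻¹ * f z, ?_, ?_⟩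
  · have := (isBigO_refl (fun z : E 3 × ℝ => (z.2 ^ k)⁻¹) scriFilter).mul hf
    refine scriBdd_iff_isBigO.2 (this.trans_eventuallyEq ?_)
    filter_upwards [eventually_scriFilter_pos] with z hz
    exact inv_mul_cancel₀ (pow_ne_zero _ hz.2.1.ne')
  · filter_upwards [eventually_scriFilter_pos] with z hz
    rw [mul_inv_cancel_left₀ (pow_ne_zero _ hz.2.1.ne')]

theorem ScriO.of_le {l : ℕ} (hf : ScriO f k) (h : l ≤ k) : ScriO f l := by
  obtain ⟨r, hr, h1⟩ := hf.exists_bdd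
  refine (show ScriBdd fun z => z.2 ^ (k - l) * r z by fun_prop).scriO ?_
  filter_upwards [h1] with z hz
  rw [hz, ← mul_assoc, ← pow_add, Nat.add_sub_cancel' h]

theorem ScriO.add (hf : ScriO f k) (hg : ScriO g k) : ScriO (fun z => f z + g z) k := IsBigO.add hf hg

theorem ScriO.sub (hf : ScriO f k) (hg : ScriO g k) : ScriO (fun z => f z - g z) k := IsBigO.sub hf hg

theorem ScriO.sum {ι : Type*} {F : ι → E 3 × ℝ → ℝ} (s : Finset ι) (h : ∀ i ∈ s, ScriO (F i) k) :
    ScriO (fun z => ∑ i ∈ s, F i z) k := by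
  have : (fun z => ∑ i ∈ s, F i z) = ∑ i ∈ s, F i := by funext z; simp
  rw [this]
  exact IsBigO.sum h

theorem ScriO.mul_bdd (hf : ScriO f k) (hg : ScriBdd g) : ScriO (fun z => f z * g z) k := by
  have := IsBigO.mul hf (scriBdd_iff_isBigO.1 hg)
  simp only [mul_one] at this
  exact this

theorem ScriBdd.mul_scriO (hg : ScriBdd g) (hf : ScriO f k) : ScriO (fun z => g z * f z) k := by
  simpa only [mul_comm] using hf.mul_bdd hg

theorem ScriO.tendsto (hf : ScriO f k) (hk : k ≠ 0) : Tendsto f scriFilter (nhds 0) := by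
  refine IsBigO.trans_tendsto hf ?_
  have h1 : Tendsto (fun z : E 3 × ℝ => z.2) scriFilter (nhds 0) :=
    (tendsto_snd (f := 𝓟 (sphere (0 : E 3) 1)) (g := nhdsWithin (0 : ℝ) (Ioi 0))).mono_right
      nhdsWithin_le_nhds
  simpa [hk] using h1.pow k

theorem tendsto_scriFilter {y : E 3} (hy : y ∈ sphere (0 : E 3) 1) :
    Tendsto (fun s : ℝ => (y, s)) (nhdsWithin 0 (Ioi 0)) scriFilter :=
  (tendsto_principal.2 (Eventually.of_forall fun _ => hy)).prodMk tendsto_id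

theorem ScriBdd.inv {c : ℝ} (hc : 0 < c) (h : ∀ᶠ z in scriFilter, c ≤ f z) :
    ScriBdd fun z => (f z)⁻¹ := by
  refine scriBdd_iff_isBigO.2 (IsBigO.of_bound c⁻¹ ?_)
  filter_upwards [h] with z hz
  rw [norm_inv, Real.norm_eq_abs, abs_of_pos (hc.trans_le hz)]
  simpa using inv_anti₀ hc hz

end ScriBdd

theorem ContDiffOn.scriBdd {s₀ : ℝ} (hs₀ : 0 < s₀) {f : E 3 × ℝ → ℝ}
    (hf : ContDiffOn ℝ ∞ f (scriDomain s₀)) : ScriBdd f := by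
  have h := taylor_scriO hs₀ hf 0
  simp only [Finset.range_zero, Finset.sum_empty, sub_zero] at h
  exact h

/-! ### Boundedness of the jet -/

/-- A family of jets that is bounded near null infinity. -/
structure BddJet (J : E 3 × ℝ → ScriJet) (m : ℝ) : Prop where
  m_eq : ∀ᶠ z in scriFilter, (J z).m = m
  s_eq : ∀ᶠ z in scriFilter, (J z).s = z.2
  y : ∀ i, ScriBdd fun z => (J z).y i
  p₁ : ScriBdd fun z => (J z).p₁
  p₂ : ScriBdd fun z => (J z).p₂
  X : ∀ i, ScriBdd fun z => (J z).X i
  Z : ∀ i, ScriBdd fun z => (J z).Z i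
  H : ∀ i j, ScriBdd fun z => (J z).H i j

namespace BddJet

variable {J : E 3 × ℝ → ScriJet} {m : ℝ}

theorem m_bdd (h : BddJet J m) : ScriBdd fun z => (J z).m := (ScriBdd.const m).congr h.m_eq

theorem s_bdd (h : BddJet J m) : ScriBdd fun z => (J z).s := scriBdd_snd.congr h.s_eq

theorem q (h : BddJet J m) : ScriBdd fun z => (J z).q := by
  have h1 := h.m_bdd
  have h2 := h.s_bdd
  simp only [ScriJet.q]
  fun_prop

theorem dq (h : BddJet J m) : ScriBdd fun z => (J z).dq := by
  have h1 := h.m_bdd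
  have h2 := h.s_bdd
  simp only [ScriJet.dq]
  fun_prop

theorem w (h : BddJet J m) : ScriBdd fun z => (J z).w := by
  have h1 := h.q
  have h2 := h.p₁
  simp only [ScriJet.w]
  fun_prop

theorem HT (h : BddJet J m) (i j : Fin 3) : ScriBdd fun z => (J z).HT i j := by
  have h1 := h.y
  have h2 := h.X
  have h3 := h.H
  simp only [ScriJet.HT, Matrix.add_apply, Matrix.vecMulVec_apply]
  fun_prop

theorem Pr (h : BddJet J m) (i j : Fin 3) : ScriBdd fun z => (J z).Pr i j := by
  have h1 := h.y
  simp only [ScriJet.Pr, Matrix.sub_apply, Matrix.vecMulVec_apply]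
  fun_prop

theorem metric (h : BddJet J m) (i j : Fin 3) : ScriBdd fun z => (J z).metric i j := by
  have h1 := h.y
  have h2 := h.X
  have h3 := h.p₁
  have h4 := h.Pr
  have h5 := h.q
  have h6 := h.w
  simp only [ScriJet.metric, Matrix.add_apply, Matrix.vecMulVec_apply, Matrix.smul_apply,
    Matrix.sub_apply, smul_eq_mul]
  fun_prop

theorem T (h : BddJet J m) (i j : Fin 3) : ScriBdd fun z => (J z).T i j := by
  have h2 := h.X
  have h3 := h.HT
  have h5 := h.dq
  have h6 := h.w
  simp only [ScriJet.T, Matrix.vecMulVec_apply, Matrix.smul_apply,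
    Matrix.sub_apply, smul_eq_mul]
  fun_prop

theorem hess (h : BddJet J m) (i j : Fin 3) : ScriBdd fun z => (J z).hess i j := by
  have h1 := h.y
  have h2 := h.X
  have h3 := h.p₁
  have h4 := h.p₂
  have h5 := h.q
  have h6 := h.dq
  have h7 := h.T
  have h8 := h.Z
  simp only [ScriJet.hess, ScriJet.k₀, ScriJet.ζ, Matrix.add_apply, Matrix.vecMulVec_apply,
    Matrix.smul_apply, Pi.sub_apply, Pi.smul_apply, smul_eq_mul]
  fun_prop

theorem inv (h : BddJet J m) (hQ : ∀ᶠ z in scriFilter, 1 / 2 ≤ (J z).Q) (i j : Fin 3) :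
    ScriBdd fun z => (J z).inv i j := by
  have h1 := h.y
  have h2 := h.X
  have h3 := ScriBdd.inv (by norm_num) hQ
  have h4 := h.Pr
  have h5 := h.q
  have h6 := h.w
  simp only [ScriJet.inv, Matrix.add_apply, Matrix.vecMulVec_apply, Matrix.smul_apply,
    smul_eq_mul, dotProduct, Fin.sum_univ_three]
  fun_prop

theorem tr (h : BddJet J m) (hQ : ∀ᶠ z in scriFilter, 1 / 2 ≤ (J z).Q) :
    ScriBdd fun z => (J z).tr := by
  have h1 := h.inv hQ
  have h2 := h.hess
  simp only [ScriJet.tr, Matrix.trace, Matrix.diag_apply, Matrix.mul_apply, Fin.sum_univ_three]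
  fun_prop

theorem traceless (h : BddJet J m) (hQ : ∀ᶠ z in scriFilter, 1 / 2 ≤ (J z).Q) (i j : Fin 3) :
    ScriBdd fun z => (J z).traceless i j := by
  have h1 := h.tr hQ
  have h2 := h.hess
  have h3 := h.metric
  simp only [ScriJet.traceless, Matrix.sub_apply, Matrix.smul_apply, smul_eq_mul]
  fun_prop

end BddJet

/-! ### The induced metric at null infinity -/

/-- `ScriJet.Q` as a function on `ℝ³ ∖ {0} × [0, s₀)` that is constant along rays. -/
noncomputable def gradSq (m s₀ : ℝ) (f : E 3 × ℝ → ℝ) (z : E 3 × ℝ) : ℝ :=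
  -2 * dS s₀ f z - (z.2 ^ 2 - 2 * m * z.2 ^ 3) * dS s₀ f z ^ 2
    - (∑ i, z.1 i * z.1 i) * ∑ i, dX s₀ i f z * dX s₀ i f z

section gradSq

variable {m s₀ : ℝ} {f : E 3 × ℝ → ℝ}

theorem contDiffOn_gradSq (hf : ContDiffOn ℝ ∞ f (scriDomain s₀)) :
    ContDiffOn ℝ ∞ (gradSq m s₀ f) (scriDomain s₀) := by
  have h1 := contDiffOn_dS hf
  have h2 : ContDiffOn ℝ ∞ (fun z : E 3 × ℝ => z.2 ^ 2 - 2 * m * z.2 ^ 3) (scriDomain s₀) :=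
    ContDiff.contDiffOn (by fun_prop)
  have h3 : ∀ i, ContDiffOn ℝ ∞ (fun z : E 3 × ℝ => z.1 i) (scriDomain s₀) := fun i =>
    ((contDiff_euclidean.1 contDiff_id i).comp contDiff_fst).contDiffOn
  exact ((contDiffOn_const.mul h1).sub (h2.mul (h1.pow 2))).sub
    ((ContDiffOn.sum fun i _ => (h3 i).mul (h3 i)).mul
      (ContDiffOn.sum fun i _ => (contDiffOn_dX hf i).mul (contDiffOn_dX hf i)))

theorem isHomog_gradSq (hf : ContDiffOn ℝ ∞ f (scriDomain s₀))
    (hk : ∀ s ∈ Ico 0 s₀, IsHomog 0 (fun x => f (x, s))) :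
    ∀ s ∈ Ico 0 s₀, IsHomog 0 (fun x => gradSq m s₀ f (x, s)) := by
  intro s hs t ht x hx
  have h1 := isHomog_dS hf hk s hs t ht x hx
  have h2 : ∀ i, dX s₀ i f (t • x, s) = t⁻¹ * dX s₀ i f (x, s) := fun i => by
    simpa using isHomog_dX hf hk i s hs t ht x hx
  simp only [zpow_zero, one_mul] at h1 ⊢
  simp only [gradSq, h1, h2, Fin.sum_univ_three, PiLp.smul_apply, smul_eq_mul]
  field_simp

variable {z : E 3 × ℝ}

theorem gradSq_eq (hf : ContDiffOn ℝ ∞ f (scriDomain s₀))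
    (hk : ∀ s ∈ Ico 0 s₀, IsHomog 0 (fun x => f (x, s))) (hz : z ∈ scriDomain s₀)
    (hy : z.1 ∈ sphere (0 : E 3) 1) : gradSq m s₀ f z = (jetAt m s₀ f z).Q := by
  obtain ⟨e1, e2, e3, e4, e5, e6, e7, e8⟩ := jetAt_spec (m := m) hf hk hz hy
  rw [ScriJet.Q, ScriJet.q, e1, e2, e3, e6, gradSq, sum_sq_eq_norm_sq,
    mem_sphere_zero_iff_norm.1 hy]
  simp [dotProduct]

theorem dS_gradSq (hf : ContDiffOn ℝ ∞ f (scriDomain s₀))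
    (hk : ∀ s ∈ Ico 0 s₀, IsHomog 0 (fun x => f (x, s))) (hz : z ∈ scriDomain s₀)
    (hy : z.1 ∈ sphere (0 : E 3) 1) : dS s₀ (gradSq m s₀ f) z = (jetAt m s₀ f z).dsQ := by
  obtain ⟨e1, e2, e3, e4, e5, e6, e7, e8⟩ := jetAt_spec (m := m) hf hk hz hy
  obtain ⟨x, s⟩ := z
  have h1 := hasDerivWithinAt_dS (contDiffOn_gradSq (m := m) hf) hz
  have hp := hasDerivWithinAt_dS (contDiffOn_dS hf) hz
  have hX : ∀ i, HasDerivWithinAt (fun t => dX s₀ i f (x, t)) (dX s₀ i (dS s₀ f) (x, s))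
      (Ico 0 s₀) s := fun i => by
    rw [dX_dS_comm hf hz]; exact hasDerivWithinAt_dS (contDiffOn_dX hf i) hz
  have hq : HasDerivWithinAt (fun t : ℝ => t ^ 2 - 2 * m * t ^ 3) (2 * s - 6 * m * s ^ 2)
      (Ico 0 s₀) s :=
    (((hasDerivAt_pow 2 s).sub ((hasDerivAt_pow 3 s).const_mul (2 * m))).congr_deriv
      (by push_cast; ring)).hasDerivWithinAt
  have h2 := ((hp.const_mul (-2)).sub (hq.mul (hp.pow 2))).sub
    ((HasDerivWithinAt.fun_sum (u := Finset.univ) fun i _ => (hX i).mul (hX i)).const_mul (∑ i, x i * x i))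
  have h3 := (uniqueDiffOn_Ico 0 s₀ s hz.2).eq_deriv _ h1 h2
  rw [h3, ScriJet.dsQ, ScriJet.dq, ScriJet.q, e1, e2, e3, e4, e6, e7, sum_sq_eq_norm_sq,
    mem_sphere_zero_iff_norm.1 hy]
  simp only [dotProduct, Fin.sum_univ_three, Pi.pow_apply]
  ring

theorem sum_mul_dX_gradSq (hf : ContDiffOn ℝ ∞ f (scriDomain s₀))
    (hk : ∀ s ∈ Ico 0 s₀, IsHomog 0 (fun x => f (x, s))) (hz : z ∈ scriDomain s₀)
    (hy : z.1 ∈ sphere (0 : E 3) 1) :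
    ∑ i, dX s₀ i f z * dX s₀ i (gradSq m s₀ f) z = (jetAt m s₀ f z).dXQ := by
  obtain ⟨e1, e2, e3, e4, e5, e6, e7, e8⟩ := jetAt_spec (m := m) hf hk hz hy
  obtain ⟨x, s⟩ := z
  have h1 := hasPD_slice (contDiffOn_gradSq (m := m) hf) hz
  have hp := hasPD_slice (contDiffOn_dS hf) hz
  have hX := fun i => hasPD_slice (contDiffOn_dX hf i) hz
  have h2 := ((hp.const_mul (-2)).sub ((hp.mul hp).const_mul (s ^ 2 - 2 * m * s ^ 3))).sub
    ((HasPD.sum Finset.univ fun i _ => (HasPD.coord (x := x) i).mul (HasPD.coord i)).mul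
      (HasPD.sum Finset.univ fun i _ => (hX i).mul (hX i)))
  have h3 : ∀ i, dX s₀ i (gradSq m s₀ f) (x, s) = _ := fun i =>
    ((h1.eq i).symm.trans (pderiv_congr (Eventually.of_forall fun x => by
      simp only [gradSq, sq (dS s₀ f _)]) i)).trans (h2.eq i)
  have h4 : ∑ i, x i * dX s₀ i f (x, s) = 0 := by simpa using sum_mul_dX hf hk hz
  simp only [h3]
  rw [ScriJet.dXQ, ScriJet.w, ScriJet.q, ScriJet.HT, e1, e2, e3, e5, e6, e7, e8, sum_sq_eq_norm_sq,
    mem_sphere_zero_iff_norm.1 hy]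
  simp only [dotProduct, Matrix.mulVec, Matrix.add_apply, Matrix.vecMulVec_apply, Matrix.of_apply,
    Fin.sum_univ_three] at h4 ⊢
  simp
  generalize dX s₀ 0 f (x, s) = X0 at *
  generalize dX s₀ 1 f (x, s) = X1 at *
  generalize dX s₀ 2 f (x, s) = X2 at *
  linear_combination 2 * (X0 ^ 2 + X1 ^ 2 + X2 ^ 2) * h4

end gradSq

/-- A spacelike graph as in `ScriGraph` whose mean curvature is `1 + s³ φ`, with `φ` smooth up to
null infinity. -/
structure ScriCMC (m s₀ : ℝ) (u : E 3 → ℝ) (P φ : S2 × ℝ → ℝ) : Prop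
    extends ScriGraph m s₀ u P where
  φ_smooth : SmoothUpToScri s₀ φ
  meanCurvature_eq : ∀ y : S2, ∀ s ∈ Ioo 0 s₀,
    meanCurvature m u (s⁻¹ • (y : E 3)) = 1 + s ^ 3 * φ (y, s)

namespace ScriGraph

variable {m s₀ : ℝ} {u : E 3 → ℝ} {P : S2 × ℝ → ℝ}

theorem smooth_ext (h : ScriGraph m s₀ u P) : ContDiffOn ℝ ∞ (rayExt P) (scriDomain s₀) :=
  contDiffOn_rayExt h.smooth

theorem isHomog_ext (_ : ScriGraph m s₀ u P) :
    ∀ s ∈ Ico 0 s₀, IsHomog 0 (fun x => rayExt P (x, s)) := fun s _ => isHomog_rayExt P s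

theorem eventually_spec (h : ScriGraph m s₀ u P) : ∀ᶠ z in scriFilter,
    (jetAt m s₀ (rayExt P) z).m = m ∧ (jetAt m s₀ (rayExt P) z).s = z.2 ∧
    (jetAt m s₀ (rayExt P) z).p₁ = dS s₀ (rayExt P) z ∧
    (jetAt m s₀ (rayExt P) z).p₂ = dS s₀ (dS s₀ (rayExt P)) z ∧
    ((jetAt m s₀ (rayExt P) z).y = fun i => z.1 i) ∧
    ((jetAt m s₀ (rayExt P) z).X = fun i => dX s₀ i (rayExt P) z) ∧
    ((jetAt m s₀ (rayExt P) z).Z = fun i => dX s₀ i (dS s₀ (rayExt P)) z) ∧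
    (jetAt m s₀ (rayExt P) z).H = Matrix.of fun i j => dX s₀ i (dX s₀ j (rayExt P)) z := by
  filter_upwards [eventually_scriFilter_mem h.s₀_pos] with z hz
  exact jetAt_spec h.smooth_ext h.isHomog_ext hz.1 hz.2.1

theorem bddJet (h : ScriGraph m s₀ u P) : BddJet (jetAt m s₀ (rayExt P)) m := by
  have hb : ∀ {f : E 3 × ℝ → ℝ}, ContDiffOn ℝ ∞ f (scriDomain s₀) → ScriBdd f :=
    fun hf => ContDiffOn.scriBdd h.s₀_pos hf
  have hf := h.smooth_ext
  have hs := h.eventually_spec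
  refine ⟨hs.mono fun z hz => hz.1, hs.mono fun z hz => hz.2.1, fun i => ?_, ?_, ?_, fun i => ?_,
    fun i => ?_, fun i j => ?_⟩
  · have : ContDiffOn ℝ ∞ (fun z : E 3 × ℝ => z.1 i) (scriDomain s₀) :=
      ((contDiff_euclidean.1 contDiff_id i).comp contDiff_fst).contDiffOn
    exact (hb this).congr (hs.mono fun z hz => by rw [hz.2.2.2.2.1])
  · exact (hb (contDiffOn_dS hf)).congr (hs.mono fun z hz => hz.2.2.1)
  · exact (hb (contDiffOn_dS (contDiffOn_dS hf))).congr (hs.mono fun z hz => hz.2.2.2.1)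
  · exact (hb (contDiffOn_dX hf i)).congr (hs.mono fun z hz => by rw [hz.2.2.2.2.2.1])
  · exact (hb (contDiffOn_dX (contDiffOn_dS hf) i)).congr
      (hs.mono fun z hz => by rw [hz.2.2.2.2.2.2.1])
  · exact (hb (contDiffOn_dX (contDiffOn_dX hf j) i)).congr
      (hs.mono fun z hz => by rw [hz.2.2.2.2.2.2.2]; rfl)

theorem norm_smul_gt (h : ScriGraph m s₀ u P) {z : E 3 × ℝ} (hy : z.1 ∈ sphere (0 : E 3) 1)
    (hs : z.2 ∈ Ioo 0 s₀) : s₀⁻¹ < ‖z.2⁻¹ • z.1‖ := by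
  rw [norm_smul, mem_sphere_zero_iff_norm.1 hy, mul_one, norm_inv, Real.norm_eq_abs,
    abs_of_pos hs.1]
  exact (inv_lt_inv₀ h.s₀_pos hs.1).2 hs.2

theorem mem_scriDomain {z : E 3 × ℝ} (hy : z.1 ∈ sphere (0 : E 3) 1) (hs : z.2 ∈ Ico 0 s₀) :
    z ∈ scriDomain s₀ := ⟨sphere_ne_zero hy, hs⟩

theorem Q_pos (h : ScriGraph m s₀ u P) {z : E 3 × ℝ} (hy : z.1 ∈ sphere (0 : E 3) 1)
    (hs : z.2 ∈ Ioo 0 s₀) : 0 < (jetAt m s₀ (rayExt P) z).Q := by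
  have hx := h.norm_smul_gt hy hs
  exact (h.matches (mem_scriDomain hy ⟨hs.1.le, hs.2⟩) hy hs.1).Q_pos (h.ne_zero hx)
    (h.lapse_pos hx) (h.spacelike _ hx)

end ScriGraph

namespace ScriCMC

variable {m s₀ : ℝ} {u : E 3 → ℝ} {P φ : S2 × ℝ → ℝ}

/-- The equation for the mean curvature, in terms of the jet of `P`. -/
theorem sqrt_Q_eq (h : ScriCMC m s₀ u P φ) {z : E 3 × ℝ} (hy : z.1 ∈ sphere (0 : E 3) 1)
    (hs : z.2 ∈ Ioo 0 s₀) :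
    3 * (1 + z.2 ^ 3 * rayExt φ z) * Real.sqrt (jetAt m s₀ (rayExt P) z).Q
      = 3 * (jetAt m s₀ (rayExt P) z).w - z.2 * (jetAt m s₀ (rayExt P) z).tr := by
  have hz := ScriGraph.mem_scriDomain (s₀ := s₀) hy ⟨hs.1.le, hs.2⟩
  have h1 := (h.matches hz hy hs.1).meanCurvature_eq h.spacelikeOver (h.norm_smul_gt hy hs)
  have h2 := h.meanCurvature_eq ⟨z.1, hy⟩ z.2 hs
  simp only at h2
  have h3 : rayExt φ z = φ (⟨z.1, hy⟩, z.2) := radialExtension_coe (fun y => φ (y, z.2)) ⟨z.1, hy⟩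
  rw [h2, (jetAt_spec (m := m) h.smooth_ext h.isHomog_ext hz hy).2.1] at h1
  rw [h3, h1]

/-- The equation for the mean curvature, multiplied by `Q`, so that it makes sense up to `s = 0`. -/
theorem Q_mul_sqrt_Q_eq (h : ScriCMC m s₀ u P φ) {z : E 3 × ℝ} (hy : z.1 ∈ sphere (0 : E 3) 1)
    (hs : z.2 ∈ Ioo 0 s₀) :
    let J := jetAt m s₀ (rayExt P) z
    6 * (1 + z.2 ^ 3 * rayExt φ z) * (J.Q * Real.sqrt J.Q) = 6 * J.w * J.Q
      - 2 * z.2 * (J.dq * J.p₁ + J.q * J.p₂ + J.HT.trace) * J.Q + z.2 * (J.w * J.dsQ + J.dXQ) := by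
  intro J
  have hQ := h.Q_pos hy hs
  have h1 := h.sqrt_Q_eq hy hs
  rw [ScriJet.tr_eq hQ.ne'] at h1
  have h2 : 6 * (1 + z.2 ^ 3 * rayExt φ z) * (J.Q * Real.sqrt J.Q)
      = 2 * J.Q * (3 * (1 + z.2 ^ 3 * rayExt φ z) * Real.sqrt J.Q) := by ring
  rw [h2, h1]
  have := hQ.ne'
  simp only [J] at *
  field_simp
  ring

/-- In the limit `s → 0` the equation for the mean curvature, multiplied by `Q`, is `Q √Q = Q`. -/
theorem gradSq_zero_mem (h : ScriCMC m s₀ u P φ) {y : E 3} (hy : y ∈ sphere (0 : E 3) 1) :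
    gradSq m s₀ (rayExt P) (y, 0) ∈ ({0, 1} : Set ℝ) := by
  have hf := h.smooth_ext
  have hb := h.bddJet
  have hφ := ContDiffOn.scriBdd h.s₀_pos (contDiffOn_rayExt h.φ_smooth)
  set J := jetAt m s₀ (rayExt P) with hJ
  set Q₀ := gradSq m s₀ (rayExt P) (y, 0) with hQ₀
  -- the limit of `Q` along the ray
  have hS := tendsto_scriFilter hy
  have hQ : Tendsto (fun s => (J (y, s)).Q) (nhdsWithin 0 (Ioi 0)) (nhds Q₀) := by
    have h1 := taylor_scriO h.s₀_pos (contDiffOn_gradSq (m := m) hf) 1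
    have h2 := (h1.tendsto one_ne_zero).comp hS
    simp only [Function.comp_def, Finset.sum_range_one, pow_zero, Nat.factorial_zero, Nat.cast_one,
      div_one, one_mul, Function.iterate_zero, id] at h2
    have h3 := h2.add_const Q₀
    simp only [zero_add, ← hQ₀, sub_add_cancel] at h3
    refine h3.congr' ?_
    filter_upwards [Ioo_mem_nhdsGT h.s₀_pos] with s hs
    exact gradSq_eq hf h.isHomog_ext (ScriGraph.mem_scriDomain hy ⟨hs.1.le, hs.2⟩) hy
  have hsq := Real.continuous_sqrt.continuousAt.tendsto.comp hQ
  have h0 : Tendsto (fun s : ℝ => s) (nhdsWithin 0 (Ioi 0)) (nhds 0) := nhdsWithin_le_nhds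
  have hB : ∀ {f : E 3 × ℝ → ℝ}, ScriBdd f →
      Tendsto (fun s => s * f (y, s)) (nhdsWithin 0 (Ioi 0)) (nhds 0) := by
    intro f hf
    have : ScriO (fun z => z.2 * f z) 1 := hf.scriO (Eventually.of_forall fun z => by simp)
    exact (this.tendsto one_ne_zero).comp hS
  have b1 := hb.p₁
  have b2 := hb.p₂
  have b3 := hb.X
  have b4 := hb.Z
  have b5 := hb.HT
  have b6 := hb.w
  have b7 := hb.q
  have b8 := hb.dq
  have e1 := hB (f := fun z => z.2 ^ 2 * rayExt φ z) (by fun_prop)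
  have e2 := hB (f := fun z => z.2 * (1 - 2 * m * z.2) * (J z).p₁) (by fun_prop)
  have e3 := hB (f := fun z => (J z).dq * (J z).p₁ + (J z).q * (J z).p₂ + (J z).HT.trace) (by
    simp only [Matrix.trace, Matrix.diag_apply, Fin.sum_univ_three]; fun_prop)
  have e4 := hB (f := fun z => (J z).w * (J z).dsQ + (J z).dXQ) (by
    simp only [ScriJet.dsQ, ScriJet.dXQ, dotProduct, Matrix.mulVec, Fin.sum_univ_three]; fun_prop)
  have l1 := ((e1.const_add 1).const_mul 6).mul (hQ.mul hsq)
  have l2 := ((((e2.const_add 1).const_mul 6).mul hQ).sub ((e3.const_mul 2).mul hQ)).add e4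
  have hpos : 0 ≤ Q₀ := by
    refine ge_of_tendsto hQ ?_
    filter_upwards [Ioo_mem_nhdsGT h.s₀_pos] with s hs using (h.Q_pos (z := (y, s)) hy hs).le
  have heq : 6 * (1 + 0) * (Q₀ * Real.sqrt Q₀) = 6 * (1 + 0) * Q₀ - 2 * 0 * Q₀ + 0 := by
    refine tendsto_nhds_unique (l1.congr' ?_) l2
    filter_upwards [Ioo_mem_nhdsGT h.s₀_pos] with s hs
    have h1 := h.Q_mul_sqrt_Q_eq (z := (y, s)) hy hs
    have h2 := jetAt_spec (m := m) hf h.isHomog_ext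
      (ScriGraph.mem_scriDomain (z := (y, s)) hy ⟨hs.1.le, hs.2⟩) hy
    simp only [← hJ] at h1 h2
    have h3 : (J (y, s)).w = 1 + s * (s * (1 - 2 * m * s) * (J (y, s)).p₁) := by
      rw [ScriJet.w, ScriJet.q, h2.1, h2.2.1]; ring
    rw [← h3]
    simp only [Function.comp_def]
    linear_combination h1
  have h4 : Q₀ * (Real.sqrt Q₀ - 1) = 0 := by linarith
  rcases mul_eq_zero.1 h4 with h5 | h5
  · exact Or.inl h5
  · refine Or.inr ?_
    have h6 := Real.sq_sqrt hpos
    have h7 : Real.sqrt Q₀ = 1 := by linarith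
    rw [h7] at h6
    rw [mem_singleton_iff, ← h6, one_pow]

end ScriCMC

/-- A function on `𝕊² × [0, s₀)` that vanishes for `s = 0` and is positive for `s > 0` has points
with small `s > 0` where its gradient along the sphere vanishes and its derivative in `s` is
nonnegative: the maximum over `𝕊² × [0, s₁]` is attained at such a point. -/
theorem exists_max_point {s₀ s₁ : ℝ} {g : E 3 × ℝ → ℝ} (hg : ContDiffOn ℝ ∞ g (scriDomain s₀))
    (hk : ∀ s ∈ Ico 0 s₀, IsHomog 0 (fun x => g (x, s))) (hs₁ : 0 < s₁) (hs₁s₀ : s₁ < s₀)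
    (h0 : ∀ y ∈ sphere (0 : E 3) 1, g (y, 0) = 0)
    (hpos : ∀ y ∈ sphere (0 : E 3) 1, ∀ s ∈ Ioo 0 s₀, 0 < g (y, s)) :
    ∃ (y : E 3) (s : ℝ), y ∈ sphere (0 : E 3) 1 ∧ 0 < s ∧ s ≤ s₁ ∧
      (∀ i, dX s₀ i g (y, s) = 0) ∧ 0 ≤ dS s₀ g (y, s) := by
  have hO : IsOpen ({0}ᶜ : Set (E 3)) := isOpen_compl_singleton
  have hK : IsCompact (sphere (0 : E 3) 1 ×ˢ Icc 0 s₁) := (isCompact_sphere _ _).prod isCompact_Icc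
  have he : (EuclideanSpace.single 0 1 : E 3) ∈ sphere (0 : E 3) 1 := by simp
  have hKs : sphere (0 : E 3) 1 ×ˢ Icc 0 s₁ ⊆ scriDomain s₀ := fun z hz =>
    ScriGraph.mem_scriDomain hz.1 ⟨hz.2.1, hz.2.2.trans_lt hs₁s₀⟩
  obtain ⟨⟨y, s⟩, hz, hmax⟩ := hK.exists_isMaxOn ⟨(EuclideanSpace.single 0 1, s₁), he, hs₁.le, le_rfl⟩
    (hg.continuousOn.mono hKs)
  have hmax' : ∀ y' ∈ sphere (0 : E 3) 1, ∀ s' ∈ Icc 0 s₁,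
      g (y', s') ≤ g (y, s) :=
    fun y' hy' s' hs' => hmax (show (y', s') ∈ sphere (0 : E 3) 1 ×ˢ Icc 0 s₁ from ⟨hy', hs'⟩)
  have hy : y ∈ sphere (0 : E 3) 1 := hz.1
  have hs : 0 < s := by
    rcases hz.2.1.eq_or_lt with h1 | h1
    · exfalso
      simp only at h1
      have h2 := hmax' _ he s₁ ⟨hs₁.le, le_rfl⟩
      rw [← h1, h0 y hy] at h2
      exact (hpos _ he s₁ ⟨hs₁, hs₁s₀⟩).not_ge h2
    · exact h1
  have hsI : s ∈ Ioo 0 s₀ := ⟨hs, lt_of_le_of_lt hz.2.2 hs₁s₀⟩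
  have hzD : (y, s) ∈ scriDomain s₀ := hKs hz
  -- a maximum on the sphere is a local maximum in `ℝ³` of the extension along rays
  have hX : ∀ i, dX s₀ i g (y, s) = 0 := by
    intro i
    have h1 : IsLocalMax (fun x => g (x, s)) y := by
      filter_upwards [hO.mem_nhds (sphere_ne_zero hy)] with x hx
      have hn : 0 < ‖x‖ := norm_pos_iff.2 hx
      have h2 : ‖x‖⁻¹ • x ∈ sphere (0 : E 3) 1 := by
        rw [mem_sphere_zero_iff_norm, norm_smul, norm_inv, norm_norm, inv_mul_cancel₀ hn.ne']
      have h3 := hk s ⟨hs.le, hsI.2⟩ ‖x‖⁻¹ (inv_pos.2 hn) x hx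
      simp only [zpow_zero, one_mul] at h3
      rw [← h3]
      exact hmax' _ h2 s hz.2
    rw [← (hasPD_slice hg hzD).eq i, pderiv, h1.fderiv_eq_zero]
    rfl
  -- `s = s₁` is possible, hence only difference quotients from the left
  have hS : 0 ≤ dS s₀ g (y, s) := by
    have h1 := ((hasDerivWithinAt_dS hg hzD).hasDerivAt (Ico_mem_nhds hs hsI.2)).hasDerivWithinAt
      (s := Iio s)
    rw [hasDerivWithinAt_iff_tendsto_slope' self_notMem_Iio] at h1
    refine ge_of_tendsto h1 ?_
    filter_upwards [Ioo_mem_nhdsLT hs] with t ht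
    rw [slope_def_field]
    exact div_nonneg_of_nonpos (by linarith [hmax' y hy t ⟨ht.1.le, ht.2.le.trans hz.2.2⟩])
      (by linarith [ht.2])
  exact ⟨y, s, hy, hs, hz.2.2, hX, hS⟩

theorem ScriJet.traceless_symm (J : ScriJet) : J.traceless.transpose = J.traceless := by
  have h1 := HT_symm (J := J)
  ext i j
  have h2 : J.HT j i = J.HT i j := congrFun (congrFun h1 i) j
  simp only [traceless, hess, metric, T, Pr, Matrix.transpose_apply, Matrix.sub_apply,
    Matrix.add_apply, Matrix.smul_apply, smul_eq_mul, Matrix.vecMulVec_apply, h2,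
    Matrix.one_apply, eq_comm (a := j) (b := i)]
  ring

namespace ScriCMC

variable {m s₀ : ℝ} {u : E 3 → ℝ} {P φ : S2 × ℝ → ℝ}

/-- `Q` does not vanish identically at null infinity. Otherwise its maximum over
`𝕊² × [0, s₁]` would be small, and it would be attained at a point with `s > 0`. There the gradient
of `Q` along the sphere vanishes and `∂ₛQ ≥ 0`, so that the equation for the mean curvature gives
`√Q ≥ 1 - O(s₁)`. -/
theorem exists_gradSq_zero_ne (h : ScriCMC m s₀ u P φ) :
    ∃ y ∈ sphere (0 : E 3) 1, gradSq m s₀ (rayExt P) (y, 0) ≠ 0 := by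
  by_contra! h0
  have hf := h.smooth_ext
  have hb := h.bddJet
  have hφ := ContDiffOn.scriBdd h.s₀_pos (contDiffOn_rayExt h.φ_smooth)
  have hg := contDiffOn_gradSq (m := m) hf
  set J := jetAt m s₀ (rayExt P) with hJ
  have hJQ : ∀ᶠ z in scriFilter, gradSq m s₀ (rayExt P) z = (J z).Q :=
    (eventually_scriFilter_mem h.s₀_pos).mono fun z hz => gradSq_eq hf h.isHomog_ext hz.1 hz.2.1
  have hQ : Tendsto (fun z => (J z).Q) scriFilter (nhds 0) := by
    have h1 := (taylor_scriO h.s₀_pos hg 1).tendsto one_ne_zero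
    refine h1.congr' ?_
    filter_upwards [hJQ, eventually_scriFilter_pos] with z hz hz'
    simp [hz, h0 z.1 hz'.1]
  have b1 := hb.p₁
  have b2 := hb.p₂
  have b5 := hb.HT
  have b7 := hb.q
  have b8 := hb.dq
  have hB : ∀ {f : E 3 × ℝ → ℝ}, ScriBdd f → Tendsto (fun z => z.2 * f z) scriFilter (nhds 0) := by
    intro f hf
    have : ScriO (fun z => z.2 * f z) 1 := hf.scriO (Eventually.of_forall fun z => by simp)
    exact this.tendsto one_ne_zero
  have e1 := hB (f := fun z => z.2 ^ 2 * rayExt φ z) (by fun_prop)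
  have e2 := hB (f := fun z => z.2 * (1 - 2 * m * z.2) * (J z).p₁) (by fun_prop)
  have e3 := hB (f := fun z => (J z).dq * (J z).p₁ + (J z).q * (J z).p₂ + (J z).HT.trace) (by
    simp only [Matrix.trace, Matrix.diag_apply, Fin.sum_univ_three]; fun_prop)
  have l1 := ((e1.const_add 1).const_mul 6).mul (Real.continuous_sqrt.continuousAt.tendsto.comp hQ)
  have l2 := ((e2.const_add 1).const_mul 6).sub (e3.const_mul 2)
  have l3 := e2.const_add 1
  simp only [Real.sqrt_zero, mul_zero, add_zero, mul_one, sub_zero] at l1 l2 l3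
  -- the coefficients of `Q` on the two sides of the equation tend to `0` and `6`, and `w` to `1`
  have hev := (l1.eventually (gt_mem_nhds (by norm_num : (0 : ℝ) < 1))).and
    ((l2.eventually (lt_mem_nhds (by norm_num : (1 : ℝ) < 6))).and
      (l3.eventually (lt_mem_nhds (by norm_num : (0 : ℝ) < 1))))
  obtain ⟨δ, hδ, hev⟩ := eventually_scriFilter.1 hev
  -- the maximum of `Q`
  set s₁ := min δ s₀ / 2
  have hs₁ : 0 < s₁ := by have := lt_min hδ h.s₀_pos; simp only [s₁]; linarith
  have hs₁δ : s₁ < δ := by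
    have := min_le_left δ s₀; have := lt_min hδ h.s₀_pos; simp only [s₁]; linarith
  have hs₁s₀ : s₁ < s₀ := by
    have := min_le_right δ s₀; have := lt_min hδ h.s₀_pos; simp only [s₁]; linarith
  obtain ⟨y, s, hy, hs, hss₁, hX, hS⟩ := exists_max_point hg (isHomog_gradSq hf h.isHomog_ext) hs₁
    hs₁s₀ h0 fun y hy s hs => by
      rw [gradSq_eq (z := (y, s)) hf h.isHomog_ext
        (ScriGraph.mem_scriDomain (z := (y, s)) hy ⟨hs.1.le, hs.2⟩) hy]
      exact h.Q_pos (z := (y, s)) hy hs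
  have hsI : s ∈ Ioo 0 s₀ := ⟨hs, lt_of_le_of_lt hss₁ hs₁s₀⟩
  have hzD : (y, s) ∈ scriDomain s₀ :=
    ScriGraph.mem_scriDomain (z := (y, s)) hy ⟨hs.le, hsI.2⟩
  have hJz := jetAt_spec (m := m) hf h.isHomog_ext hzD hy
  have hdX : (J (y, s)).dXQ = 0 := by
    rw [hJ, ← sum_mul_dX_gradSq hf h.isHomog_ext hzD hy]
    exact Finset.sum_eq_zero fun i _ => by rw [hX i, mul_zero]
  rw [dS_gradSq hf h.isHomog_ext hzD hy, ← hJ] at hS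
  have heq := h.Q_mul_sqrt_Q_eq (z := (y, s)) hy hsI
  have hQp := h.Q_pos (z := (y, s)) hy hsI
  obtain ⟨c1, c2, c3⟩ := hev y hy s ⟨hs, lt_of_le_of_lt hss₁ hs₁δ⟩
  simp only [← hJ, Function.comp_def] at heq hJz hQp c1 c2 c3
  have hw : (J (y, s)).w = 1 + s * (s * (1 - 2 * m * s) * (J (y, s)).p₁) := by
    rw [ScriJet.w, ScriJet.q, hJz.1, hJz.2.1]; ring
  rw [← hw] at c2 c3
  rw [hdX] at heq
  -- at the maximum this gives `Q > 6 Q`, up to terms of a favourable sign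
  have k1 := mul_lt_mul_of_pos_right c1 hQp
  have k2 := mul_lt_mul_of_pos_right c2 hQp
  have k3 := mul_nonneg hs.le (mul_nonneg c3.le hS)
  nlinarith

/-- `Q = 1` at null infinity: `Q` takes values in `{0, 1}` there, the sphere is connected, and `Q` is
not identically zero. -/
theorem gradSq_zero_eq_one (h : ScriCMC m s₀ u P φ) {y : E 3} (hy : y ∈ sphere (0 : E 3) 1) :
    gradSq m s₀ (rayExt P) (y, 0) = 1 := by
  have hc : ContinuousOn (fun y => gradSq m s₀ (rayExt P) (y, 0)) (sphere (0 : E 3) 1) :=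
    (contDiffOn_slice (contDiffOn_gradSq h.smooth_ext) ⟨le_rfl, h.s₀_pos⟩).continuousOn.mono
      fun y hy => sphere_ne_zero hy
  obtain ⟨c, hc, hE⟩ := (isPreconnected_sphere one_lt_rank_space (0 : E 3) 1).eqOn_const_of_mapsTo
    (toFinite ({0, 1} : Set ℝ)).isDiscrete hc (fun y hy => h.gradSq_zero_mem hy) ⟨0, by simp⟩
  obtain ⟨y', hy', h'⟩ := h.exists_gradSq_zero_ne
  have h1 := hE hy
  have h2 := hE hy'
  simp only [Function.const_apply] at h1 h2
  rw [h1]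
  rcases hc with hc | hc
  · rw [h2, hc] at h'; exact absurd rfl h'
  · exact hc

theorem scriO_Q_sub_one (h : ScriCMC m s₀ u P φ) :
    ScriO (fun z => (jetAt m s₀ (rayExt P) z).Q - 1) 1 := by
  refine (taylor_scriO h.s₀_pos (contDiffOn_gradSq (m := m) h.smooth_ext) 1).congr ?_
  filter_upwards [eventually_scriFilter_mem h.s₀_pos] with z hz
  rw [← gradSq_eq h.smooth_ext h.isHomog_ext hz.1 hz.2.1]
  simp [h.gradSq_zero_eq_one hz.2.1]

theorem half_le_Q (h : ScriCMC m s₀ u P φ) :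
    ∀ᶠ z in scriFilter, 1 / 2 ≤ (jetAt m s₀ (rayExt P) z).Q := by
  filter_upwards [(h.scriO_Q_sub_one.tendsto one_ne_zero).eventually
    (lt_mem_nhds (by norm_num : -(1 / 2 : ℝ) < 0))] with z hz
  linarith

theorem tracelessNorm_eq (h : ScriCMC m s₀ u P φ) {z : E 3 × ℝ} (hy : z.1 ∈ sphere (0 : E 3) 1)
    (hs : z.2 ∈ Ioo 0 s₀) :
    let J := jetAt m s₀ (rayExt P) z
    tracelessNorm m u (z.2⁻¹ • z.1)
      = z.2 * (Real.sqrt J.Q)⁻¹ * Real.sqrt (J.inv * J.traceless * (J.inv * J.traceless)).trace := by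
  intro J
  have hz := ScriGraph.mem_scriDomain (s₀ := s₀) hy ⟨hs.1.le, hs.2⟩
  have hJz := jetAt_spec (m := m) h.smooth_ext h.isHomog_ext hz hy
  have hQ := h.Q_pos hy hs
  rw [tracelessNorm_eq_sqrt_trace h.spacelikeOver (h.norm_smul_gt hy hs),
    (h.matches hz hy hs.1).trace_traceless_sq h.spacelikeOver (h.norm_smul_gt hy hs),
    Real.sqrt_mul (by positivity), Real.sqrt_div (by positivity), hJz.2.1, Real.sqrt_sq hs.1.le,
    div_eq_mul_inv]

theorem traceless_bound (h : ScriCMC m s₀ u P φ) {z : E 3 × ℝ} (hy : z.1 ∈ sphere (0 : E 3) 1)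
    (hs : z.2 ∈ Ioo 0 s₀) :
    let J := jetAt m s₀ (rayExt P) z
    ∀ i j, |J.traceless i j| ≤ 9 * J.metric.trace
      * Real.sqrt (J.inv * J.traceless * (J.inv * J.traceless)).trace := by
  intro J
  have hx := h.norm_smul_gt hy hs
  have hQ := h.Q_pos hy hs
  have h1 := (h.matches (ScriGraph.mem_scriDomain hy ⟨hs.1.le, hs.2⟩) hy hs.1).metric_posDef
    (h.ne_zero hx) (h.lapse_pos hx) (h.spacelike _ hx)
  rw [← ScriJet.metric_inv hQ.ne']
  exact (abs_apply_le_of_posDef h1 J.traceless_symm).2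

/-- The norm of the traceless second fundamental form is of the order of `s` times the components
of the traceless part of the Hessian. -/
theorem isBigOScri_tracelessNorm_iff (h : ScriCMC m s₀ u P φ) (k : ℕ) :
    IsBigOScri (tracelessNorm m u) (k + 1) ↔
      ∀ i j, ScriO (fun z => (jetAt m s₀ (rayExt P) z).traceless i j) k := by
  have hb := h.bddJet
  have hQ := h.half_le_Q
  rw [isBigOScri_iff]
  constructor
  -- the metric is bounded, so that the components are bounded by the norm
  · intro hN i j
    obtain ⟨r, hr, hN⟩ := hN.exists_bdd
    have b1 := hb.p₁
    have b2 := hb.X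
    have b3 := hb.q
    have b4 := hb.metric
    have hR : ScriBdd fun z => 9 * (jetAt m s₀ (rayExt P) z).metric.trace
        * (((jetAt m s₀ (rayExt P) z).Q + 1) * |r z|) := by
      have hr' : ScriBdd fun z => |r z| := by
        exact (isBigO_abs_left.2 (scriBdd_iff_isBigO.1 hr)) |> scriBdd_iff_isBigO.2
      simp only [Matrix.trace, Matrix.diag_apply, Fin.sum_univ_three, ScriJet.Q, dotProduct]
      fun_prop
    have hR' : ScriO (fun z => z.2 ^ k * (9 * (jetAt m s₀ (rayExt P) z).metric.trace
        * (((jetAt m s₀ (rayExt P) z).Q + 1) * |r z|))) k :=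
      hR.scriO (Eventually.of_forall fun _ => rfl)
    refine IsBigO.trans (IsBigO.of_bound 1 ?_) hR'
    filter_upwards [eventually_scriFilter_mem h.s₀_pos, hN] with z hz hN
    have hz' : z.2 ∈ Ioo 0 s₀ := hz.2.2
    have h1 := h.traceless_bound hz.2.1 hz' i j
    have h2 := h.tracelessNorm_eq hz.2.1 hz'
    have hQ := h.Q_pos hz.2.1 hz'
    have hx := h.norm_smul_gt hz.2.1 hz'
    have h5 := (h.matches hz.1 hz.2.1 hz.2.2.1).metric_posDef
      (h.ne_zero hx) (h.lapse_pos hx) (h.spacelike _ hx)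
    simp only at h1 h2 hN
    set J := jetAt m s₀ (rayExt P) z
    set N := Real.sqrt (J.inv * J.traceless * (J.inv * J.traceless)).trace
    have h3 : N = z.2 ^ k * (Real.sqrt J.Q * r z) := by
      have hsq := (Real.sqrt_pos.2 hQ).ne'
      have := hz'.1.ne'
      rw [h2, pow_succ] at hN
      field_simp at hN
      linear_combination hN
    have h4 : N ≤ z.2 ^ k * ((J.Q + 1) * |r z|) := by
      rw [h3]
      refine mul_le_mul_of_nonneg_left ?_ (pow_nonneg hz'.1.le k)
      have h6 : Real.sqrt J.Q ≤ J.Q + 1 := by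
        nlinarith [Real.sq_sqrt hQ.le, sq_nonneg (Real.sqrt J.Q - 1), Real.sqrt_nonneg J.Q]
      calc Real.sqrt J.Q * r z ≤ Real.sqrt J.Q * |r z| :=
            mul_le_mul_of_nonneg_left (le_abs_self _) (Real.sqrt_nonneg _)
        _ ≤ _ := mul_le_mul_of_nonneg_right h6 (abs_nonneg _)
    have h7 : 0 ≤ J.metric.trace := h5.posSemidef.trace_nonneg
    rw [one_mul, Real.norm_eq_abs, Real.norm_eq_abs]
    refine h1.trans (le_trans ?_ (le_abs_self _))
    calc 9 * J.metric.trace * N ≤ 9 * J.metric.trace * (z.2 ^ k * ((J.Q + 1) * |r z|)) :=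
          mul_le_mul_of_nonneg_left h4 (mul_nonneg (by norm_num) h7)
      _ = _ := by ring
  -- the inverse of the metric is bounded, since `Q ≥ 1 / 2`
  · intro ht
    choose r hr hrt using fun i j => (ht i j).exists_bdd
    have b1 := hb.inv hQ
    let F : E 3 × ℝ → ℝ := fun z =>
      ((jetAt m s₀ (rayExt P) z).inv * Matrix.of (fun i j => r i j z)
        * ((jetAt m s₀ (rayExt P) z).inv * Matrix.of (fun i j => r i j z))).trace
    have hF : ScriBdd F := by
      simp only [F, Matrix.trace, Matrix.diag_apply, Fin.sum_univ_three, Matrix.mul_apply,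
        Matrix.of_apply]
      fun_prop
    have hR : ScriBdd fun z => (|F z| + 1) * 2 := by
      have hr' : ScriBdd fun z => |F z| :=
        scriBdd_iff_isBigO.2 (isBigO_abs_left.2 (scriBdd_iff_isBigO.1 hF))
      fun_prop
    have hR' : ScriO (fun z => z.2 ^ (k + 1) * ((|F z| + 1) * 2)) (k + 1) :=
      hR.scriO (Eventually.of_forall fun _ => rfl)
    refine IsBigO.trans (IsBigO.of_bound 1 ?_) hR'
    filter_upwards [eventually_scriFilter_mem h.s₀_pos, hQ, eventually_all.2 fun i =>
      eventually_all.2 fun j => hrt i j] with z hz hQ hrt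
    have hz' : z.2 ∈ Ioo 0 s₀ := hz.2.2
    have h2 := h.tracelessNorm_eq hz.2.1 hz'
    simp only [F] at h2 ⊢
    set J := jetAt m s₀ (rayExt P) z
    have h3 : J.traceless = z.2 ^ k • Matrix.of (fun i j => r i j z) := by
      ext i j; rw [hrt i j]; rfl
    have h4 : Real.sqrt (J.inv * J.traceless * (J.inv * J.traceless)).trace
        = z.2 ^ k * Real.sqrt (F z) := by
      rw [h3, Matrix.mul_smul, Matrix.smul_mul, Matrix.mul_smul, smul_smul, Matrix.trace_smul,
        smul_eq_mul, Real.sqrt_mul (mul_self_nonneg _), ← sq,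
        Real.sqrt_sq (pow_nonneg hz'.1.le k)]
    rw [h4] at h2
    change _ ≤ 1 * ‖z.2 ^ (k + 1) * ((|F z| + 1) * 2)‖
    rw [h2, one_mul, Real.norm_eq_abs, Real.norm_eq_abs, abs_of_nonneg, abs_of_nonneg]
    · have h5 : Real.sqrt (F z) ≤ |F z| + 1 := by
        refine (Real.sqrt_le_sqrt (le_abs_self _)).trans ?_
        nlinarith [Real.sq_sqrt (abs_nonneg (F z)), sq_nonneg (Real.sqrt |F z| - 1),
          Real.sqrt_nonneg |F z|]
      have h6 : (Real.sqrt J.Q)⁻¹ ≤ 2 := by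
        have h7 : 1 / 2 ≤ Real.sqrt J.Q := by
          refine Real.le_sqrt_of_sq_le ?_; linarith
        rw [inv_le_comm₀ (by linarith) (by norm_num)]
        linarith
      have h8 : (Real.sqrt J.Q)⁻¹ * Real.sqrt (F z) ≤ 2 * (|F z| + 1) :=
        mul_le_mul h6 h5 (Real.sqrt_nonneg _) (by norm_num)
      have h9 := mul_le_mul_of_nonneg_left h8 (pow_nonneg hz'.1.le (k + 1))
      calc _ = z.2 ^ (k + 1) * ((Real.sqrt J.Q)⁻¹ * Real.sqrt (F z)) := by ring
        _ ≤ _ := h9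
        _ = _ := by ring
    · have := hz'.1.le; positivity
    · have := hz'.1.le; positivity

theorem isBigOScri_tracelessNorm_one (h : ScriCMC m s₀ u P φ) :
    IsBigOScri (tracelessNorm m u) 1 :=
  (h.isBigOScri_tracelessNorm_iff 0).2 fun i j => h.bddJet.traceless h.half_le_Q i j

end ScriCMC

/-! ### Expansions at null infinity -/

/-- `f = a + s b + s² c + O(s³)`, where `a`, `b`, `c` are bounded. For the coefficients to be
determined by `f` they have to be functions of `y` alone, which is not required here. -/
structure ScriExp (f a b c : E 3 × ℝ → ℝ) : Prop where
  bdd₀ : ScriBdd a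
  bdd₁ : ScriBdd b
  bdd₂ : ScriBdd c
  rem : ScriO (fun z => f z - (a z + z.2 * b z + z.2 ^ 2 * c z)) 3

namespace ScriExp

variable {f g a b c a' b' c' : E 3 × ℝ → ℝ}

theorem of_eq (h₀ : ScriBdd a) (h₁ : ScriBdd b) (h₂ : ScriBdd c) {r : E 3 × ℝ → ℝ} (hr : ScriBdd r)
    (h : ∀ᶠ z in scriFilter, f z = a z + z.2 * b z + z.2 ^ 2 * c z + z.2 ^ 3 * r z) :
    ScriExp f a b c :=
  ⟨h₀, h₁, h₂, hr.scriO (h.mono fun z hz => by rw [hz]; ring)⟩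

theorem exists_rem (h : ScriExp f a b c) : ∃ r, ScriBdd r ∧
    ∀ᶠ z in scriFilter, f z = a z + z.2 * b z + z.2 ^ 2 * c z + z.2 ^ 3 * r z := by
  obtain ⟨r, hr, h1⟩ := h.rem.exists_bdd
  exact ⟨r, hr, h1.mono fun z hz => by linarith⟩

theorem bdd (h : ScriExp f a b c) : ScriBdd f := by
  obtain ⟨r, hr, h1⟩ := h.exists_rem
  have h2 := h.bdd₀
  have h3 := h.bdd₁
  have h4 := h.bdd₂
  exact ScriBdd.congr (by fun_prop) h1

theorem congr (h : ScriExp f a b c) (e : ∀ᶠ z in scriFilter, g z = f z) : ScriExp g a b c :=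
  ⟨h.bdd₀, h.bdd₁, h.bdd₂, h.rem.congr (e.mono fun z hz => by rw [hz])⟩

theorem congr_coeff (h : ScriExp f a b c)
    (e : ∀ᶠ z in scriFilter, a' z = a z ∧ b' z = b z ∧ c' z = c z) : ScriExp f a' b' c' :=
  ⟨h.bdd₀.congr (e.mono fun _ hz => hz.1), h.bdd₁.congr (e.mono fun _ hz => hz.2.1),
    h.bdd₂.congr (e.mono fun _ hz => hz.2.2),
    h.rem.congr (e.mono fun z hz => by rw [hz.1, hz.2.1, hz.2.2])⟩

theorem of_bdd (h : ScriBdd a) : ScriExp a a (fun _ => 0) fun _ => 0 :=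
  of_eq h (.const 0) (.const 0) (.const 0) (Eventually.of_forall fun z => by ring)

theorem const (x : ℝ) : ScriExp (fun _ => x) (fun _ => x) (fun _ => 0) fun _ => 0 :=
  of_bdd (.const x)

theorem snd : ScriExp (fun z => z.2) (fun _ => 0) (fun _ => 1) fun _ => 0 :=
  of_eq (.const 0) (.const 1) (.const 0) (.const 0) (Eventually.of_forall fun z => by ring)

theorem snd_sq : ScriExp (fun z => z.2 ^ 2) (fun _ => 0) (fun _ => 0) fun _ => 1 :=
  of_eq (.const 0) (.const 0) (.const 1) (.const 0) (Eventually.of_forall fun z => by ring)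

theorem of_scriO_one (h : ScriO f 1) : ∃ r, ScriExp f (fun _ => 0) r fun _ => 0 := by
  obtain ⟨r, hr, h1⟩ := h.exists_bdd
  exact ⟨r, of_eq (.const 0) hr (.const 0) (.const 0) (h1.mono fun z hz => by rw [hz]; ring)⟩

theorem of_scriO_two (h : ScriO f 2) : ∃ r, ScriExp f (fun _ => 0) (fun _ => 0) r := by
  obtain ⟨r, hr, h1⟩ := h.exists_bdd
  exact ⟨r, of_eq (.const 0) (.const 0) hr (.const 0) (h1.mono fun z hz => by rw [hz]; ring)⟩

theorem add (hf : ScriExp f a b c) (hg : ScriExp g a' b' c') :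
    ScriExp (fun z => f z + g z) (fun z => a z + a' z) (fun z => b z + b' z)
      fun z => c z + c' z :=
  ⟨hf.bdd₀.add hg.bdd₀, hf.bdd₁.add hg.bdd₁, hf.bdd₂.add hg.bdd₂,
    (hf.rem.add hg.rem).congr (Eventually.of_forall fun z => by ring)⟩

theorem sub (hf : ScriExp f a b c) (hg : ScriExp g a' b' c') :
    ScriExp (fun z => f z - g z) (fun z => a z - a' z) (fun z => b z - b' z)
      fun z => c z - c' z :=
  ⟨hf.bdd₀.sub hg.bdd₀, hf.bdd₁.sub hg.bdd₁, hf.bdd₂.sub hg.bdd₂,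
    (hf.rem.sub hg.rem).congr (Eventually.of_forall fun z => by ring)⟩

theorem mul (hf : ScriExp f a b c) (hg : ScriExp g a' b' c') :
    ScriExp (fun z => f z * g z) (fun z => a z * a' z) (fun z => a z * b' z + b z * a' z)
      fun z => a z * c' z + b z * b' z + c z * a' z := by
  obtain ⟨r, hr, hf'⟩ := hf.exists_rem
  obtain ⟨r', hr', hg'⟩ := hg.exists_rem
  have := hf.bdd₀
  have := hf.bdd₁
  have := hf.bdd₂
  have := hg.bdd₀
  have := hg.bdd₁
  have := hg.bdd₂
  refine of_eq (by fun_prop) (by fun_prop) (by fun_prop)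
    (r := fun z => b z * c' z + c z * b' z + z.2 * (c z * c' z)
      + r z * (a' z + z.2 * b' z + z.2 ^ 2 * c' z) + (a z + z.2 * b z + z.2 ^ 2 * c z) * r' z
      + z.2 ^ 3 * (r z * r' z)) (by fun_prop) ?_
  filter_upwards [hf', hg'] with z h1 h2
  rw [h1, h2]
  ring

theorem const_mul (x : ℝ) (hf : ScriExp f a b c) :
    ScriExp (fun z => x * f z) (fun z => x * a z) (fun z => x * b z) fun z => x * c z :=
  ((const x).mul hf).congr_coeff (Eventually.of_forall fun z => by simp)

theorem scriO_three (h : ScriExp f a b c)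
    (e : ∀ᶠ z in scriFilter, a z = 0 ∧ b z = 0 ∧ c z = 0) : ScriO f 3 :=
  h.rem.congr (e.mono fun z hz => by rw [hz.1, hz.2.1, hz.2.2]; ring)

theorem scriO_two (h : ScriExp f a b c) (e : ∀ᶠ z in scriFilter, a z = 0 ∧ b z = 0) :
    ScriO f 2 := by
  obtain ⟨r, hr, h1⟩ := h.exists_rem
  have := h.bdd₂
  refine (show ScriBdd fun z => c z + z.2 * r z by fun_prop).scriO ?_
  filter_upwards [h1, e] with z hz he
  rw [hz, he.1, he.2]; ring

theorem scriO_one (h : ScriExp f a b c) (e : ∀ᶠ z in scriFilter, a z = 0) : ScriO f 1 := by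
  obtain ⟨r, hr, h1⟩ := h.exists_rem
  have := h.bdd₁
  have := h.bdd₂
  refine (show ScriBdd fun z => b z + z.2 * c z + z.2 ^ 2 * r z by fun_prop).scriO ?_
  filter_upwards [h1, e] with z hz he
  rw [hz, he]; ring

theorem zero_of_scriO_one (h : ScriExp f a b c) (hf : ScriO f 1) {a₀ : E 3 → ℝ}
    (e : ∀ᶠ z in scriFilter, a z = a₀ z.1) {y : E 3} (hy : y ∈ sphere (0 : E 3) 1) : a₀ y = 0 := by
  have h1 := hf.sub ((h.sub (of_bdd h.bdd₀)).scriO_one (Eventually.of_forall fun z => sub_self _))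
  exact eq_zero_of_scriO (k := 0) (h1.congr (e.mono fun z hz => by rw [← hz]; simp)) hy

theorem zero_of_scriO_two (h : ScriExp f a b c) (hf : ScriO f 2)
    (ha : ∀ᶠ z in scriFilter, a z = 0) {b₀ : E 3 → ℝ}
    (e : ∀ᶠ z in scriFilter, b z = b₀ z.1) {y : E 3} (hy : y ∈ sphere (0 : E 3) 1) : b₀ y = 0 := by
  have h1 := hf.sub ((h.sub (snd.mul (of_bdd h.bdd₁))).scriO_two
    (ha.mono fun z hz => by simp [hz]))
  exact eq_zero_of_scriO (k := 1) (h1.congr (e.mono fun z hz => by rw [← hz]; ring)) hy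

theorem zero_of_scriO_three (h : ScriExp f a b c) (hf : ScriO f 3)
    (hab : ∀ᶠ z in scriFilter, a z = 0 ∧ b z = 0) {c₀ : E 3 → ℝ}
    (e : ∀ᶠ z in scriFilter, c z = c₀ z.1) {y : E 3} (hy : y ∈ sphere (0 : E 3) 1) : c₀ y = 0 := by
  have h1 := hf.sub ((h.sub (snd_sq.mul (of_bdd h.bdd₂))).scriO_three
    (hab.mono fun z hz => by simp [hz.1, hz.2]))
  exact eq_zero_of_scriO (k := 2) (h1.congr (e.mono fun z hz => by rw [← hz]; ring)) hy

end ScriExp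

/-! ### The Taylor coefficients of `P` -/

section Coefficients

variable {s₀ : ℝ} {f : E 3 × ℝ → ℝ}

theorem contDiffOn_iterate_dS (hf : ContDiffOn ℝ ∞ f (scriDomain s₀)) (j : ℕ) :
    ContDiffOn ℝ ∞ ((dS s₀)^[j] f) (scriDomain s₀) := by
  induction j with
  | zero => exact hf
  | succ j ih => rw [Function.iterate_succ_apply']; exact contDiffOn_dS ih

theorem isHomog_iterate_dS (hf : ContDiffOn ℝ ∞ f (scriDomain s₀)) {k : ℤ}
    (hk : ∀ s ∈ Ico 0 s₀, IsHomog k (fun x => f (x, s))) (j : ℕ) :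
    ∀ s ∈ Ico 0 s₀, IsHomog k (fun x => (dS s₀)^[j] f (x, s)) := by
  induction j with
  | zero => exact hk
  | succ j ih =>
    rw [Function.iterate_succ_apply']; exact isHomog_dS (contDiffOn_iterate_dS hf j) ih

theorem iterate_dS_dX (hf : ContDiffOn ℝ ∞ f (scriDomain s₀)) (i : Fin 3) (j : ℕ) :
    EqOn ((dS s₀)^[j] (dX s₀ i f)) (dX s₀ i ((dS s₀)^[j] f)) (scriDomain s₀) := by
  induction j with
  | zero => exact fun z _ => rfl
  | succ j ih =>
    intro z hz
    rw [Function.iterate_succ_apply', Function.iterate_succ_apply', dS_congr ih hz,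
      dX_dS_comm (contDiffOn_iterate_dS hf j) hz]

theorem iterate_dS_congr {g : E 3 × ℝ → ℝ} (h : EqOn f g (scriDomain s₀)) (j : ℕ) :
    EqOn ((dS s₀)^[j] f) ((dS s₀)^[j] g) (scriDomain s₀) := by
  induction j with
  | zero => exact h
  | succ j ih =>
    rw [Function.iterate_succ_apply', Function.iterate_succ_apply']; exact dS_congr ih

end Coefficients

/-- The Taylor coefficient `∂ₛʲP(·, 0)`, constant along rays. -/
noncomputable def scriCoeff (s₀ : ℝ) (P : S2 × ℝ → ℝ) (j : ℕ) (x : E 3) : ℝ :=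
  (dS s₀)^[j] (rayExt P) (x, 0)

namespace ScriGraph

variable {m s₀ : ℝ} {u : E 3 → ℝ} {P : S2 × ℝ → ℝ}

theorem contDiffOn_scriCoeff (h : ScriGraph m s₀ u P) (j : ℕ) :
    ContDiffOn ℝ ∞ (scriCoeff s₀ P j) {0}ᶜ :=
  contDiffOn_slice (contDiffOn_iterate_dS h.smooth_ext j) ⟨le_rfl, h.s₀_pos⟩

theorem isHomog_scriCoeff (h : ScriGraph m s₀ u P) (j : ℕ) : IsHomog 0 (scriCoeff s₀ P j) :=
  isHomog_iterate_dS h.smooth_ext h.isHomog_ext j 0 ⟨le_rfl, h.s₀_pos⟩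

theorem mem_zero (h : ScriGraph m s₀ u P) {x : E 3} (hx : x ≠ 0) : (x, (0 : ℝ)) ∈ scriDomain s₀ :=
  ⟨hx, le_rfl, h.s₀_pos⟩

theorem pderiv_scriCoeff (h : ScriGraph m s₀ u P) (j : ℕ) {x : E 3} (hx : x ≠ 0) (i : Fin 3) :
    pderiv i (scriCoeff s₀ P j) x = (dS s₀)^[j] (dX s₀ i (rayExt P)) (x, 0) := by
  rw [iterate_dS_dX h.smooth_ext i j (h.mem_zero hx)]
  exact (hasPD_slice (contDiffOn_iterate_dS h.smooth_ext j) (h.mem_zero hx)).eq i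

theorem pderiv_pderiv_scriCoeff (h : ScriGraph m s₀ u P) (j : ℕ) {x : E 3} (hx : x ≠ 0)
    (i k : Fin 3) : pderiv i (pderiv k (scriCoeff s₀ P j)) x
      = (dS s₀)^[j] (dX s₀ i (dX s₀ k (rayExt P))) (x, 0) := by
  have hO : IsOpen ({0}ᶜ : Set (E 3)) := isOpen_compl_singleton
  have h1 : pderiv k (scriCoeff s₀ P j)
      =ᶠ[nhds x] fun x => (dS s₀)^[j] (dX s₀ k (rayExt P)) (x, 0) := by
    filter_upwards [hO.mem_nhds hx] with x hx using h.pderiv_scriCoeff j hx k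
  have hk := contDiffOn_dX h.smooth_ext k
  rw [pderiv_congr h1, iterate_dS_dX hk i j (h.mem_zero hx)]
  exact (hasPD_slice (contDiffOn_iterate_dS hk j) (h.mem_zero hx)).eq i

/-- The Taylor expansion of a smooth function up to null infinity. -/
theorem scriExp_of_contDiffOn (h : ScriGraph m s₀ u P) {f : E 3 × ℝ → ℝ}
    (hf : ContDiffOn ℝ ∞ f (scriDomain s₀)) :
    ScriExp f (fun z => f (z.1, 0)) (fun z => dS s₀ f (z.1, 0))
      fun z => 1 / 2 * dS s₀ (dS s₀ f) (z.1, 0) := by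
  have hb : ∀ {f : E 3 × ℝ → ℝ}, ContDiffOn ℝ ∞ f (scriDomain s₀) →
      ScriBdd fun z => f (z.1, 0) := by
    intro f hf
    have h1 : ContDiffOn ℝ ∞ (fun z : E 3 × ℝ => f (z.1, 0)) (scriDomain s₀) :=
      hf.comp (contDiff_fst.prodMk contDiff_const).contDiffOn fun z hz => h.mem_zero hz.1
    exact ContDiffOn.scriBdd h.s₀_pos h1
  refine ⟨hb hf, hb (contDiffOn_dS hf), (ScriBdd.const _).mul (hb (contDiffOn_dS (contDiffOn_dS hf))),
    (taylor_scriO h.s₀_pos hf 3).congr (Eventually.of_forall fun z => ?_)⟩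
  simp [Finset.sum_range_succ, Nat.factorial]
  ring

theorem scriExp_p₁ (h : ScriGraph m s₀ u P) : ScriExp (fun z => (jetAt m s₀ (rayExt P) z).p₁)
    (fun z => scriCoeff s₀ P 1 z.1) (fun z => scriCoeff s₀ P 2 z.1)
    fun z => 1 / 2 * scriCoeff s₀ P 3 z.1 :=
  (h.scriExp_of_contDiffOn (contDiffOn_dS h.smooth_ext)).congr
    (h.eventually_spec.mono fun _ hz => hz.2.2.1)

theorem scriExp_p₂ (h : ScriGraph m s₀ u P) : ScriExp (fun z => (jetAt m s₀ (rayExt P) z).p₂)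
    (fun z => scriCoeff s₀ P 2 z.1) (fun z => scriCoeff s₀ P 3 z.1)
    fun z => 1 / 2 * scriCoeff s₀ P 4 z.1 :=
  (h.scriExp_of_contDiffOn (contDiffOn_dS (contDiffOn_dS h.smooth_ext))).congr
    (h.eventually_spec.mono fun _ hz => hz.2.2.2.1)

theorem scriExp_X (h : ScriGraph m s₀ u P) (i : Fin 3) :
    ScriExp (fun z => (jetAt m s₀ (rayExt P) z).X i)
    (fun z => pderiv i (scriCoeff s₀ P 0) z.1) (fun z => pderiv i (scriCoeff s₀ P 1) z.1)
    fun z => 1 / 2 * pderiv i (scriCoeff s₀ P 2) z.1 := by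
  refine ((h.scriExp_of_contDiffOn (contDiffOn_dX h.smooth_ext i)).congr
    (h.eventually_spec.mono fun z hz => by rw [hz.2.2.2.2.2.1])).congr_coeff ?_
  filter_upwards [eventually_scriFilter_pos] with z hz
  have h1 := fun j => h.pderiv_scriCoeff j (sphere_ne_zero hz.1) i
  exact ⟨h1 0, h1 1, by rw [h1 2]; rfl⟩

theorem scriExp_Z (h : ScriGraph m s₀ u P) (i : Fin 3) :
    ScriExp (fun z => (jetAt m s₀ (rayExt P) z).Z i)
    (fun z => pderiv i (scriCoeff s₀ P 1) z.1) (fun z => pderiv i (scriCoeff s₀ P 2) z.1)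
    fun z => 1 / 2 * pderiv i (scriCoeff s₀ P 3) z.1 := by
  refine ((h.scriExp_of_contDiffOn (contDiffOn_dX (contDiffOn_dS h.smooth_ext) i)).congr
    (h.eventually_spec.mono fun z hz => by rw [hz.2.2.2.2.2.2.1])).congr_coeff ?_
  filter_upwards [eventually_scriFilter_pos] with z hz
  have h0 := sphere_ne_zero hz.1
  have h2 : EqOn (dX s₀ i (dS s₀ (rayExt P))) (dS s₀ (dX s₀ i (rayExt P))) (scriDomain s₀) :=
    fun z hz => dX_dS_comm h.smooth_ext hz i
  have h1 : ∀ j, pderiv i (scriCoeff s₀ P (j + 1)) z.1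
      = (dS s₀)^[j] (dX s₀ i (dS s₀ (rayExt P))) (z.1, 0) := fun j => by
    rw [h.pderiv_scriCoeff (j + 1) h0 i, Function.iterate_succ_apply]
    exact (iterate_dS_congr h2 j (h.mem_zero h0)).symm
  exact ⟨h1 0, h1 1, by rw [h1 2]; rfl⟩

theorem scriExp_H (h : ScriGraph m s₀ u P) (i k : Fin 3) :
    ScriExp (fun z => (jetAt m s₀ (rayExt P) z).H i k)
    (fun z => pderiv i (pderiv k (scriCoeff s₀ P 0)) z.1)
    (fun z => pderiv i (pderiv k (scriCoeff s₀ P 1)) z.1)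
    fun z => 1 / 2 * pderiv i (pderiv k (scriCoeff s₀ P 2)) z.1 := by
  refine ((h.scriExp_of_contDiffOn (contDiffOn_dX (contDiffOn_dX h.smooth_ext k) i)).congr
    (h.eventually_spec.mono fun z hz => by rw [hz.2.2.2.2.2.2.2]; rfl)).congr_coeff ?_
  filter_upwards [eventually_scriFilter_pos] with z hz
  have h1 := fun j => h.pderiv_pderiv_scriCoeff j (sphere_ne_zero hz.1) i k
  exact ⟨h1 0, h1 1, by rw [h1 2]; rfl⟩

theorem scriExp_y (h : ScriGraph m s₀ u P) (i : Fin 3) :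
    ScriExp (fun z => (jetAt m s₀ (rayExt P) z).y i) (fun z => z.1 i) (fun _ => 0) fun _ => 0 :=
  (ScriExp.of_bdd (h.bddJet.y i)).congr_coeff
    (h.eventually_spec.mono fun z hz => by rw [hz.2.2.2.2.1]; simp)

theorem scriExp_q (h : ScriGraph m s₀ u P) :
    ScriExp (fun z => (jetAt m s₀ (rayExt P) z).q) (fun _ => 0) (fun _ => 0) fun _ => 1 :=
  .of_eq (.const 0) (.const 0) (.const 1) (.const (-2 * m)) (h.eventually_spec.mono fun z hz => by
    rw [ScriJet.q, hz.1, hz.2.1]; ring)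

theorem scriExp_dq (h : ScriGraph m s₀ u P) :
    ScriExp (fun z => (jetAt m s₀ (rayExt P) z).dq) (fun _ => 0) (fun _ => 2) fun _ => -6 * m :=
  .of_eq (.const 0) (.const 2) (.const (-6 * m)) (.const 0) (h.eventually_spec.mono fun z hz => by
    rw [ScriJet.dq, hz.1, hz.2.1]; ring)

theorem scriExp_w (h : ScriGraph m s₀ u P) :
    ScriExp (fun z => (jetAt m s₀ (rayExt P) z).w) (fun _ => 1) (fun _ => 0)
      fun z => scriCoeff s₀ P 1 z.1 :=
  ((ScriExp.const 1).add (h.scriExp_q.mul h.scriExp_p₁)).congr_coeff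
    (Eventually.of_forall fun z => by simp)

end ScriGraph

/-! ### The deviation of the Hessian from a multiple of the metric -/

namespace ScriJet

variable (J : ScriJet) (κ : ℝ)

/-- The component along `∂ₛ` of `hess - κ metric`. -/
noncomputable def devS : ℝ := J.k₀ - κ * (-2 * J.p₁ - J.q * J.p₁ ^ 2)

/-- The mixed components of `hess - κ metric`. -/
noncomputable def devM : Fin 3 → ℝ := J.ζ + (κ * J.w) • J.X

/-- The components of `hess - κ metric` tangential to the sphere. -/
noncomputable def devT : Matrix (Fin 3) (Fin 3) ℝ :=
  J.T - κ • (J.Pr - J.q • Matrix.vecMulVec J.X J.X)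

variable {J κ}

theorem hess_sub_metric : J.hess - κ • J.metric = J.devS κ • Matrix.vecMulVec J.y J.y
    + (Matrix.vecMulVec J.y (J.devM κ) + Matrix.vecMulVec (J.devM κ) J.y) + J.devT κ := by
  ext i j
  simp only [hess, metric, devS, devM, devT, Matrix.sub_apply, Matrix.add_apply, Matrix.smul_apply,
    Matrix.vecMulVec_apply, smul_eq_mul, Pi.add_apply, Pi.smul_apply]
  ring

theorem devM_y : J.devM κ ⬝ᵥ J.y = 0 := by
  rw [devM, add_dotProduct, smul_dotProduct, X_y, ζ_y]; simp

theorem devT_y : (J.devT κ).mulVec J.y = 0 := by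
  simp only [devT, T, Pr, Matrix.sub_mulVec, Matrix.smul_mulVec, Matrix.vecMulVec_mulVec, HT_y,
    X_y, J.y_sq, Matrix.one_mulVec]
  simp

theorem devT_symm : (J.devT κ).transpose = J.devT κ := by
  simp only [devT, T, Pr, Matrix.transpose_sub, Matrix.transpose_smul, HT_symm,
    Matrix.transpose_vecMulVec, Matrix.transpose_one]

theorem y_devT : Matrix.vecMul J.y (J.devT κ) = 0 := by
  rw [← devT_symm, Matrix.vecMul_transpose, devT_y]

theorem Pr_mul_mul_Pr : J.Pr * (J.hess - κ • J.metric) * J.Pr = J.devT κ := by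
  have hy := J.y_sq
  have h1 : J.y ⬝ᵥ J.devM κ = 0 := by rw [dotProduct_comm, devM_y]
  have h2 := devM_y (J := J) (κ := κ)
  rw [hess_sub_metric, Pr]
  simp only [mul_add, add_mul, sub_mul, mul_sub, Matrix.mul_smul, one_mul, mul_one, sub_zero,
    Matrix.vecMulVec_zero, Matrix.vecMulVec_mul, Matrix.mul_vecMulVec, y_devT, devT_y,
    Matrix.zero_vecMulVec]
  simp [h1, h2, hy, Matrix.vecMulVec_mulVec]

theorem y_mul_mul_y : J.y ⬝ᵥ (J.hess - κ • J.metric).mulVec J.y = J.devS κ := by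
  have hy := J.y_sq
  have h1 : J.y ⬝ᵥ J.devM κ = 0 := by rw [dotProduct_comm, devM_y]
  have h2 := devM_y (J := J) (κ := κ)
  rw [hess_sub_metric]
  simp [Matrix.add_mulVec, Matrix.smul_mulVec, Matrix.vecMulVec_mulVec, devT_y, h1, h2, hy]

theorem trace_devT : (J.devT κ).trace
    = J.HT.trace - 1 / 2 * J.dq * J.w * (J.X ⬝ᵥ J.X) - κ * (2 - J.q * (J.X ⬝ᵥ J.X)) := by
  simp only [devT, T, Pr, Matrix.trace_sub, Matrix.trace_smul, Matrix.trace_vecMulVec, J.y_sq,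
    Matrix.trace_one, smul_eq_mul, Fintype.card_fin]
  push_cast
  ring

/-- The trace of the Hessian in terms of its deviation from `κ` times the metric. -/
theorem tr_eq_add (hQ : J.Q ≠ 0) : J.tr = 3 * κ + J.devS κ * (1 - J.q * (J.X ⬝ᵥ J.X)) / J.Q
    + 2 * J.w * (J.X ⬝ᵥ J.devM κ) / J.Q + (J.devT κ).trace
    + (J.X ⬝ᵥ (J.devT κ).mulVec J.X) / J.Q := by
  have h0 : J.tr = 3 * κ + (J.inv * (J.hess - κ • J.metric)).trace := by
    rw [mul_sub, Matrix.mul_smul, inv_mul_metric hQ, Matrix.trace_sub, Matrix.trace_smul,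
      Matrix.trace_one, tr]
    simp
    ring
  have hy := J.y_sq
  have hXy := X_y (J := J)
  have h1 : J.y ⬝ᵥ J.devM κ = 0 := by rw [dotProduct_comm, devM_y]
  have h2 := devM_y (J := J) (κ := κ)
  have h3 : ∀ a : Fin 3 → ℝ, Matrix.vecMulVec a J.y * J.devT κ = 0 := fun a => by
    rw [Matrix.vecMulVec_mul, y_devT, Matrix.vecMulVec_zero]
  have h4 : ∀ a : Fin 3 → ℝ, Matrix.vecMulVec a J.X * J.devT κ
      = Matrix.vecMulVec a (Matrix.vecMul J.X (J.devT κ)) := fun a => Matrix.vecMulVec_mul _ _ _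
  have h5 : J.y ⬝ᵥ Matrix.vecMul J.X (J.devT κ) = 0 := by
    rw [dotProduct_comm, ← Matrix.dotProduct_mulVec, devT_y, dotProduct_zero]
  have h6 : J.X ⬝ᵥ Matrix.vecMul J.X (J.devT κ) = J.X ⬝ᵥ (J.devT κ).mulVec J.X := by
    rw [dotProduct_comm, Matrix.dotProduct_mulVec]
  rw [h0, hess_sub_metric, inv, Pr]
  simp only [mul_add, add_mul, sub_mul, mul_sub, Matrix.smul_mul, Matrix.mul_smul, one_mul, mul_one,
    Matrix.vecMulVec_mul_vecMulVec, hy, hXy, h1, h2, one_smul, zero_smul,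
    h3, h4, smul_zero, sub_zero, Matrix.vecMulVec_zero, Matrix.vecMulVec_smul, Matrix.trace_add,
    Matrix.trace_sub, Matrix.trace_smul, Matrix.trace_vecMulVec, smul_eq_mul, Matrix.trace_zero,
    h5, h6]
  field_simp
  ring

end ScriJet

namespace ScriCMC

variable {m s₀ : ℝ} {u : E 3 → ℝ} {P φ : S2 × ℝ → ℝ}

theorem scriO_devT_of_traceless (h : ScriCMC m s₀ u P φ) {k : ℕ}
    (ht : ∀ i j, ScriO (fun z => (jetAt m s₀ (rayExt P) z).traceless i j) k) (i j : Fin 3) :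
    ScriO (fun z => (jetAt m s₀ (rayExt P) z).devT ((jetAt m s₀ (rayExt P) z).tr / 3) i j) k := by
  have hP := h.bddJet.Pr
  have e : ∀ z, (jetAt m s₀ (rayExt P) z).devT ((jetAt m s₀ (rayExt P) z).tr / 3) i j
      = ∑ l, ∑ k, (jetAt m s₀ (rayExt P) z).Pr i k * (jetAt m s₀ (rayExt P) z).traceless k l
        * (jetAt m s₀ (rayExt P) z).Pr l j := fun z => by
    rw [← ScriJet.Pr_mul_mul_Pr, Matrix.mul_apply]
    simp only [Matrix.mul_apply, Finset.sum_mul]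
    rfl
  exact (ScriO.sum _ fun l _ => ScriO.sum _ fun k _ =>
    ((hP i k).mul_scriO (ht k l)).mul_bdd (hP l j)).congr (Eventually.of_forall e)

theorem scriO_devS_of_traceless (h : ScriCMC m s₀ u P φ) {k : ℕ}
    (ht : ∀ i j, ScriO (fun z => (jetAt m s₀ (rayExt P) z).traceless i j) k) :
    ScriO (fun z => (jetAt m s₀ (rayExt P) z).devS ((jetAt m s₀ (rayExt P) z).tr / 3)) k := by
  have hy := h.bddJet.y
  have e : ∀ z, (jetAt m s₀ (rayExt P) z).devS ((jetAt m s₀ (rayExt P) z).tr / 3)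
      = ∑ l, ∑ k, (jetAt m s₀ (rayExt P) z).y l * ((jetAt m s₀ (rayExt P) z).traceless l k
        * (jetAt m s₀ (rayExt P) z).y k) := fun z => by
    rw [← ScriJet.y_mul_mul_y]
    simp only [dotProduct, Matrix.mulVec, Finset.mul_sum]
    rfl
  exact (ScriO.sum _ fun l _ => ScriO.sum _ fun k _ =>
    ((hy l).mul_scriO ((ht l k).mul_bdd (hy k)))).congr (Eventually.of_forall e)

theorem Q_ne_zero (h : ScriCMC m s₀ u P φ) :
    ∀ᶠ z in scriFilter, (jetAt m s₀ (rayExt P) z).Q ≠ 0 :=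
  h.half_le_Q.mono fun z hz => by linarith

theorem scriBdd_inv_Q (h : ScriCMC m s₀ u P φ) :
    ScriBdd fun z => (jetAt m s₀ (rayExt P) z).Q⁻¹ := ScriBdd.inv (by norm_num) h.half_le_Q

/-- If the Hessian agrees with a multiple of the metric up to an error, then so does its trace. -/
theorem scriO_tr_sub (h : ScriCMC m s₀ u P φ) {k : ℕ} {κ : E 3 × ℝ → ℝ}
    (hS : ScriO (fun z => (jetAt m s₀ (rayExt P) z).devS (κ z)) k)
    (hM : ∀ i, ScriO (fun z => (jetAt m s₀ (rayExt P) z).devM (κ z) i) k)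
    (hT : ∀ i j, ScriO (fun z => (jetAt m s₀ (rayExt P) z).devT (κ z) i j) k) :
    ScriO (fun z => (jetAt m s₀ (rayExt P) z).tr - 3 * κ z) k := by
  have hb := h.bddJet
  have b1 := hb.X
  have b2 := hb.q
  have b3 := h.scriBdd_inv_Q
  have b4 := hb.w
  have c1 : ScriBdd fun z => (1 - (jetAt m s₀ (rayExt P) z).q
      * ((jetAt m s₀ (rayExt P) z).X ⬝ᵥ (jetAt m s₀ (rayExt P) z).X))
      * (jetAt m s₀ (rayExt P) z).Q⁻¹ := by
    simp only [dotProduct, Fin.sum_univ_three]; fun_prop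
  have c2 : ∀ i, ScriBdd fun z => 2 * (jetAt m s₀ (rayExt P) z).w
      * (jetAt m s₀ (rayExt P) z).X i * (jetAt m s₀ (rayExt P) z).Q⁻¹ := fun i => by fun_prop
  have c3 : ∀ i j, ScriBdd fun z => (jetAt m s₀ (rayExt P) z).X i
      * (jetAt m s₀ (rayExt P) z).X j * (jetAt m s₀ (rayExt P) z).Q⁻¹ := fun i j => by fun_prop
  refine ((((hS.mul_bdd c1).add (ScriO.sum Finset.univ fun i _ => (c2 i).mul_scriO (hM i))).add
    (ScriO.sum Finset.univ fun i _ => hT i i)).add (ScriO.sum Finset.univ fun i _ =>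
      ScriO.sum Finset.univ fun j _ => (c3 i j).mul_scriO (hT i j))).congr ?_
  filter_upwards [h.Q_ne_zero] with z hz
  rw [ScriJet.tr_eq_add (κ := κ z) hz]
  simp only [dotProduct, Matrix.mulVec, Matrix.trace, Matrix.diag_apply, Fin.sum_univ_three,
    div_eq_mul_inv]
  ring

/-- If the Hessian agrees with a multiple of the metric up to an error, then its traceless part is of
the order of the error. -/
theorem scriO_traceless (h : ScriCMC m s₀ u P φ) {k : ℕ} {κ : E 3 × ℝ → ℝ}
    (hS : ScriO (fun z => (jetAt m s₀ (rayExt P) z).devS (κ z)) k)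
    (hM : ∀ i, ScriO (fun z => (jetAt m s₀ (rayExt P) z).devM (κ z) i) k)
    (hT : ∀ i j, ScriO (fun z => (jetAt m s₀ (rayExt P) z).devT (κ z) i j) k) (i j : Fin 3) :
    ScriO (fun z => (jetAt m s₀ (rayExt P) z).traceless i j) k := by
  have hb := h.bddJet
  have hy := hb.y
  refine ((((hS.mul_bdd ((hy i).mul (hy j))).add (((hy i).mul_scriO (hM j)).add
    ((hM i).mul_bdd (hy j)))).add (hT i j)).sub (((h.scriO_tr_sub hS hM hT).mul_bdd
      ((hb.metric i j).mul (.const (1 / 3)))))).congr (Eventually.of_forall fun z => ?_)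
  have h1 := congrFun (congrFun (ScriJet.hess_sub_metric (J := jetAt m s₀ (rayExt P) z)
    (κ := κ z)) i) j
  simp only [Matrix.sub_apply, Matrix.add_apply, Matrix.smul_apply, Matrix.vecMulVec_apply,
    smul_eq_mul] at h1
  simp only [ScriJet.traceless, Matrix.sub_apply, Matrix.smul_apply, smul_eq_mul]
  linear_combination h1

/-- If the traceless part of the Hessian vanishes at null infinity, then so does the traceless part
of the Hessian of `P(·, 0)` on the sphere, so that `P(·, 0)` is the restriction of an affine
function. -/
theorem eq_add_of_scriO_traceless (h : ScriCMC m s₀ u P φ)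
    (ht : ∀ i j, ScriO (fun z => (jetAt m s₀ (rayExt P) z).traceless i j) 1) :
    ∃ (a : ℝ) (b : Fin 3 → ℝ), ∀ y ∈ sphere (0 : E 3) 1,
      scriCoeff s₀ P 0 y = a + ∑ i, b i * y i := by
  have hb := h.bddJet
  have b1 := hb.X
  have b2 := hb.w
  have b3 := hb.tr h.half_le_Q
  have b4 := hb.HT
  have b5 := hb.Pr
  set J := jetAt m s₀ (rayExt P) with hJ
  have hXX : ScriBdd fun z => (J z).X ⬝ᵥ (J z).X := by
    simp only [dotProduct, Fin.sum_univ_three]; fun_prop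
  have hdq : ScriO (fun z => (J z).dq) 1 := h.scriExp_dq.scriO_one (Eventually.of_forall fun _ => rfl)
  have hq : ScriO (fun z => (J z).q) 1 := h.scriExp_q.scriO_one (Eventually.of_forall fun _ => rfl)
  have hT := h.scriO_devT_of_traceless ht
  rw [← hJ] at hT
  -- the trace of the tangential part
  have h1 : ScriO (fun z => (J z).HT.trace - 2 * ((J z).tr / 3)) 1 := by
    refine (((ScriO.sum Finset.univ fun i _ => hT i i).add
      (hdq.mul_bdd (show ScriBdd fun z => 1 / 2 * (J z).w * ((J z).X ⬝ᵥ (J z).X) by fun_prop))).sub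
      (hq.mul_bdd (show ScriBdd fun z => (J z).tr / 3 * ((J z).X ⬝ᵥ (J z).X) by fun_prop))).congr
      (Eventually.of_forall fun z => ?_)
    have := ScriJet.trace_devT (J := J z) (κ := (J z).tr / 3)
    rw [Matrix.trace] at this
    simp only [Matrix.diag_apply] at this
    rw [this]
    ring
  have h2 : ∀ i j, ScriO (fun z => (J z).HT i j - (J z).HT.trace / 2 * (J z).Pr i j) 1 := by
    intro i j
    refine ((((hT i j).add (hdq.mul_bdd (show ScriBdd fun z => 1 / 2 * (J z).w
      * ((J z).X i * (J z).X j) by fun_prop))).sub (hq.mul_bdd (show ScriBdd fun z =>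
      (J z).tr / 3 * ((J z).X i * (J z).X j) by fun_prop))).sub (h1.mul_bdd (show ScriBdd fun z =>
      1 / 2 * (J z).Pr i j by fun_prop))).congr (Eventually.of_forall fun z => ?_)
    simp only [ScriJet.devT, ScriJet.T, Matrix.sub_apply, Matrix.smul_apply, Matrix.vecMulVec_apply,
      smul_eq_mul]
    ring
  have hO : IsOpen ({0}ᶜ : Set (E 3)) := isOpen_compl_singleton
  set ψ := scriCoeff s₀ P 0
  -- the values at null infinity
  have hHT : ∀ i j, ScriExp (fun z => (J z).HT i j) _ _ _ := fun i j =>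
    ((h.scriExp_H i j).add ((h.scriExp_y i).mul (h.scriExp_X j))).add
      ((h.scriExp_X i).mul (h.scriExp_y j))
  have hPr : ∀ i j, ScriExp (fun z => (J z).Pr i j) _ _ _ := fun i j =>
    (ScriExp.const ((1 : Matrix (Fin 3) (Fin 3) ℝ) i j)).sub
      ((h.scriExp_y i).mul (h.scriExp_y j))
  refine eq_add_of_traceless_hessian (h.contDiffOn_scriCoeff 0) (h.isHomog_scriCoeff 0)
    (fun y => 1 / 2 * (∑ k, (pderiv k (pderiv k ψ) y + y k * pderiv k ψ y + pderiv k ψ y * y k)))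
    fun y hy i j => ?_
  have h3 := ((hHT i j).sub (((((hHT 0 0).add (hHT 1 1)).add (hHT 2 2)).const_mul (1 / 2)).mul
    (hPr i j))).zero_of_scriO_one ((h2 i j).congr (Eventually.of_forall fun z => by
      simp only [Matrix.trace, Matrix.diag_apply, Fin.sum_univ_three]; ring))
    (a₀ := fun y => pderiv i (pderiv j ψ) y + y i * pderiv j ψ y + pderiv i ψ y * y j
      - 1 / 2 * (∑ k, (pderiv k (pderiv k ψ) y + y k * pderiv k ψ y + pderiv k ψ y * y k))
        * ((1 : Matrix (Fin 3) (Fin 3) ℝ) i j - y i * y j))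
    (Eventually.of_forall fun z => by simp only [Fin.sum_univ_three]; rfl) hy
  simp only [Matrix.one_apply] at h3
  linear_combination h3

end ScriCMC

/-! ### Graphs with affine boundary values -/

/-- The linear form `b · y`. -/
noncomputable def linForm (b : Fin 3 → ℝ) (y : E 3) : ℝ := ∑ i, b i * y i

/-- The gradient on the sphere of `linForm b`. -/
noncomputable def linGrad (b : Fin 3 → ℝ) (y : E 3) (i : Fin 3) : ℝ := b i - linForm b y * y i

section linForm

variable {b : Fin 3 → ℝ}

theorem sum_linGrad_sq {y : E 3} (hy : y ∈ sphere (0 : E 3) 1) :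
    ∑ i, linGrad b y i * linGrad b y i = ∑ i, b i * b i - linForm b y ^ 2 := by
  have h := sum_sq_eq_norm_sq y
  rw [mem_sphere_zero_iff_norm.1 hy] at h
  simp only [linGrad, linForm, Fin.sum_univ_three] at *
  linear_combination (b 0 * y 0 + b 1 * y 1 + b 2 * y 2) ^ 2 * h

theorem scriBdd_coord (i : Fin 3) : ScriBdd fun z : E 3 × ℝ => z.1 i :=
  ContDiffOn.scriBdd one_pos
    ((contDiff_euclidean.1 contDiff_id i).comp contDiff_fst).contDiffOn

theorem scriBdd_linForm (b : Fin 3 → ℝ) : ScriBdd fun z : E 3 × ℝ => linForm b z.1 := by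
  have := scriBdd_coord
  simp only [linForm, Fin.sum_univ_three]
  fun_prop

variable {g : E 3 → ℝ} {F F' F'' : ℝ → ℝ}

theorem hasPD_linForm_unitDir {x : E 3} (hx : x ≠ 0) :
    HasPD (fun x => ∑ j, b j * unitDir x j)
      (fun i => (b i - (∑ j, b j * unitDir x j) * unitDir x i) * ‖x‖⁻¹) x := by
  refine (HasPD.sum Finset.univ fun j _ => (hasPD_unitDir hx j).const_mul (b j)).congr_deriv ?_
  intro i
  simp only [Fin.sum_univ_three]
  fin_cases i <;> simp <;> ring

theorem unitDir_sphere {y : E 3} (hy : y ∈ sphere (0 : E 3) 1) (i : Fin 3) : unitDir y i = y i := by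
  rw [unitDir, mem_sphere_zero_iff_norm.1 hy, div_one]

theorem eq_comp_of_eqOn_sphere (hg : IsHomog 0 g)
    (h : ∀ y ∈ sphere (0 : E 3) 1, g y = F (linForm b y)) {x : E 3} (hx : x ≠ 0) :
    g x = F (∑ j, b j * unitDir x j) := by
  refine hg.eq_of_eqOn_sphere (g := fun x => F (∑ j, b j * unitDir x j)) ?_ ?_ hx
  · intro t ht x hx
    have h1 : ∀ k, unitDir (t • x) k = unitDir x k := fun k => by
      have := norm_ne_zero_iff.2 hx
      simp [unitDir, norm_smul, abs_of_pos ht]; field_simp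
    simp [h1]
  · intro y hy
    simp only [h y hy, unitDir_sphere hy, linForm]

theorem hasPD_of_eqOn_sphere (hg : IsHomog 0 g) (hF : ∀ t, HasDerivAt F (F' t) t)
    (h : ∀ y ∈ sphere (0 : E 3) 1, g y = F (linForm b y)) {x : E 3} (hx : x ≠ 0) :
    HasPD g (fun i => F' (∑ j, b j * unitDir x j)
      * ((b i - (∑ j, b j * unitDir x j) * unitDir x i) * ‖x‖⁻¹)) x := by
  have hO : IsOpen ({0}ᶜ : Set (E 3)) := isOpen_compl_singleton
  refine ((hasPD_linForm_unitDir hx).comp (hF _)).congr_of_eventuallyEq ?_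
  filter_upwards [hO.mem_nhds hx] with x hx using eq_comp_of_eqOn_sphere hg h hx

theorem pderiv_of_eqOn_sphere (hg : IsHomog 0 g) (hF : ∀ t, HasDerivAt F (F' t) t)
    (h : ∀ y ∈ sphere (0 : E 3) 1, g y = F (linForm b y)) {y : E 3}
    (hy : y ∈ sphere (0 : E 3) 1) (i : Fin 3) :
    pderiv i g y = F' (linForm b y) * linGrad b y i := by
  rw [(hasPD_of_eqOn_sphere hg hF h (sphere_ne_zero hy)).eq i]
  simp only [unitDir_sphere hy, mem_sphere_zero_iff_norm.1 hy, linForm, linGrad]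
  ring

/-- The Hessian of a function of `b · y` on the sphere. -/
theorem pderiv_pderiv_of_eqOn_sphere (hg : IsHomog 0 g) (hF : ∀ t, HasDerivAt F (F' t) t)
    (hF' : ∀ t, HasDerivAt F' (F'' t) t)
    (h : ∀ y ∈ sphere (0 : E 3) 1, g y = F (linForm b y)) {y : E 3}
    (hy : y ∈ sphere (0 : E 3) 1) (i k : Fin 3) :
    pderiv i (pderiv k g) y + y i * pderiv k g y + pderiv i g y * y k
      = F'' (linForm b y) * (linGrad b y i * linGrad b y k)
        - linForm b y * F' (linForm b y) * ((1 : Matrix (Fin 3) (Fin 3) ℝ) i k - y i * y k) := by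
  have hO : IsOpen ({0}ᶜ : Set (E 3)) := isOpen_compl_singleton
  have hy0 := sphere_ne_zero hy
  have h1 : pderiv k g =ᶠ[nhds y] fun x => F' (∑ j, b j * unitDir x j)
      * ((b k - (∑ j, b j * unitDir x j) * unitDir x k) * ‖x‖⁻¹) := by
    filter_upwards [hO.mem_nhds hy0] with x hx using (hasPD_of_eqOn_sphere hg hF h hx).eq k
  have hl := hasPD_linForm_unitDir (b := b) hy0
  rw [pderiv_congr h1, ((hl.comp (hF' _)).mul (((HasPD.const (b k)).sub
    (hl.mul (hasPD_unitDir hy0 k))).mul (hasPD_norm_inv hy0))).eq i,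
    pderiv_of_eqOn_sphere hg hF h hy, pderiv_of_eqOn_sphere hg hF h hy]
  simp only [unitDir_sphere hy, mem_sphere_zero_iff_norm.1 hy, linGrad, Matrix.one_apply]
  change F'' (linForm b y) * ((b i - linForm b y * y i) * 1⁻¹)
    * ((b k - linForm b y * y k) * 1⁻¹) + F' (linForm b y) * ((0 - ((b i - linForm b y * y i) * 1⁻¹
    * y k + linForm b y * (((if i = k then 1 else 0) - y i * y k) / 1))) * 1⁻¹
    + (b k - linForm b y * y k) * -(y i / 1 ^ 3)) + _ + _ = _
  ring

end linForm

namespace ScriCMC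

variable {m s₀ : ℝ} {u : E 3 → ℝ} {P φ : S2 × ℝ → ℝ}

/-- The equation for the mean curvature without the root. -/
theorem scriO_Q_sub_sq (h : ScriCMC m s₀ u P φ) :
    ScriO (fun z => (jetAt m s₀ (rayExt P) z).Q
      - ((jetAt m s₀ (rayExt P) z).w - 1 / 3 * (z.2 * (jetAt m s₀ (rayExt P) z).tr)) ^ 2) 3 := by
  have hφ := ContDiffOn.scriBdd h.s₀_pos (contDiffOn_rayExt h.φ_smooth)
  have hb := h.bddJet
  have b1 := hb.w
  have b2 := hb.tr h.half_le_Q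
  have hW : ScriBdd fun z => Real.sqrt (jetAt m s₀ (rayExt P) z).Q := by
    have b3 := hb.p₁
    have b4 := hb.q
    have b5 := hb.X
    have hQ : ScriBdd fun z => (jetAt m s₀ (rayExt P) z).Q + 1 := by
      simp only [ScriJet.Q, dotProduct, Fin.sum_univ_three]; fun_prop
    refine scriBdd_iff_isBigO.2 (IsBigO.trans (IsBigO.of_bound 1 ?_) (scriBdd_iff_isBigO.1 hQ))
    filter_upwards [h.half_le_Q] with z hz
    rw [one_mul, Real.norm_eq_abs, Real.norm_eq_abs, abs_of_nonneg (Real.sqrt_nonneg _)]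
    refine le_trans ?_ (le_abs_self _)
    nlinarith [Real.sq_sqrt (by linarith : 0 ≤ (jetAt m s₀ (rayExt P) z).Q),
      sq_nonneg (Real.sqrt (jetAt m s₀ (rayExt P) z).Q - 1),
      Real.sqrt_nonneg (jetAt m s₀ (rayExt P) z).Q]
  refine (show ScriBdd fun z => -(rayExt φ z * Real.sqrt (jetAt m s₀ (rayExt P) z).Q)
    * (Real.sqrt (jetAt m s₀ (rayExt P) z).Q + ((jetAt m s₀ (rayExt P) z).w
      - 1 / 3 * (z.2 * (jetAt m s₀ (rayExt P) z).tr))) by fun_prop).scriO ?_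
  filter_upwards [eventually_scriFilter_mem h.s₀_pos, h.half_le_Q] with z hz hQ
  have h1 := h.sqrt_Q_eq hz.2.1 hz.2.2
  have h2 := Real.sq_sqrt (by linarith : 0 ≤ (jetAt m s₀ (rayExt P) z).Q)
  set W := Real.sqrt (jetAt m s₀ (rayExt P) z).Q
  rw [← h2]
  linear_combination (1 / 3 * (W + ((jetAt m s₀ (rayExt P) z).w
      - 1 / 3 * (z.2 * (jetAt m s₀ (rayExt P) z).tr)))) * h1

/-- If the Hessian agrees to higher order with a multiple of the metric, except for the component
along `∂ₛ`, then its trace differs by that component. -/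
theorem scriO_tr_sub_devS (h : ScriCMC m s₀ u P φ) {k : ℕ} {κ : E 3 × ℝ → ℝ}
    (hS : ScriO (fun z => (jetAt m s₀ (rayExt P) z).devS (κ z)) k)
    (hM : ∀ i, ScriO (fun z => (jetAt m s₀ (rayExt P) z).devM (κ z) i) (k + 1))
    (hT : ∀ i j, ScriO (fun z => (jetAt m s₀ (rayExt P) z).devT (κ z) i j) (k + 1)) :
    ScriO (fun z => (jetAt m s₀ (rayExt P) z).tr - 3 * κ z
      - (jetAt m s₀ (rayExt P) z).devS (κ z)) (k + 1) := by
  have hb := h.bddJet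
  have b1 := hb.X
  have b2 := hb.q
  have b3 := h.scriBdd_inv_Q
  have b4 := hb.w
  have c2 : ∀ i, ScriBdd fun z => 2 * (jetAt m s₀ (rayExt P) z).w
      * (jetAt m s₀ (rayExt P) z).X i * (jetAt m s₀ (rayExt P) z).Q⁻¹ := fun i => by fun_prop
  have c3 : ∀ i j, ScriBdd fun z => (jetAt m s₀ (rayExt P) z).X i
      * (jetAt m s₀ (rayExt P) z).X j * (jetAt m s₀ (rayExt P) z).Q⁻¹ := fun i j => by fun_prop
  have hXX : ScriBdd fun z => (jetAt m s₀ (rayExt P) z).X ⬝ᵥ (jetAt m s₀ (rayExt P) z).X := by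
    simp only [dotProduct, Fin.sum_univ_three]; fun_prop
  have hq : ScriO (fun z => (jetAt m s₀ (rayExt P) z).q) 1 :=
    h.scriExp_q.scriO_one (Eventually.of_forall fun _ => rfl)
  have c1 : ScriO (fun z => (1 - (jetAt m s₀ (rayExt P) z).q
      * ((jetAt m s₀ (rayExt P) z).X ⬝ᵥ (jetAt m s₀ (rayExt P) z).X))
      * (jetAt m s₀ (rayExt P) z).Q⁻¹ - 1) 1 := by
    refine ((((hq.mul_bdd hXX).add h.scriO_Q_sub_one).mul_bdd b3).mul_bdd (.const (-1))).congr ?_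
    filter_upwards [h.Q_ne_zero] with z hz
    field_simp
    ring
  have c4 : ScriO (fun z => (jetAt m s₀ (rayExt P) z).devS (κ z) * ((1 - (jetAt m s₀ (rayExt P) z).q
      * ((jetAt m s₀ (rayExt P) z).X ⬝ᵥ (jetAt m s₀ (rayExt P) z).X))
      * (jetAt m s₀ (rayExt P) z).Q⁻¹ - 1)) (k + 1) := by
    obtain ⟨r, hr, h1⟩ := hS.exists_bdd
    obtain ⟨r', hr', h2⟩ := c1.exists_bdd
    refine (hr.mul hr').scriO ?_
    filter_upwards [h1, h2] with z h1 h2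
    rw [h1, h2]
    ring
  refine (((c4.add (ScriO.sum Finset.univ fun i _ => (c2 i).mul_scriO (hM i))).add
    (ScriO.sum Finset.univ fun i _ => hT i i)).add (ScriO.sum Finset.univ fun i _ =>
      ScriO.sum Finset.univ fun j _ => (c3 i j).mul_scriO (hT i j))).congr ?_
  filter_upwards [h.Q_ne_zero] with z hz
  rw [ScriJet.tr_eq_add (κ := κ z) hz]
  simp only [dotProduct, Matrix.mulVec, Matrix.trace, Matrix.diag_apply, Fin.sum_univ_three,
    div_eq_mul_inv]
  ring

end ScriCMC

theorem ScriExp.sum_three {F a b c : Fin 3 → E 3 × ℝ → ℝ}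
    (h : ∀ i, ScriExp (F i) (a i) (b i) (c i)) :
    ScriExp (fun z => ∑ i, F i z) (fun z => ∑ i, a i z) (fun z => ∑ i, b i z)
      fun z => ∑ i, c i z := by
  simp only [Fin.sum_univ_three]
  exact ((h 0).add (h 1)).add (h 2)

/-- A graph as in `ScriCMC` whose boundary values `P(·, 0)` are the restriction of an affine function
to the sphere. -/
structure AffineCMC (m s₀ : ℝ) (u : E 3 → ℝ) (P φ : S2 × ℝ → ℝ) (a : ℝ) (b : Fin 3 → ℝ) : Prop
    extends ScriCMC m s₀ u P φ where
  coeff_zero : ∀ y ∈ sphere (0 : E 3) 1, scriCoeff s₀ P 0 y = a + linForm b y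

namespace AffineCMC

variable {m s₀ : ℝ} {u : E 3 → ℝ} {P φ : S2 × ℝ → ℝ} {a : ℝ} {b : Fin 3 → ℝ}

theorem pderiv_coeff_zero (h : AffineCMC m s₀ u P φ a b) {y : E 3}
    (hy : y ∈ sphere (0 : E 3) 1) (i : Fin 3) :
    pderiv i (scriCoeff s₀ P 0) y = linGrad b y i := by
  rw [pderiv_of_eqOn_sphere (F := fun t => a + t) (F' := fun _ => 1) (h.isHomog_scriCoeff 0)
    (fun t => (hasDerivAt_id' t).const_add a) h.coeff_zero hy, one_mul]

theorem hess_coeff_zero (h : AffineCMC m s₀ u P φ a b) {y : E 3}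
    (hy : y ∈ sphere (0 : E 3) 1) (i k : Fin 3) :
    pderiv i (pderiv k (scriCoeff s₀ P 0)) y + y i * pderiv k (scriCoeff s₀ P 0) y
      + pderiv i (scriCoeff s₀ P 0) y * y k
      = -linForm b y * ((1 : Matrix (Fin 3) (Fin 3) ℝ) i k - y i * y k) := by
  rw [pderiv_pderiv_of_eqOn_sphere (F := fun t => a + t) (F' := fun _ => 1) (F'' := fun _ => 0)
    (h.isHomog_scriCoeff 0) (fun t => (hasDerivAt_id' t).const_add a)
    (fun t => hasDerivAt_const t 1) h.coeff_zero hy]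
  ring

/-- `|∇(v + P)|² = 1` at null infinity. -/
theorem coeff_one (h : AffineCMC m s₀ u P φ a b) {y : E 3} (hy : y ∈ sphere (0 : E 3) 1) :
    scriCoeff s₀ P 1 y = -(1 + ∑ i, b i * b i - linForm b y ^ 2) / 2 := by
  have h1 := h.gradSq_zero_eq_one hy
  have h2 : ∀ i, dX s₀ i (rayExt P) (y, 0) = linGrad b y i := fun i => by
    rw [← h.pderiv_coeff_zero hy, h.pderiv_scriCoeff 0 (sphere_ne_zero hy)]; rfl
  have h3 : scriCoeff s₀ P 1 y = dS s₀ (rayExt P) (y, 0) := rfl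
  simp only [gradSq, h2, sum_linGrad_sq hy, sum_sq_eq_norm_sq y, mem_sphere_zero_iff_norm.1 hy] at h1
  rw [h3]
  linear_combination -h1 / 2

theorem pderiv_coeff_one (h : AffineCMC m s₀ u P φ a b) {y : E 3}
    (hy : y ∈ sphere (0 : E 3) 1) (i : Fin 3) :
    pderiv i (scriCoeff s₀ P 1) y = linForm b y * linGrad b y i :=
  pderiv_of_eqOn_sphere (F := fun t => -(1 + ∑ i, b i * b i - t ^ 2) / 2) (F' := fun t => t)
    (h.isHomog_scriCoeff 1) (fun t => ((((hasDerivAt_pow 2 t).const_sub _).fun_neg).div_const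
      2).congr_deriv (by norm_num)) (fun _ hy => h.coeff_one hy) hy i

theorem hess_coeff_one (h : AffineCMC m s₀ u P φ a b) {y : E 3}
    (hy : y ∈ sphere (0 : E 3) 1) (i k : Fin 3) :
    pderiv i (pderiv k (scriCoeff s₀ P 1)) y + y i * pderiv k (scriCoeff s₀ P 1) y
      + pderiv i (scriCoeff s₀ P 1) y * y k = linGrad b y i * linGrad b y k
        - linForm b y ^ 2 * ((1 : Matrix (Fin 3) (Fin 3) ℝ) i k - y i * y k) := by
  rw [pderiv_pderiv_of_eqOn_sphere (F := fun t => -(1 + ∑ i, b i * b i - t ^ 2) / 2)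
    (F' := fun t => t) (F'' := fun _ => 1) (h.isHomog_scriCoeff 1)
    (fun t => ((((hasDerivAt_pow 2 t).const_sub _).fun_neg).div_const
      2).congr_deriv (by norm_num)) (fun t => hasDerivAt_id' t)
    (fun _ hy => h.coeff_one hy) hy]
  ring

/-- The factor `κ` for which `hess - κ metric` is small. -/
noncomputable def conf (b : Fin 3 → ℝ) (z : E 3 × ℝ) : ℝ :=
  -linForm b z.1 - z.2 * linForm b z.1 ^ 2

theorem scriExp_conf (b : Fin 3 → ℝ) : ScriExp (conf b) (fun z => -linForm b z.1)
    (fun z => -linForm b z.1 ^ 2) fun _ => 0 := by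
  have := scriBdd_linForm b
  exact .of_eq (by fun_prop) (by fun_prop) (.const 0) (.const 0)
    (Eventually.of_forall fun z => by rw [conf]; ring)

/-- The expansion of `X`, with the first two coefficients made explicit. -/
theorem scriExp_X' (h : AffineCMC m s₀ u P φ a b) (i : Fin 3) :
    ScriExp (fun z => (jetAt m s₀ (rayExt P) z).X i) (fun z => linGrad b z.1 i)
      (fun z => linForm b z.1 * linGrad b z.1 i)
      fun z => 1 / 2 * pderiv i (scriCoeff s₀ P 2) z.1 := by
  refine (h.scriExp_X i).congr_coeff ?_
  filter_upwards [eventually_scriFilter_pos] with z hz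
  exact ⟨(h.pderiv_coeff_zero hz.1 i).symm, (h.pderiv_coeff_one hz.1 i).symm, rfl⟩

theorem scriExp_HT (h : AffineCMC m s₀ u P φ a b) (i k : Fin 3) :
    ScriExp (fun z => (jetAt m s₀ (rayExt P) z).HT i k)
      (fun z => -linForm b z.1 * ((1 : Matrix (Fin 3) (Fin 3) ℝ) i k - z.1 i * z.1 k))
      (fun z => linGrad b z.1 i * linGrad b z.1 k
        - linForm b z.1 ^ 2 * ((1 : Matrix (Fin 3) (Fin 3) ℝ) i k - z.1 i * z.1 k))
      fun z => 1 / 2 * (pderiv i (pderiv k (scriCoeff s₀ P 2)) z.1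
        + z.1 i * pderiv k (scriCoeff s₀ P 2) z.1 + pderiv i (scriCoeff s₀ P 2) z.1 * z.1 k) := by
  refine (((h.scriExp_H i k).add ((h.scriExp_y i).mul (h.scriExp_X k))).add
    ((h.scriExp_X i).mul (h.scriExp_y k))).congr_coeff ?_
  filter_upwards [eventually_scriFilter_pos] with z hz
  have h0 := h.hess_coeff_zero hz.1 i k
  have h1 := h.hess_coeff_one hz.1 i k
  refine ⟨?_, ?_, ?_⟩
  · linear_combination -h0
  · linear_combination -h1
  · ring

theorem scriExp_Pr (h : ScriGraph m s₀ u P) (i k : Fin 3) :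
    ScriExp (fun z => (jetAt m s₀ (rayExt P) z).Pr i k)
      (fun z => (1 : Matrix (Fin 3) (Fin 3) ℝ) i k - z.1 i * z.1 k) (fun _ => 0) fun _ => 0 :=
  ((ScriExp.const ((1 : Matrix (Fin 3) (Fin 3) ℝ) i k)).sub
    ((h.scriExp_y i).mul (h.scriExp_y k))).congr_coeff (Eventually.of_forall fun z => by simp)

/-- The tangential part of `hess - κ metric` is `O(s²)`. The coefficient `c₂` of `s²` in `κ` is left
free, since the trace of the Hessian is known only up to this order. -/
theorem scriExp_devT (h : AffineCMC m s₀ u P φ a b) {κ c₂ : E 3 × ℝ → ℝ}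
    (hκ : ScriExp κ (fun z => -linForm b z.1) (fun z => -linForm b z.1 ^ 2) c₂) (i k : Fin 3) :
    ScriExp (fun z => (jetAt m s₀ (rayExt P) z).devT (κ z) i k) (fun _ => 0) (fun _ => 0)
      fun z => 1 / 2 * (pderiv i (pderiv k (scriCoeff s₀ P 2)) z.1
        + z.1 i * pderiv k (scriCoeff s₀ P 2) z.1 + pderiv i (scriCoeff s₀ P 2) z.1 * z.1 k)
        - (3 * linForm b z.1 - 3 * m) * (linGrad b z.1 i * linGrad b z.1 k)
        - c₂ z * ((1 : Matrix (Fin 3) (Fin 3) ℝ) i k - z.1 i * z.1 k) := by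
  have hX := h.scriExp_X'
  refine ((((h.scriExp_HT i k).sub ((((h.scriExp_dq).const_mul (1 / 2)).mul h.scriExp_w).mul
    ((hX i).mul (hX k)))).sub (hκ.mul ((scriExp_Pr h.toScriGraph i k).sub
      (h.scriExp_q.mul ((hX i).mul (hX k)))))).congr
      (Eventually.of_forall fun z => ?_)).congr_coeff (Eventually.of_forall fun z => ⟨?_, ?_, ?_⟩)
  · simp only [ScriJet.devT, ScriJet.T, Matrix.sub_apply, Matrix.smul_apply, Matrix.vecMulVec_apply,
      smul_eq_mul]
  · ring
  · ring
  · ring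

theorem scriExp_devM (h : AffineCMC m s₀ u P φ a b) (i : Fin 3) :
    ScriExp (fun z => (jetAt m s₀ (rayExt P) z).devM (conf b z) i) (fun _ => 0)
      (fun z => pderiv i (scriCoeff s₀ P 2) z.1
        - (2 * scriCoeff s₀ P 1 z.1 + 2 * linForm b z.1 ^ 2) * linGrad b z.1 i)
      fun z => 1 / 2 * pderiv i (scriCoeff s₀ P 3) z.1
        - (2 * scriCoeff s₀ P 2 z.1 - 6 * m * scriCoeff s₀ P 1 z.1) * linGrad b z.1 i
        - 2 * scriCoeff s₀ P 1 z.1 * linForm b z.1 * linGrad b z.1 i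
        - linForm b z.1 ^ 3 * linGrad b z.1 i - 1 / 2 * linForm b z.1
          * pderiv i (scriCoeff s₀ P 2) z.1
        - linForm b z.1 * scriCoeff s₀ P 1 z.1 * linGrad b z.1 i := by
  have hX := h.scriExp_X' i
  have hp := h.scriExp_p₁
  refine (((h.scriExp_Z i).sub (((h.scriExp_dq.mul hp).add (((h.scriExp_q.const_mul (1 / 2)).mul
    h.scriExp_dq).mul (hp.mul hp))).mul hX)).add (((scriExp_conf b).mul h.scriExp_w).mul hX)
    |>.congr (Eventually.of_forall fun z => ?_)).congr_coeff ?_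
  · simp only [ScriJet.devM, ScriJet.ζ, Pi.add_apply, Pi.sub_apply, Pi.smul_apply, smul_eq_mul]
    ring
  · filter_upwards [eventually_scriFilter_pos] with z hz
    rw [h.pderiv_coeff_one hz.1 i]
    refine ⟨?_, ?_, ?_⟩ <;> ring

theorem scriExp_devS (h : AffineCMC m s₀ u P φ a b) :
    ScriExp (fun z => (jetAt m s₀ (rayExt P) z).devS (conf b z))
      (fun z => scriCoeff s₀ P 2 z.1 - 2 * linForm b z.1 * scriCoeff s₀ P 1 z.1)
      (fun z => scriCoeff s₀ P 3 z.1 - 3 * scriCoeff s₀ P 1 z.1 ^ 2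
        - 2 * linForm b z.1 * scriCoeff s₀ P 2 z.1
        - 2 * linForm b z.1 ^ 2 * scriCoeff s₀ P 1 z.1)
      fun z => 1 / 2 * scriCoeff s₀ P 4 z.1 + 9 * m * scriCoeff s₀ P 1 z.1 ^ 2
        - 6 * scriCoeff s₀ P 1 z.1 * scriCoeff s₀ P 2 z.1
        - linForm b z.1 * (scriCoeff s₀ P 3 z.1 + scriCoeff s₀ P 1 z.1 ^ 2)
        - 2 * linForm b z.1 ^ 2 * scriCoeff s₀ P 2 z.1 := by
  have hp := h.scriExp_p₁
  refine (((h.scriExp_p₂.sub ((h.scriExp_dq.const_mul (3 / 2)).mul (hp.mul hp))).sub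
    (((h.scriExp_q.const_mul (1 / 2)).mul h.scriExp_dq).mul (hp.mul (hp.mul hp)))).sub
    ((scriExp_conf b).mul ((hp.const_mul (-2)).sub (h.scriExp_q.mul (hp.mul hp))))
    |>.congr (Eventually.of_forall fun z => ?_)).congr_coeff (Eventually.of_forall fun z => ⟨?_, ?_, ?_⟩)
  · simp only [ScriJet.devS, ScriJet.k₀]
    ring
  all_goals ring

theorem scriExp_Q (h : AffineCMC m s₀ u P φ a b) :
    ScriExp (fun z => (jetAt m s₀ (rayExt P) z).Q) (fun _ => 1)
      (fun z => -2 * scriCoeff s₀ P 2 z.1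
        - 2 * linForm b z.1 * (∑ i, b i * b i - linForm b z.1 ^ 2))
      fun z => -scriCoeff s₀ P 3 z.1 - scriCoeff s₀ P 1 z.1 ^ 2
        - linForm b z.1 ^ 2 * (∑ i, b i * b i - linForm b z.1 ^ 2)
        - ∑ i, linGrad b z.1 i * pderiv i (scriCoeff s₀ P 2) z.1 := by
  have hp := h.scriExp_p₁
  refine (((hp.const_mul (-2)).sub (h.scriExp_q.mul (hp.mul hp))).sub (ScriExp.sum_three fun i =>
    (h.scriExp_X' i).mul (h.scriExp_X' i))).congr (Eventually.of_forall fun z => ?_) |>.congr_coeff ?_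
  · simp only [ScriJet.Q, dotProduct]
    ring
  · filter_upwards [eventually_scriFilter_pos] with z hz
    have h1 := h.coeff_one hz.1
    have h2 := sum_linGrad_sq (b := b) hz.1
    refine ⟨?_, ?_, ?_⟩
    · rw [h2, h1]; ring
    · rw [← h2]; simp only [Fin.sum_univ_three]; ring
    · rw [← h2]; simp only [Fin.sum_univ_three]; ring

theorem scriO_devT (h : AffineCMC m s₀ u P φ a b) (i k : Fin 3) :
    ScriO (fun z => (jetAt m s₀ (rayExt P) z).devT (conf b z) i k) 2 :=
  (h.scriExp_devT (scriExp_conf b) i k).scriO_two (Eventually.of_forall fun _ => ⟨rfl, rfl⟩)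

/-- The mean curvature determines `∂ₛ²P` at null infinity. -/
theorem coeff_two (h : AffineCMC m s₀ u P φ a b) {y : E 3} (hy : y ∈ sphere (0 : E 3) 1) :
    scriCoeff s₀ P 2 y = -linForm b y * (1 + ∑ i, b i * b i - linForm b y ^ 2) := by
  have hS := h.scriExp_devS
  -- the trace up to `O(s)`, which the factor `s` in the equation turns into `O(s²)`
  obtain ⟨r, hr⟩ := ScriExp.of_scriO_one (h.scriO_tr_sub_devS (k := 0) hS.bdd
    (fun i => (h.scriExp_devM i).scriO_one (Eventually.of_forall fun _ => rfl))
    fun i k => (h.scriO_devT i k).of_le (by norm_num))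
  have htr : ScriExp (fun z => (jetAt m s₀ (rayExt P) z).tr) _ _ _ :=
    ((hr.add hS).add ((scriExp_conf b).const_mul 3)).congr (Eventually.of_forall fun z => by ring)
  have hW := h.scriExp_w.sub ((ScriExp.snd.mul htr).const_mul (1 / 3))
  have h1 := ((h.scriExp_Q).sub (hW.mul hW)).zero_of_scriO_two
    ((h.scriO_Q_sub_sq.of_le (by norm_num)).congr (Eventually.of_forall fun z => by ring))
    (Eventually.of_forall fun z => by ring)
    (b₀ := fun y => -2 * scriCoeff s₀ P 2 y - 2 * linForm b y * (∑ i, b i * b i - linForm b y ^ 2)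
      - 2 * (linForm b y - 1 / 3 * (scriCoeff s₀ P 2 y - 2 * linForm b y * scriCoeff s₀ P 1 y)))
    (Eventually.of_forall fun z => by ring) hy
  rw [h.coeff_one hy] at h1
  linear_combination (-3 / 4) * h1

theorem pderiv_coeff_two (h : AffineCMC m s₀ u P φ a b) {y : E 3}
    (hy : y ∈ sphere (0 : E 3) 1) (i : Fin 3) :
    pderiv i (scriCoeff s₀ P 2) y
      = (-(1 + ∑ i, b i * b i) + 3 * linForm b y ^ 2) * linGrad b y i :=
  pderiv_of_eqOn_sphere (F := fun t => -t * (1 + ∑ i, b i * b i - t ^ 2))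
    (F' := fun t => -(1 + ∑ i, b i * b i) + 3 * t ^ 2) (h.isHomog_scriCoeff 2)
    (fun t => ((hasDerivAt_id' t).fun_neg.mul ((hasDerivAt_pow 2 t).const_sub _)).congr_deriv
      (by norm_num; ring)) (fun _ hy => h.coeff_two hy) hy i

theorem hess_coeff_two (h : AffineCMC m s₀ u P φ a b) {y : E 3}
    (hy : y ∈ sphere (0 : E 3) 1) (i k : Fin 3) :
    pderiv i (pderiv k (scriCoeff s₀ P 2)) y + y i * pderiv k (scriCoeff s₀ P 2) y
      + pderiv i (scriCoeff s₀ P 2) y * y k = 6 * linForm b y * (linGrad b y i * linGrad b y k)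
        - linForm b y * (-(1 + ∑ i, b i * b i) + 3 * linForm b y ^ 2)
          * ((1 : Matrix (Fin 3) (Fin 3) ℝ) i k - y i * y k) :=
  pderiv_pderiv_of_eqOn_sphere (F := fun t => -t * (1 + ∑ i, b i * b i - t ^ 2))
    (F' := fun t => -(1 + ∑ i, b i * b i) + 3 * t ^ 2) (F'' := fun t => 6 * t)
    (h.isHomog_scriCoeff 2)
    (fun t => ((hasDerivAt_id' t).fun_neg.mul ((hasDerivAt_pow 2 t).const_sub _)).congr_deriv
      (by norm_num; ring))
    (fun t => (((hasDerivAt_pow 2 t).const_mul 3).const_add _).congr_deriv (by norm_num; ring))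
    (fun _ hy => h.coeff_two hy) hy i k

theorem scriO_devM (h : AffineCMC m s₀ u P φ a b) (i : Fin 3) :
    ScriO (fun z => (jetAt m s₀ (rayExt P) z).devM (conf b z) i) 2 := by
  refine (h.scriExp_devM i).scriO_two ?_
  filter_upwards [eventually_scriFilter_pos] with z hz
  refine ⟨rfl, ?_⟩
  rw [h.pderiv_coeff_two hz.1, h.coeff_one hz.1]
  ring

/-- The mean curvature determines `∂ₛ³P` at null infinity. -/
theorem coeff_three (h : AffineCMC m s₀ u P φ a b) {y : E 3} (hy : y ∈ sphere (0 : E 3) 1) :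
    scriCoeff s₀ P 3 y = 3 * scriCoeff s₀ P 1 y ^ 2
      + 6 * linForm b y ^ 2 * scriCoeff s₀ P 1 y := by
  have hS := h.scriExp_devS
  have hS0 : ScriO (fun z => (jetAt m s₀ (rayExt P) z).devS (conf b z)) 1 := hS.scriO_one (by
    filter_upwards [eventually_scriFilter_pos] with z hz
    rw [h.coeff_two hz.1, h.coeff_one hz.1]; ring)
  -- the trace up to `O(s²)`, which the factor `s` in the equation turns into `O(s³)`
  obtain ⟨r, hr⟩ := ScriExp.of_scriO_two (h.scriO_tr_sub_devS (k := 1) hS0 h.scriO_devM h.scriO_devT)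
  have htr : ScriExp (fun z => (jetAt m s₀ (rayExt P) z).tr) _ _ _ :=
    ((hr.add hS).add ((scriExp_conf b).const_mul 3)).congr (Eventually.of_forall fun z => by ring)
  have hW := h.scriExp_w.sub ((ScriExp.snd.mul htr).const_mul (1 / 3))
  have h1 := ((h.scriExp_Q).sub (hW.mul hW)).zero_of_scriO_three
    (h.scriO_Q_sub_sq.congr (Eventually.of_forall fun z => by ring))
    (by
      filter_upwards [eventually_scriFilter_pos] with z hz
      rw [h.coeff_two hz.1, h.coeff_one hz.1]
      constructor <;> ring)
    (c₀ := fun y => -scriCoeff s₀ P 3 y - scriCoeff s₀ P 1 y ^ 2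
      - linForm b y ^ 2 * (∑ i, b i * b i - linForm b y ^ 2)
      - ∑ i, linGrad b y i * pderiv i (scriCoeff s₀ P 2) y
      - (2 * (scriCoeff s₀ P 1 y - 1 / 3 * (scriCoeff s₀ P 3 y - 3 * scriCoeff s₀ P 1 y ^ 2
        - 2 * linForm b y * scriCoeff s₀ P 2 y
        - 2 * linForm b y ^ 2 * scriCoeff s₀ P 1 y - 3 * linForm b y ^ 2))
        + (linForm b y - 1 / 3 * (scriCoeff s₀ P 2 y - 2 * linForm b y * scriCoeff s₀ P 1 y)) ^ 2))
    (Eventually.of_forall fun z => by ring) hy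
  have h2 : ∑ i, linGrad b y i * pderiv i (scriCoeff s₀ P 2) y
      = (-(1 + ∑ i, b i * b i) + 3 * linForm b y ^ 2) * (∑ i, b i * b i - linForm b y ^ 2) := by
    rw [← sum_linGrad_sq hy, Finset.mul_sum]
    exact Finset.sum_congr rfl fun i _ => by rw [h.pderiv_coeff_two hy]; ring
  simp only [h2, h.coeff_two hy, h.coeff_one hy] at h1 ⊢
  linear_combination (-3) * h1

theorem scriO_devS (h : AffineCMC m s₀ u P φ a b) :
    ScriO (fun z => (jetAt m s₀ (rayExt P) z).devS (conf b z)) 2 := by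
  refine h.scriExp_devS.scriO_two ?_
  filter_upwards [eventually_scriFilter_pos] with z hz
  rw [h.coeff_three hz.1, h.coeff_two hz.1, h.coeff_one hz.1]
  constructor <;> ring

theorem scriO_traceless_two (h : AffineCMC m s₀ u P φ a b) (i j : Fin 3) :
    ScriO (fun z => (jetAt m s₀ (rayExt P) z).traceless i j) 2 :=
  h.scriO_traceless h.scriO_devS h.scriO_devM h.scriO_devT i j

end AffineCMC

/-! ### Third order decay -/

namespace AffineCMC

variable {m s₀ : ℝ} {u : E 3 → ℝ} {P φ : S2 × ℝ → ℝ} {a : ℝ} {b : Fin 3 → ℝ}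

/-- One third of the trace of the Hessian agrees with `conf` to second order. -/
theorem exists_scriExp_tr (h : AffineCMC m s₀ u P φ a b) : ∃ c₂,
    ScriExp (fun z => (jetAt m s₀ (rayExt P) z).tr / 3) (fun z => -linForm b z.1)
      (fun z => -linForm b z.1 ^ 2) c₂ := by
  obtain ⟨r, hr⟩ := ScriExp.of_scriO_two (h.scriO_tr_sub h.scriO_devS h.scriO_devM h.scriO_devT)
  exact ⟨_, (((hr.const_mul (1 / 3)).add (scriExp_conf b)).congr
    (Eventually.of_forall fun z => by ring)).congr_coeff
    (c' := fun z => 1 / 3 * r z + 0) (Eventually.of_forall fun z => ⟨by ring, by ring, rfl⟩)⟩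

theorem sum_one_sub {y : E 3} (hy : y ∈ sphere (0 : E 3) 1) :
    ∑ i, ((1 : Matrix (Fin 3) (Fin 3) ℝ) i i - y i * y i) = 2 := by
  have h := sum_sq_eq_norm_sq y
  rw [mem_sphere_zero_iff_norm.1 hy] at h
  rw [Finset.sum_sub_distrib, h]
  simp
  norm_num

/-- In the tangential part of the Hessian at third order, the trace free part is
`3 m (B ⊗ B - |B|² / 2)`, where `B = ∇P(·, 0)`. -/
theorem sum_sq_eq_of_scriO (h : AffineCMC m s₀ u P φ a b) (hm : 0 < m)
    (ht : ∀ i j, ScriO (fun z => (jetAt m s₀ (rayExt P) z).traceless i j) 3) {y : E 3}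
    (hy : y ∈ sphere (0 : E 3) 1) : ∑ i, b i * b i = linForm b y ^ 2 := by
  obtain ⟨c₂, hκ⟩ := h.exists_scriExp_tr
  have hT := h.scriO_devT_of_traceless ht
  have hPr := scriExp_Pr h.toScriGraph
  have hE := h.scriExp_devT hκ
  -- the traceless part of the coefficient of `s²`, in which the unknown `c₂` drops out
  have h1 : ∀ i k, 3 * m * (linGrad b y i * linGrad b y k - 1 / 2
      * (∑ j, b j * b j - linForm b y ^ 2)
      * ((1 : Matrix (Fin 3) (Fin 3) ℝ) i k - y i * y k)) = 0 := by
    intro i k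
    refine ((hE i k).sub (((ScriExp.sum_three fun j => hE j j).const_mul (1 / 2)).mul
      (hPr i k))).zero_of_scriO_three ((hT i k).sub (((ScriO.sum Finset.univ fun j _ =>
      hT j j).mul_bdd ((ScriBdd.const (1 / 2)).mul (h.bddJet.Pr i k)))) |>.congr
      (Eventually.of_forall fun z => by ring)) (Eventually.of_forall fun z => by simp)
      (c₀ := fun y => 3 * m * (linGrad b y i * linGrad b y k - 1 / 2
      * (∑ j, b j * b j - linForm b y ^ 2)
      * ((1 : Matrix (Fin 3) (Fin 3) ℝ) i k - y i * y k))) ?_ hy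
    filter_upwards [eventually_scriFilter_pos] with z hz
    have e1 := sum_one_sub hz.1
    have e2 := sum_linGrad_sq (b := b) hz.1
    simp only [h.hess_coeff_two hz.1, Fin.sum_univ_three] at e1 e2 ⊢
    rw [← e2]
    linear_combination (1 / 2 * (1 / 2 * linForm b z.1 * (-(1 + (b 0 * b 0 + b 1 * b 1 + b 2 * b 2))
      + 3 * linForm b z.1 ^ 2) + c₂ z)
      * ((1 : Matrix (Fin 3) (Fin 3) ℝ) i k - z.1 i * z.1 k)) * e1
  have h2 : ∑ i, linGrad b y i * y i = 0 := by
    have e := sum_sq_eq_norm_sq y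
    rw [mem_sphere_zero_iff_norm.1 hy] at e
    simp only [linGrad, linForm, Fin.sum_univ_three] at *
    linear_combination -(b 0 * y 0 + b 1 * y 1 + b 2 * y 2) * e
  -- contract with `B ⊗ B`
  have h3 : ∑ i, ∑ k, linGrad b y i * linGrad b y k * (3 * m * (linGrad b y i * linGrad b y k - 1 / 2
      * (∑ j, b j * b j - linForm b y ^ 2)
      * ((1 : Matrix (Fin 3) (Fin 3) ℝ) i k - y i * y k))) = 0 :=
    Finset.sum_eq_zero fun i _ => Finset.sum_eq_zero fun k _ => by rw [h1, mul_zero]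
  have h4 := sum_linGrad_sq (b := b) hy
  rw [← h4] at h3
  have h5 : (∑ i, linGrad b y i * linGrad b y i) ^ 2 = 0 := by
    simp only [Fin.sum_univ_three, Matrix.one_apply] at h2 h3 ⊢
    simp at h3
    have hm' := hm.ne'
    set B0 := linGrad b y 0
    set B1 := linGrad b y 1
    set B2 := linGrad b y 2
    have h6 : 3 / 2 * m * (B0 * B0 + B1 * B1 + B2 * B2) ^ 2 = 0 := by
      linear_combination h3 - (3 / 2 * m * (B0 * B0 + B1 * B1 + B2 * B2)
        * (B0 * y 0 + B1 * y 1 + B2 * y 2)) * h2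
    rcases mul_eq_zero.1 h6 with h7 | h7
    · exfalso; linarith
    · exact h7
  have h8 := pow_eq_zero_iff two_ne_zero |>.1 h5
  rw [h4] at h8
  linarith

theorem eq_zero_of_scriO (h : AffineCMC m s₀ u P φ a b) (hm : 0 < m)
    (ht : ∀ i j, ScriO (fun z => (jetAt m s₀ (rayExt P) z).traceless i j) 3) : b = 0 := by
  -- evaluate at the basis vectors
  have h1 : ∀ i, ∑ j, b j * b j = b i ^ 2 := fun i => by
    rw [h.sum_sq_eq_of_scriO hm ht (y := EuclideanSpace.single i 1) (by simp)]
    simp [linForm]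
  have e0 := h1 0
  have e1 := h1 1
  have e2 := h1 2
  simp only [Fin.sum_univ_three] at e0 e1 e2
  have hb : ∀ i, b i ^ 2 = 0 := fun i => by
    rw [← h1 i, Fin.sum_univ_three]; linarith
  funext i
  exact pow_eq_zero_iff two_ne_zero |>.1 (hb i)

end AffineCMC

namespace AffineCMC

variable {m s₀ : ℝ} {u : E 3 → ℝ} {P φ : S2 × ℝ → ℝ} {a : ℝ}

theorem linForm_zero (y : E 3) : linForm 0 y = 0 := by simp [linForm]

theorem linGrad_zero (y : E 3) (i : Fin 3) : linGrad 0 y i = 0 := by simp [linGrad, linForm_zero]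

theorem coeff_zero_values (h : AffineCMC m s₀ u P φ a 0) {y : E 3} (hy : y ∈ sphere (0 : E 3) 1) :
    scriCoeff s₀ P 1 y = -1 / 2 ∧ scriCoeff s₀ P 2 y = 0 ∧ scriCoeff s₀ P 3 y = 3 / 4 := by
  have h1 := h.coeff_one hy
  have h2 := h.coeff_two hy
  have h3 := h.coeff_three hy
  simp only [linForm_zero] at h1 h2 h3
  rw [h1] at h3
  refine ⟨by rw [h1]; simp, by rw [h2]; simp, by rw [h3]; simp; norm_num⟩

/-- With constant boundary values, only the component along `∂ₛ` can contribute at second order. -/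
theorem scriO_devT_three (h : AffineCMC m s₀ u P φ a 0) (i k : Fin 3) :
    ScriO (fun z => (jetAt m s₀ (rayExt P) z).devT (conf 0 z) i k) 3 := by
  refine (h.scriExp_devT (scriExp_conf 0) i k).scriO_three ?_
  filter_upwards [eventually_scriFilter_pos] with z hz
  refine ⟨rfl, rfl, ?_⟩
  rw [h.hess_coeff_two hz.1]
  simp [linForm_zero, linGrad_zero]

theorem scriO_devM_three (h : AffineCMC m s₀ u P φ a 0) (i : Fin 3) :
    ScriO (fun z => (jetAt m s₀ (rayExt P) z).devM (conf 0 z) i) 3 := by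
  refine (h.scriExp_devM i).scriO_three ?_
  filter_upwards [eventually_scriFilter_pos] with z hz
  have h3 : pderiv i (scriCoeff s₀ P 3) z.1 = 0 := by
    rw [pderiv_of_eqOn_sphere (b := 0) (F := fun _ => 3 / 4) (F' := fun _ => 0)
      (h.isHomog_scriCoeff 3) (fun t => hasDerivAt_const t _)
      (fun y hy => (h.coeff_zero_values hy).2.2) hz.1]
    ring
  refine ⟨rfl, ?_, ?_⟩
  · rw [h.pderiv_coeff_two hz.1]
    simp [linGrad_zero]
  · rw [h3]
    simp [linForm_zero, linGrad_zero]

theorem scriExp_devS_const (h : AffineCMC m s₀ u P φ a 0) :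
    ScriExp (fun z => (jetAt m s₀ (rayExt P) z).devS (conf 0 z)) (fun _ => 0) (fun _ => 0)
      fun z => 1 / 2 * scriCoeff s₀ P 4 z.1 + 9 * m / 4 := by
  refine h.scriExp_devS.congr_coeff ?_
  filter_upwards [eventually_scriFilter_pos] with z hz
  obtain ⟨h1, h2, h3⟩ := h.coeff_zero_values hz.1
  rw [h1, h2, h3, linForm_zero]
  refine ⟨by ring, by ring, by ring⟩

/-- If the traceless part vanishes to third order, then the trace of the tangential part gives
`tr hess = O(s³)`, so that the component along `∂ₛ` is `O(s³)` too. -/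
theorem coeff_four (h : AffineCMC m s₀ u P φ a 0)
    (ht : ∀ i j, ScriO (fun z => (jetAt m s₀ (rayExt P) z).traceless i j) 3) {y : E 3}
    (hy : y ∈ sphere (0 : E 3) 1) : scriCoeff s₀ P 4 y = -(9 * m / 2) := by
  obtain ⟨c₂, hκ⟩ := h.exists_scriExp_tr
  have hT := h.scriO_devT_of_traceless ht
  have hE := h.scriExp_devT hκ
  have hb := h.bddJet
  have b1 := hb.p₁
  have b2 := hb.q
  -- the trace of the Hessian vanishes to third order
  have h1 : ScriO (fun z => (jetAt m s₀ (rayExt P) z).tr / 3) 3 := by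
    have h2 : ScriO (fun z => (jetAt m s₀ (rayExt P) z).tr / 3 + 1 / 2 * ∑ i,
        (jetAt m s₀ (rayExt P) z).devT ((jetAt m s₀ (rayExt P) z).tr / 3) i i) 3 := by
      refine (hκ.add ((ScriExp.sum_three fun i => hE i i).const_mul (1 / 2))).scriO_three ?_
      filter_upwards [eventually_scriFilter_pos] with z hz
      refine ⟨by simp [linForm_zero], by simp [linForm_zero], ?_⟩
      have e1 := sum_one_sub hz.1
      simp only [h.hess_coeff_two hz.1, linForm_zero, linGrad_zero, Fin.sum_univ_three] at e1 ⊢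
      linear_combination (-1 / 2 * c₂ z) * e1
    refine (h2.sub ((ScriO.sum Finset.univ fun i _ => hT i i).mul_bdd (.const (1 / 2)))).congr
      (Eventually.of_forall fun z => by ring)
  have h3 : ScriO (fun z => (jetAt m s₀ (rayExt P) z).devS (conf 0 z)) 3 := by
    refine ((h.scriO_devS_of_traceless ht).add (h1.mul_bdd (show ScriBdd fun z =>
      -2 * (jetAt m s₀ (rayExt P) z).p₁ - (jetAt m s₀ (rayExt P) z).q
        * (jetAt m s₀ (rayExt P) z).p₁ ^ 2 by fun_prop))).congr (Eventually.of_forall fun z => ?_)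
    simp only [ScriJet.devS, conf, linForm_zero]
    ring
  have h4 := h.scriExp_devS_const.zero_of_scriO_three h3 (Eventually.of_forall fun _ => ⟨rfl, rfl⟩)
    (c₀ := fun y => 1 / 2 * scriCoeff s₀ P 4 y + 9 * m / 4) (Eventually.of_forall fun _ => rfl) hy
  linarith

theorem scriO_traceless_three (h : AffineCMC m s₀ u P φ a 0)
    (h4 : ∀ y ∈ sphere (0 : E 3) 1, scriCoeff s₀ P 4 y = -(9 * m / 2)) (i j : Fin 3) :
    ScriO (fun z => (jetAt m s₀ (rayExt P) z).traceless i j) 3 := by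
  refine h.scriO_traceless (κ := conf 0) (h.scriExp_devS_const.scriO_three ?_) h.scriO_devM_three
    h.scriO_devT_three i j
  filter_upwards [eventually_scriFilter_pos] with z hz
  exact ⟨rfl, rfl, by rw [h4 z.1 hz.1]; ring⟩

end AffineCMC

/-! ### The boundary values -/

theorem scriCoeff_zero_coe (s₀ : ℝ) (P : S2 × ℝ → ℝ) (y : S2) :
    scriCoeff s₀ P 0 (y : E 3) = P (y, 0) :=
  radialExtension_coe (fun y => P (y, 0)) y

theorem ScriGraph.iteratedDerivWithin_eq {m s₀ : ℝ} {u : E 3 → ℝ} {P : S2 × ℝ → ℝ}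
    (h : ScriGraph m s₀ u P) (n : ℕ) (y : S2) :
    iteratedDerivWithin n (fun s => P (y, s)) (Ico 0 s₀) 0 = scriCoeff s₀ P n (y : E 3) := by
  have h1 : (fun s => P (y, s)) = fun s => rayExt P ((y : E 3), s) := by
    funext s; exact (radialExtension_coe (fun y => P (y, s)) y).symm
  rw [h1, iteratedDerivWithin_eq_dS n h.smooth_ext (sphere_ne_zero y.2) ⟨le_rfl, h.s₀_pos⟩]
  rfl

theorem isFirstFourCombination_iff_scriCoeff (s₀ : ℝ) (P : S2 × ℝ → ℝ) :
    (IsFirstFourCombination fun y => P (y, 0)) ↔ ∃ (a : ℝ) (b : Fin 3 → ℝ),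
      ∀ y ∈ sphere (0 : E 3) 1, scriCoeff s₀ P 0 y = a + linForm b y := by
  rw [isFirstFourCombination_iff]
  refine exists_congr fun a => exists_congr fun b => ?_
  constructor
  · intro h y hy
    exact (scriCoeff_zero_coe s₀ P ⟨y, hy⟩).trans (h ⟨y, hy⟩)
  · intro h y
    exact (scriCoeff_zero_coe s₀ P y).symm.trans (h y y.2)

theorem isBigOScri_of_le {F : E 3 → ℝ} {k l : ℕ} (hF : IsBigOScri F k) (h : l ≤ k) :
    IsBigOScri F l :=
  isBigOScri_iff.2 ((isBigOScri_iff.1 hF).of_le h)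

theorem tracelessFF_symm {m : ℝ} {u : E 3 → ℝ} {U : Set (E 3)} (h : SpacelikeOver m u U) {x : E 3}
    (hx : x ∈ U) : (tracelessFF m u x).transpose = tracelessFF m u x := by
  ext i j
  simp only [Matrix.transpose_apply, tracelessFF, Matrix.sub_apply, Matrix.smul_apply,
    secondFF_symm h hx j, inducedMetric_symm m u x j]

theorem abs_scalarCurvature_add_six {m : ℝ} {u : E 3 → ℝ} {U : Set (E 3)} (h : SpacelikeOver m u U)
    {x : E 3} (hx : x ∈ U) (hH : meanCurvature m u x = 1) :
    |scalarCurvature (inducedMetric m u) x + 6| = tracelessNorm m u x ^ 2 := by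
  have h1 := (abs_apply_le_of_posDef (h.posDef x hx) (tracelessFF_symm h hx)).1
  rw [tracelessNorm_eq_sqrt_trace h hx, Real.sq_sqrt h1, h.scalarCurvature_eq_traceless hx, hH]
  rw [one_pow, mul_one, sub_add_cancel, abs_of_nonneg h1]

end SchwarzschildCMC

theorem theorem3p3 (m s₀ : ℝ) (hm : 0 ≤ m) (hs₀ : 0 < s₀) (hms₀ : 2 * m * s₀ ≤ 1)
    (u : E 3 → ℝ) (P : S2 × ℝ → ℝ)
    -- `P = r_* - u`, as a function of `y = 𝐱 / r` and `s = 1 / r`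
    (hPu : ∀ y : S2, ∀ s ∈ Ioo 0 s₀, P (y, s) = tortoise m s⁻¹ - u (s⁻¹ • (y : E 3)))
    (hP : SmoothUpToScri s₀ P)
    -- the graph of `u` over `r > 1 / s₀` is spacelike
    (hspacelike : ∀ x : E 3, s₀⁻¹ < ‖x‖ → (inducedMetric m u x).PosDef)
    -- `s⁻³ (H - 1)` extends smoothly to `s = 0`
    (hH : ∃ φ : S2 × ℝ → ℝ, SmoothUpToScri s₀ φ ∧ ∀ y : S2, ∀ s ∈ Ioo 0 s₀,
      meanCurvature m u (s⁻¹ • (y : E 3)) = 1 + s ^ 3 * φ (y, s)) :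
    IsBigOScri (tracelessNorm m u) 1 ∧
    (IsBigOScri (tracelessNorm m u) 2 ↔ IsFirstFourCombination fun y => P (y, 0)) ∧
    ((IsFirstFourCombination fun y => P (y, 0)) ↔ IsBigOScri (tracelessNorm m u) 3) ∧
    ((∀ x : E 3, s₀⁻¹ < ‖x‖ → meanCurvature m u x = 1) →
      (IsBigOScri (tracelessNorm m u) 3 ↔
        IsBigOScri (fun x => |scalarCurvature (inducedMetric m u) x + 6|) 6)) ∧
    (0 < m →
      (IsBigOScri (tracelessNorm m u) 4 ↔
        (∃ c : ℝ, ∀ y : S2, P (y, 0) = c) ∧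
        ∀ y : S2, iteratedDerivWithin 4 (fun s => P (y, s)) (Ico 0 s₀) 0 = -(9 * m / 2))) := by
  obtain ⟨φ, hφ, hH⟩ := hH
  have h : ScriCMC m s₀ u P φ :=
    { m_nonneg := hm, s₀_pos := hs₀, two_m_s₀ := hms₀, eq_sub := hPu, smooth := hP,
      spacelike := hspacelike, φ_smooth := hφ, meanCurvature_eq := hH }
  have h23 : IsBigOScri (tracelessNorm m u) 3 → IsBigOScri (tracelessNorm m u) 2 :=
    fun h => isBigOScri_of_le h (by norm_num)
  have h2P : IsBigOScri (tracelessNorm m u) 2 → IsFirstFourCombination fun y => P (y, 0) := fun h2 =>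
    (isFirstFourCombination_iff_scriCoeff s₀ P).2
      (h.eq_add_of_scriO_traceless ((h.isBigOScri_tracelessNorm_iff 1).1 h2))
  have hP3 : (IsFirstFourCombination fun y => P (y, 0)) → IsBigOScri (tracelessNorm m u) 3 := by
    intro hF
    obtain ⟨a, b, hab⟩ := (isFirstFourCombination_iff_scriCoeff s₀ P).1 hF
    have hA : AffineCMC m s₀ u P φ a b := { h with coeff_zero := hab }
    exact (h.isBigOScri_tracelessNorm_iff 2).2 hA.scriO_traceless_two
  refine ⟨h.isBigOScri_tracelessNorm_one, ⟨h2P, fun hF => h23 (hP3 hF)⟩,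
    ⟨hP3, fun h3 => h2P (h23 h3)⟩, fun hH1 => ?_, fun hm0 => ⟨fun h4 => ?_, fun ⟨⟨c, hc⟩, hP4⟩ => ?_⟩⟩
  · have hev : ∀ᶠ x in cobounded (E 3), |scalarCurvature (inducedMetric m u) x + 6|
        = tracelessNorm m u x ^ 2 := by
      filter_upwards [(tendsto_norm_cobounded_atTop (E := E 3)).eventually_gt_atTop s₀⁻¹] with x hx
      exact abs_scalarCurvature_add_six h.spacelikeOver hx (hH1 x hx)
    have he : (fun x : E 3 => (‖x‖⁻¹) ^ 6) = fun x => ((‖x‖⁻¹) ^ 3) ^ 2 := by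
      funext x; ring
    unfold IsBigOScri
    rw [isBigO_congr hev EventuallyEq.rfl, he]
    exact ⟨fun h => h.pow 2, fun h => IsBigO.of_pow two_ne_zero h⟩
  · have ht := (h.isBigOScri_tracelessNorm_iff 3).1 h4
    obtain ⟨a, b, hab⟩ := (isFirstFourCombination_iff_scriCoeff s₀ P).1
      (h2P (isBigOScri_of_le h4 (by norm_num)))
    have hA : AffineCMC m s₀ u P φ a b := { h with coeff_zero := hab }
    obtain rfl := hA.eq_zero_of_scriO hm0 ht
    refine ⟨⟨a, fun y => ?_⟩, fun y => ?_⟩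
    · exact (scriCoeff_zero_coe s₀ P y).symm.trans ((hab y y.2).trans (by simp [linForm]))
    · exact (h.iteratedDerivWithin_eq 4 y).trans (hA.coeff_four ht y.2)
  · have hc0 : ∀ y ∈ sphere (0 : E 3) 1, scriCoeff s₀ P 0 y = c + linForm 0 y := fun y hy =>
      (scriCoeff_zero_coe s₀ P ⟨y, hy⟩).trans ((hc ⟨y, hy⟩).trans (by simp [linForm]))
    have hA : AffineCMC m s₀ u P φ c 0 := { h with coeff_zero := hc0 }
    exact (h.isBigOScri_tracelessNorm_iff 3).2 (hA.scriO_traceless_three fun y hy =>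
      (h.iteratedDerivWithin_eq 4 ⟨y, hy⟩).symm.trans (hP4 ⟨y, hy⟩))
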